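/- Let $(\Omega,\mathcal F)$ be a standard Borel space with a nonatomic probability measure $P$ (for example $(0,1)$ with Lebesgue measure), and let $G=\operatorname{Aut}(\Omega,P)$ be the group of measure preserving automorphisms of the measure algebra of $P$ (measurable sets modulo null sets, with the metric $P(A\bigtriangleup B)$), with the topology of pointwise convergence. A sub-$\sigma$-field is a $\sigma$-field $\mathcal E\subset\mathcal F$ containing all sets of $\mathcal F$ of measure zero. The set of all sub-$\sigma$-fields carries the Wijsman topology of the closed subspaces $L_2(\mathcal E)\subset L_2(\Omega,\mathcal F,P)$, that is, $\mathcal E_n\to\mathcal E$ if and only if $\operatorname{dist}(f,L_2(\mathcal E_n))\to\operatorname{dist}(f,L_2(\mathcal E))$ for every $f\in L_2(\Omega,\mathcal F,P)$. Let $X_1$ be the subspace of those $\mathcal E$ that are conditionally nonatomic, that is, almost all conditional measures of $P$ given $\mathcal E$ are nonatomic. Let $T$ be a compact subset of $[0,+\infty]$. Let $X_T$ be the set of all families $(\mathcal F_t)_{t\in T}$ in $X_1$ such that $\mathcal F_s\subset\mathcal F_t$ whenever $s\le t$, the map $T\ni t\mapsto\mathcal F_t\in X_1$ is continuous, and the sub-$\sigma$-field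 corresponding to the least element of $T$ is trivial (all its sets have probability $0$ or $1$); $X_T$ is a subspace of the space $C(T,X_1)$ with the topology of uniform convergence, and $G$ acts by $g\cdot(\mathcal F_t)_t=(g\cdot\mathcal F_t)_t$. A filtration $(\mathcal F_t)_{t\in T}\in X_T$ is called conditionally nonatomic if for all $s<t$ in $T$ there is a nonatomic sub-$\sigma$-field $\mathcal E$, independent of $\mathcal F_s$, such that $\mathcal F_t$ is generated by $\mathcal F_s$ and $\mathcal E$. Let $X^{\mathrm{cna}}_T\subset X_T$ be the set of all conditionally nonatomic filtrations. Then $X^{\mathrm{cna}}_T$ is a dense $G_\delta$ subset of $X_T$. Hence almost all filtrations are conditionally nonatomic, that is, $X^{\mathrm{cna}}_T$ is comeager in $X_T$; and $X^{\mathrm{cna}}_T$ is itself a Polish $G$-space: $G$ is a Polish group, $X^{\mathrm{cna}}_T$ is $G$-invariant and Polish in the subspace topology, and the action map $G\times X^{\mathrm{cna}}_T\to X^{\mathrm{cna}}_T$ is continuous. -/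

import Mathlib

open MeasureTheory ProbabilityTheory Set Topology
open scoped ENNReal symmDiff

namespace SigmaFields

variable {Ω : Type*} [mΩ : MeasurableSpace Ω]

/-! ### The measure algebra and its automorphism group -/

/-- The measure algebra of `P`: measurable sets modulo null sets, with the metric
`(A, B) ↦ P (A ∆ B)` (carried by `MeasuredSets P`). -/
abbrev MeasureAlgebra (P : Measure Ω) : Type _ := SeparationQuotient (MeasuredSets P)

namespace MeasureAlgebra

variable {P : Measure Ω}

/-- The class of a measurable set. -/
noncomputable def mk (P : Measure Ω) (s : Set Ω) (hs : MeasurableSet s) : MeasureAlgebra P :=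
  SeparationQuotient.mk (show MeasuredSets P from ⟨s, hs⟩)

theorem mk_eq_mk {s t : Set Ω} {hs : MeasurableSet s} {ht : MeasurableSet t} :
    mk P s hs = mk P t ht ↔ s =ᵐ[P] t := by
  refine SeparationQuotient.mk_eq_mk.trans (EMetric.inseparable_iff.trans ?_)
  rw [← measure_symmDiff_eq_zero_iff]
  rfl

theorem exists_rep (a : MeasureAlgebra P) : ∃ s, ∃ hs : MeasurableSet s, mk P s hs = a := by
  obtain ⟨s, rfl⟩ := SeparationQuotient.surjective_mk a
  exact ⟨s.1, s.2, rfl⟩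

/-- `[s] ≤ [t]` if and only if `P (s \ t) = 0`. -/
instance : LE (MeasureAlgebra P) where
  le a b := ∃ s t, ∃ (hs : MeasurableSet s) (ht : MeasurableSet t),
    mk P s hs = a ∧ mk P t ht = b ∧ s ≤ᵐ[P] t

theorem mk_le_mk {s t : Set Ω} {hs : MeasurableSet s} {ht : MeasurableSet t} :
    mk P s hs ≤ mk P t ht ↔ s ≤ᵐ[P] t := by
  constructor
  · rintro ⟨s', t', hs', ht', h1, h2, h⟩
    exact (mk_eq_mk.1 h1).symm.le.trans (h.trans (mk_eq_mk.1 h2).le)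
  · intro h
    exact ⟨s, t, hs, ht, rfl, rfl, h⟩

instance : PartialOrder (MeasureAlgebra P) where
  le_refl a := by
    obtain ⟨s, hs, rfl⟩ := exists_rep a
    exact mk_le_mk.2 (Filter.EventuallyLE.refl _ _)
  le_trans a b c := by
    obtain ⟨s, hs, rfl⟩ := exists_rep a
    obtain ⟨t, ht, rfl⟩ := exists_rep b
    obtain ⟨u, hu, rfl⟩ := exists_rep c
    simp only [mk_le_mk]
    exact fun h1 h2 => h1.trans h2
  le_antisymm a b := by
    obtain ⟨s, hs, rfl⟩ := exists_rep a
    obtain ⟨t, ht, rfl⟩ := exists_rep b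
    simp only [mk_le_mk, mk_eq_mk]
    exact fun h1 h2 => h1.antisymm h2

/-- The measure of an element of the measure algebra. -/
noncomputable def measure : MeasureAlgebra P → ℝ≥0∞ :=
  SeparationQuotient.lift (fun s : MeasuredSets P => P s) fun s t h =>
    measure_congr (mk_eq_mk.1 (SeparationQuotient.mk_eq_mk.2 h : mk P s.1 s.2 = mk P t.1 t.2))

theorem isBot_mk_empty : IsBot (mk P ∅ MeasurableSet.empty) := by
  intro a
  obtain ⟨s, hs, rfl⟩ := exists_rep a
  exact mk_le_mk.2 (LE.le.eventuallyLE (empty_subset s))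

theorem le_mk_compl_iff {s : Set Ω} (hs : MeasurableSet s) (a : MeasureAlgebra P) :
    a ≤ mk P sᶜ hs.compl ↔ ∀ d, d ≤ a → d ≤ mk P s hs → IsBot d := by
  obtain ⟨t, ht, rfl⟩ := exists_rep a
  constructor
  · intro h d hd1 hd2
    obtain ⟨u, hu, rfl⟩ := exists_rep d
    have h1 : u ≤ᵐ[P] sᶜ := (mk_le_mk.1 hd1).trans (mk_le_mk.1 h)
    have h2 : u ≤ᵐ[P] s := mk_le_mk.1 hd2
    have h3 : mk P u hu ≤ mk P ∅ MeasurableSet.empty := by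
      rw [mk_le_mk]
      filter_upwards [h1, h2] with x hx1 hx2 hx
      exact hx1 hx (hx2 hx)
    exact fun b => h3.trans (isBot_mk_empty b)
  · intro h
    have h1 := h (mk P (t ∩ s) (ht.inter hs))
      (mk_le_mk.2 (LE.le.eventuallyLE inter_subset_left))
      (mk_le_mk.2 (LE.le.eventuallyLE inter_subset_right))
      (mk P ∅ MeasurableSet.empty)
    rw [mk_le_mk] at h1 ⊢
    filter_upwards [h1] with x hx hxt hxs
    exact hx ⟨hxt, hxs⟩

theorem isLUB_mk_iUnion {f : ℕ → Set Ω} (hf : ∀ n, MeasurableSet (f n)) :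
    IsLUB (range fun n => mk P (f n) (hf n)) (mk P (⋃ n, f n) (MeasurableSet.iUnion hf)) := by
  constructor
  · rintro _ ⟨n, rfl⟩
    exact mk_le_mk.2 (LE.le.eventuallyLE (subset_iUnion f n))
  · intro b hb
    obtain ⟨t, ht, rfl⟩ := exists_rep b
    have h : ∀ᵐ x ∂P, ∀ n, x ∈ f n → x ∈ t :=
      ae_all_iff.2 fun n => mk_le_mk.1 (hb ⟨n, rfl⟩)
    rw [mk_le_mk]
    filter_upwards [h] with x hx hxU
    obtain ⟨n, hn⟩ := mem_iUnion.1 hxU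
    exact hx n hn

end MeasureAlgebra

/-- The group of measure preserving automorphisms of the measure algebra (an order automorphism
of a Boolean algebra preserves all Boolean operations). -/
noncomputable def autSubgroup (P : Measure Ω) : Subgroup (MeasureAlgebra P ≃o MeasureAlgebra P) where
  carrier := {g | ∀ a, (g a).measure = a.measure}
  mul_mem' {g h} hg hh a := by
    rw [RelIso.mul_apply, hg, hh]
  one_mem' a := rfl
  inv_mem' {g} hg a := by
    rw [← hg (g⁻¹ a), RelIso.apply_inv_self]

/-- `Aut P`, the group of measure preserving automorphisms modulo null sets. -/
abbrev Aut (P : Measure Ω) : Type _ := autSubgroup P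

/-- The topology of pointwise convergence in the metric of the measure algebra. -/
noncomputable instance (P : Measure Ω) : TopologicalSpace (Aut P) :=
  TopologicalSpace.induced
    (fun (g : Aut P) (a : MeasureAlgebra P) =>
      (g : MeasureAlgebra P ≃o MeasureAlgebra P) a) inferInstance

/-! ### The space of sub-σ-fields -/

/-- A sub-σ-field: a σ-field of measurable sets that contains all sets of measure zero. -/
structure SubSigmaField (P : Measure Ω) where
  /-- The underlying σ-field. -/
  toMS : MeasurableSpace Ω
  le : toMS ≤ mΩ
  null_mem : ∀ s, MeasurableSet[mΩ] s → P s = 0 → MeasurableSet[toMS] s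

namespace SubSigmaField

variable {P : Measure Ω}

theorem ext' {E F : SubSigmaField P} (h : E.toMS = F.toMS) : E = F := by
  cases E
  cases F
  cases h
  rfl

/-- Sub-σ-fields are ordered by inclusion. -/
instance : PartialOrder (SubSigmaField P) :=
  PartialOrder.lift SubSigmaField.toMS fun _ _ h => SubSigmaField.ext' h

/-- The Wijsman topology on sub-σ-fields, a sub-σ-field `E` being identified with the closed
subspace `L₂(E)` of `L₂(P)`: the coarsest topology for which the distance from every fixed
`f ∈ L₂(P)` to `L₂(E)` depends continuously on `E`. (For linear subspaces it makes no difference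
whether the distance is truncated at `1`.) -/
noncomputable instance : TopologicalSpace (SubSigmaField P) :=
  TopologicalSpace.induced
    (fun (E : SubSigmaField P) (f : Lp ℝ 2 P) =>
      Metric.infDist f (lpMeas ℝ ℝ E.toMS 2 P : Set (Lp ℝ 2 P))) inferInstance

/-- A measurable set almost equal to a set of the sub-σ-field belongs to the sub-σ-field. -/
theorem measurableSet_congr (E : SubSigmaField P) {s t : Set Ω} (hs : MeasurableSet[E.toMS] s)
    (ht : MeasurableSet t) (h : s =ᵐ[P] t) : MeasurableSet[E.toMS] t := by
  have h0 := measure_symmDiff_eq_zero_iff.2 h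
  have hs' := E.le s hs
  have h1 : MeasurableSet[E.toMS] (s \ t) :=
    E.null_mem _ (hs'.diff ht) (measure_mono_null subset_union_left h0)
  have h2 : MeasurableSet[E.toMS] (t \ s) :=
    E.null_mem _ (ht.diff hs') (measure_mono_null subset_union_right h0)
  have h3 : t = (s \ (s \ t)) ∪ (t \ s) := by
    ext x
    simp only [mem_union, Set.mem_sdiff]
    tauto
  rw [h3]
  exact (hs.diff h1).union h2

/-- Membership in the image of a sub-σ-field under an automorphism. -/
def MemImage (g : Aut P) (E : SubSigmaField P) (s : Set Ω) : Prop :=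
  ∃ hs : MeasurableSet[mΩ] s, ∃ t, ∃ ht : MeasurableSet[E.toMS] t,
    g.1 (MeasureAlgebra.mk P t (E.le t ht)) = MeasureAlgebra.mk P s hs

theorem memImage_empty (g : Aut P) (E : SubSigmaField P) : MemImage g E ∅ := by
  refine ⟨MeasurableSet.empty, ∅, @MeasurableSet.empty Ω E.toMS, ?_⟩
  refine le_antisymm ?_ (MeasureAlgebra.isBot_mk_empty _)
  have h := MeasureAlgebra.isBot_mk_empty (P := P)
    (g.1.symm (MeasureAlgebra.mk P ∅ MeasurableSet.empty))
  exact g.1.le_symm_apply.1 h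

theorem memImage_compl {g : Aut P} {E : SubSigmaField P} {s : Set Ω} (h : MemImage g E s) :
    MemImage g E sᶜ := by
  obtain ⟨hs, t, ht, e⟩ := h
  refine ⟨hs.compl, tᶜ, ht.compl, ?_⟩
  refine eq_of_forall_le_iff fun a => ?_
  obtain ⟨a, rfl⟩ := g.1.surjective a
  rw [g.1.le_iff_le, MeasureAlgebra.le_mk_compl_iff hs, ← e,
    MeasureAlgebra.le_mk_compl_iff (E.le t ht)]
  refine Iff.trans (forall_congr' fun d => ?_) g.1.surjective.forall.symm
  have : IsBot (g.1 d) ↔ IsBot d :=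
    g.1.surjective.forall.trans (forall_congr' fun x => g.1.le_iff_le)
  rw [g.1.le_iff_le, g.1.le_iff_le, this]

theorem memImage_iUnion {g : Aut P} {E : SubSigmaField P} {f : ℕ → Set Ω}
    (h : ∀ n, MemImage g E (f n)) : MemImage g E (⋃ n, f n) := by
  choose hs t ht e using h
  refine ⟨MeasurableSet.iUnion hs, ⋃ n, t n, MeasurableSet.iUnion ht, ?_⟩
  have h1 := (g.1.isLUB_image'.2 (MeasureAlgebra.isLUB_mk_iUnion (P := P) fun n => E.le _ (ht n)))
  rw [← range_comp] at h1
  have h2 := MeasureAlgebra.isLUB_mk_iUnion (P := P) hs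
  have h3 : (fun n => MeasureAlgebra.mk P (f n) (hs n)) =
      g.1 ∘ fun n => MeasureAlgebra.mk P (t n) (E.le _ (ht n)) := funext fun n => (e n).symm
  rw [h3] at h2
  exact h1.unique h2

/-- The image `g • E = {g A : A ∈ E}` of a sub-σ-field under an automorphism. -/
instance : SMul (Aut P) (SubSigmaField P) where
  smul g E :=
    { toMS :=
        { MeasurableSet' := MemImage g E
          measurableSet_empty := by
            exact memImage_empty g E
          measurableSet_compl := fun _ h => memImage_compl h
          measurableSet_iUnion := fun _ h => memImage_iUnion h }
      le := fun _ h => h.1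
      null_mem := fun s hs h0 => by
        obtain ⟨_, t, ht, e⟩ := memImage_empty g E
        exact ⟨hs, t, ht, e.trans (MeasureAlgebra.mk_eq_mk.2 (ae_eq_empty.2 h0).symm)⟩ }

theorem measurableSet_smul_iff {g : Aut P} {E : SubSigmaField P} {s : Set Ω} :
    MeasurableSet[(g • E).toMS] s ↔ MemImage g E s := Iff.rfl

/-- The natural action of `Aut P` on sub-σ-fields. -/
instance : MulAction (Aut P) (SubSigmaField P) where
  one_smul E := by
    refine SubSigmaField.ext' (MeasurableSpace.ext fun s => ?_)
    rw [measurableSet_smul_iff]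
    constructor
    · rintro ⟨hs, t, ht, e⟩
      exact E.measurableSet_congr ht hs (MeasureAlgebra.mk_eq_mk.1 e)
    · intro hs
      exact ⟨E.le s hs, s, hs, rfl⟩
  mul_smul g h E := by
    refine SubSigmaField.ext' (MeasurableSpace.ext fun s => ?_)
    rw [measurableSet_smul_iff, measurableSet_smul_iff]
    constructor
    · rintro ⟨hs, t, ht, e⟩
      obtain ⟨u, hu, e'⟩ := MeasureAlgebra.exists_rep (h.1 (MeasureAlgebra.mk P t (E.le t ht)))
      refine ⟨hs, u, ⟨hu, t, ht, e'.symm⟩, ?_⟩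
      rw [e', ← e]
      rfl
    · rintro ⟨hs, u, ⟨hu, t, ht, e'⟩, e⟩
      refine ⟨hs, t, ht, ?_⟩
      rw [← e, ← e']
      rfl

/-- The trivial sub-σ-field: all its sets have measure `0` or `1`. -/
def IsTrivial (E : SubSigmaField P) : Prop :=
  ∀ s, MeasurableSet[E.toMS] s → P s = 0 ∨ P s = 1

/-- A sub-σ-field is nonatomic if each of its sets of positive measure contains another one of
strictly smaller positive measure. -/
def IsNonatomic (E : SubSigmaField P) : Prop :=
  ∀ s, MeasurableSet[E.toMS] s → 0 < P s →
    ∃ t, t ⊆ s ∧ MeasurableSet[E.toMS] t ∧ 0 < P t ∧ P t < P s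

/-- `E₂ | E₁` is nonatomic: `E₂` is the product of `E₁` and some nonatomic sub-σ-field, that is,
`E₂` is generated by `E₁` and a nonatomic sub-σ-field independent of `E₁`. -/
def IsNonatomicOver (E₂ E₁ : SubSigmaField P) : Prop :=
  ∃ F : SubSigmaField P, F.IsNonatomic ∧ Indep E₁.toMS F.toMS P ∧ E₁.toMS ⊔ F.toMS = E₂.toMS

/-- The set of conditionally nonatomic sub-σ-fields `E`: almost all conditional measures of `P`
given `E` have no atoms. -/
def condNonatomic (P : Measure Ω) [StandardBorelSpace Ω] [IsFiniteMeasure P] :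
    Set (SubSigmaField P) :=
  {E | ∀ᵐ ω ∂P, NullSingletonClass (condExpKernel P E.toMS ω)}

end SubSigmaField

/-! ### Spaces of filtrations -/

open SubSigmaField

variable [StandardBorelSpace Ω]

/-- Continuous filtrations indexed by `T`: continuous nondecreasing maps from `T` to the space of
conditionally nonatomic sub-σ-fields, starting (at the least element of `T`) with the trivial
sub-σ-field. The space of continuous maps carries the topology of uniform convergence (which is
the compact-open topology, as `T` is compact). -/
def filtrationSpace (P : Measure Ω) [IsFiniteMeasure P] (T : Set ℝ≥0∞) :
    Set C(T, condNonatomic P) :=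
  {F | (∀ s t : T, s ≤ t → (F s : SubSigmaField P) ≤ F t) ∧
    ∀ t : T, IsLeast T (t : ℝ≥0∞) → (F t : SubSigmaField P).IsTrivial}

/-- Conditionally nonatomic filtrations. -/
def cnaFiltrations (P : Measure Ω) [IsFiniteMeasure P] (T : Set ℝ≥0∞) :
    Set (filtrationSpace P T) :=
  {F | ∀ s t : T, s < t → (F.1 t : SubSigmaField P).IsNonatomicOver (F.1 s)}

/-- `X` with the given action is a Polish `G`-space. -/
structure IsPolishGSpace (G X : Type*) [Group G] [TopologicalSpace G] [TopologicalSpace X]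
    [MulAction G X] : Prop where
  isTopologicalGroup : IsTopologicalGroup G
  polishSpace_group : PolishSpace G
  polishSpace : PolishSpace X
  continuous_smul : Continuous fun p : G × X => p.1 • p.2

end SigmaFields

open MeasureTheory ProbabilityTheory Set Topology
open scoped ENNReal symmDiff

set_option linter.unusedSectionVars false

namespace SigmaFields

/-! ### Polish spaces -/

/-! A sub-σ-field is identified with its conditional expectation, the orthogonal projection onto
L₂(E). Pythagoras and polarization turn the Wijsman topology into the strong operator topology on
these projections (`isInducing_proj`), and a strong limit of conditional expectations is again a
conditional expectation (`exists_proj_eq_of_tendsto`); hence the sub-σ-fields form a Polish space.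
In the same way an automorphism is identified with its Koopman operator, which makes `Aut P` a
Polish group acting continuously.

The crux is a quantitative form of nonatomicity. Let the energy of a finite partition given E be the
sum over its cells A of ‖E.proj 1_A‖², that is, the mean of Σ P(A|E)². `RelNonatomic E F` asks for
F-measurable partitions of arbitrarily small energy. This amounts to a generator of F having
nonatomic conditional laws given E; when F is the whole σ-field it is membership in `condNonatomic`
(`mem_condNonatomic_iff`). If E ⊆ F, the conditional distribution function of a generator, evaluated
at the generator itself, is uniform, independent of E, and generates F together with E. This gives
`isNonatomicOver_iff`.

Gδ: that some partition has small energy given E and is nearly F-measurable is an open condition on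
(E, F), and countably many such conditions amount to `RelNonatomic` (`relNonatomic_iff`).
Compactness of the set of pairs s ≤ q < q' ≤ t takes care of the quantifiers over times
(`isGδ_cnaFiltrations`).

Density: the largest field M of a filtration F is conditionally nonatomic, so there are independent
uniform variables U k, jointly independent of M. Replace F t by its join with the variables min (U
k) (h t), k ≥ n, where h increases strictly from 0. Between times s and t each such U k reveals
whether it falls in [h s, h t); infinitely many fresh independent events make the new filtration
conditionally nonatomic (`relNonatomic_noise`). As n grows, the tail of the noise becomes irrelevant
to every fixed function, uniformly in time, so the new filtrations converge to F. -/

theorem polishSpace_of_isGδ {X : Type*} [TopologicalSpace X] [PolishSpace X] {s : Set X}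
    (hs : IsGδ s) : PolishSpace s := by
  obtain ⟨U, hU, rfl⟩ := isGδ_iff_eq_iInter_nat.1 hs
  have hP : ∀ n, PolishSpace (U n) := fun n => (hU n).polishSpace
  -- The diagonal embedding: each open `U n` is Polish, and the image is closed because `X` is
  -- Hausdorff.
  let f : (⋂ n, U n : Set X) → X × (∀ n, U n) := fun x => (x.1, fun n => ⟨x.1, mem_iInter.1 x.2 n⟩)
  have hf : Continuous f :=
    continuous_subtype_val.prodMk (continuous_pi fun n => continuous_subtype_val.subtype_mk _)
  have hr : range f = {p | ∀ n, (p.2 n : X) = p.1} := by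
    ext p
    constructor
    · rintro ⟨x, rfl⟩ n
      rfl
    · intro h
      refine ⟨⟨p.1, mem_iInter.2 fun n => h n ▸ (p.2 n).2⟩, ?_⟩
      refine Prod.ext rfl (funext fun n => Subtype.ext (h n).symm)
  have hcl : IsClosed (range f) := by
    rw [hr, ofPred_forall]
    exact isClosed_iInter fun n => isClosed_eq
      (continuous_subtype_val.comp ((continuous_apply n).comp continuous_snd)) continuous_fst
  have hind : IsInducing f :=
    IsInducing.of_comp hf continuous_fst IsInducing.subtypeVal
  have hinj : Function.Injective f := fun x y h => Subtype.ext (congrArg Prod.fst h)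
  exact IsClosedEmbedding.polishSpace ⟨⟨hind, hinj⟩, hcl⟩

/-- A space of nonexpansive self-maps of a Polish metric space that is closed under pointwise
limits of sequences is Polish in the topology of pointwise convergence. -/
theorem polishSpace_of_nonexpansive {X A : Type*} [TopologicalSpace X] [MetricSpace A]
    [CompleteSpace A] [TopologicalSpace.SeparableSpace A] (ρ : X → A → A)
    (hind : IsInducing ρ) (hinj : Function.Injective ρ)
    (hlip : ∀ x, LipschitzWith 1 (ρ x))
    (hlim : ∀ (u : ℕ → X) (p : A → A),
      (∀ a, Filter.Tendsto (fun n => ρ (u n) a) Filter.atTop (𝓝 (p a))) → ∃ x, ρ x = p) :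
    PolishSpace X := by
  cases isEmpty_or_nonempty A with
  | inl h =>
    have hsub : Subsingleton X := ⟨fun x y => hinj (Subsingleton.elim _ _)⟩
    have : DiscreteTopology X := inferInstance
    have : Countable X := inferInstance
    infer_instance
  | inr h =>
  have hP : PolishSpace A := inferInstance
  let D := TopologicalSpace.denseSeq A
  have hD : DenseRange D := TopologicalSpace.denseRange_denseSeq A
  -- Because the maps are nonexpansive, their values on a dense sequence determine both the topology
  -- and pointwise limits, so `X` becomes a closed subspace of a countable power of `A`.
  let f : X → ℕ → A := fun x n => ρ x (D n)
  have hfc : Continuous f :=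
    continuous_pi fun n => (continuous_apply (D n)).comp hind.continuous
  have hfind : IsInducing f := by
    rw [isInducing_iff_nhds]
    intro x
    refine le_antisymm (Filter.map_le_iff_le_comap.1 hfc.continuousAt) ?_
    rw [hind.nhds_eq_comap, ← Filter.map_le_iff_le_comap, ← Filter.Tendsto, tendsto_pi_nhds]
    intro a
    rw [Metric.tendsto_nhds]
    intro ε hε
    obtain ⟨n, hn⟩ := hD.exists_dist_lt a (show 0 < ε / 3 by positivity)
    have hev : ∀ᶠ y in Filter.comap f (𝓝 (f x)), dist (f y n) (f x n) < ε / 3 := by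
      have := (((continuous_apply n).tendsto (f x)).comp Filter.tendsto_comap :
        Filter.Tendsto ((fun g : ℕ → A => g n) ∘ f) _ _)
      exact Metric.tendsto_nhds.1 this _ (by positivity)
    filter_upwards [hev] with y hy
    have h1 := (hlip y).dist_le_mul a (D n)
    have h2 := (hlip x).dist_le_mul (D n) a
    simp only [NNReal.coe_one, one_mul] at h1 h2
    rw [dist_comm (D n)] at h2
    have h3 := dist_triangle4 (ρ y a) (ρ y (D n)) (ρ x (D n)) (ρ x a)
    change dist (ρ y (D n)) (ρ x (D n)) < _ at hy
    linarith
  have hfinj : Function.Injective f := by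
    intro x y hxy
    refine hinj (hD.equalizer (hlip x).continuous (hlip y).continuous ?_)
    exact hxy
  have hcl : IsClosed (range f) := by
    refine IsSeqClosed.isClosed fun v b hv hb => ?_
    choose u hu using hv
    have hb' : ∀ n, Filter.Tendsto (fun k => ρ (u k) (D n)) Filter.atTop (𝓝 (b n)) := by
      intro n
      have := (tendsto_pi_nhds.1 hb) n
      simpa only [← hu] using this
    have hcau : ∀ a, ∃ c, Filter.Tendsto (fun k => ρ (u k) a) Filter.atTop (𝓝 c) := by
      intro a
      refine cauchySeq_tendsto_of_complete (Metric.cauchySeq_iff'.2 fun ε hε => ?_)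
      obtain ⟨n, hn⟩ := hD.exists_dist_lt a (show 0 < ε / 3 by positivity)
      obtain ⟨N, hN⟩ := Metric.cauchySeq_iff'.1 (hb' n).cauchySeq (ε / 3) (by positivity)
      refine ⟨N, fun k hk => ?_⟩
      have h1 := (hlip (u k)).dist_le_mul a (D n)
      have h2 := (hlip (u N)).dist_le_mul (D n) a
      simp only [NNReal.coe_one, one_mul] at h1 h2
      rw [dist_comm (D n)] at h2
      have h3 := dist_triangle4 (ρ (u k) a) (ρ (u k) (D n)) (ρ (u N) (D n)) (ρ (u N) a)
      have h4 := hN k hk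
      linarith
    choose p hp using hcau
    obtain ⟨x, hx⟩ := hlim u p hp
    refine ⟨x, funext fun n => ?_⟩
    change ρ x (D n) = b n
    rw [hx]
    exact tendsto_nhds_unique (hp _) (hb' n)
  exact IsClosedEmbedding.polishSpace ⟨⟨hfind, hfinj⟩, hcl⟩

/-- Continuous maps from a compact metrizable space to a Polish space form a Polish space. -/
theorem polishSpace_continuousMap {T X : Type*} [TopologicalSpace T] [CompactSpace T]
    [SecondCountableTopology T] [TopologicalSpace.MetrizableSpace T] [TopologicalSpace X] [PolishSpace X] :
    PolishSpace C(T, X) := by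
  let := TopologicalSpace.upgradeIsCompletelyMetrizable X
  infer_instance

end SigmaFields

namespace SigmaFields

variable {Ω : Type*} [mΩ : MeasurableSpace Ω] {P : Measure Ω}

/-! ### Indicators in `L²` -/

theorem norm_sq_eq_integral (f : Lp ℝ 2 P) : ‖f‖ ^ 2 = ∫ x, (f x) ^ 2 ∂P := by
  rw [← real_inner_self_eq_norm_sq, L2.inner_def]
  refine integral_congr_ae (Filter.Eventually.of_forall fun x => ?_)
  simp [sq]

variable [IsProbabilityMeasure P]

/-- The class in `L²(P)` of the indicator of a measurable set (zero if the set is not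
measurable). -/
noncomputable def indLp (P : Measure Ω) [IsProbabilityMeasure P] (s : Set Ω) : Lp ℝ 2 P :=
  open Classical in
  if h : MeasurableSet s then indicatorConstLp 2 h (measure_ne_top P s) 1 else 0

theorem indLp_of_measurableSet {s : Set Ω} (hs : MeasurableSet s) :
    indLp P s = indicatorConstLp 2 hs (measure_ne_top P s) 1 := dif_pos hs

theorem coeFn_indLp {s : Set Ω} (hs : MeasurableSet s) :
    indLp P s =ᵐ[P] s.indicator fun _ => (1 : ℝ) := by
  rw [indLp_of_measurableSet hs]
  exact indicatorConstLp_coeFn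

theorem indLp_congr {s t : Set Ω} (hs : MeasurableSet s) (ht : MeasurableSet t) (h : s =ᵐ[P] t) :
    indLp P s = indLp P t := by
  refine Lp.ext ((coeFn_indLp hs).trans (Filter.EventuallyEq.trans ?_ (coeFn_indLp ht).symm))
  exact indicator_ae_eq_of_ae_eq_set h

theorem inner_indLp {s t : Set Ω} (hs : MeasurableSet s) (ht : MeasurableSet t) :
    inner ℝ (indLp P s) (indLp P t) = P.real (s ∩ t) := by
  rw [L2.inner_def, ← integral_indicator_one (hs.inter ht)]
  refine integral_congr_ae ?_
  filter_upwards [coeFn_indLp (P := P) hs, coeFn_indLp (P := P) ht] with x h1 h2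
  rw [h1, h2]
  by_cases hxs : x ∈ s <;> by_cases hxt : x ∈ t <;> simp [hxs, hxt]

theorem norm_indLp_sq {s : Set Ω} (hs : MeasurableSet s) : ‖indLp P s‖ ^ 2 = P.real s := by
  rw [← real_inner_self_eq_norm_sq, inner_indLp hs hs, inter_self]

theorem norm_indLp_sub_sq {s t : Set Ω} (hs : MeasurableSet s) (ht : MeasurableSet t) :
    ‖indLp P s - indLp P t‖ ^ 2 = P.real (s ∆ t) := by
  rw [norm_sq_eq_integral, ← integral_indicator_one (hs.symmDiff ht)]
  refine integral_congr_ae ?_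
  filter_upwards [coeFn_indLp (P := P) hs, coeFn_indLp (P := P) ht,
    Lp.coeFn_sub (indLp P s) (indLp P t)] with x h1 h2 h3
  rw [h3, Pi.sub_apply, h1, h2]
  by_cases hxs : x ∈ s <;> by_cases hxt : x ∈ t <;> simp [hxs, hxt, mem_symmDiff]

theorem ae_eq_of_indLp_eq {s t : Set Ω} (hs : MeasurableSet s) (ht : MeasurableSet t)
    (h : indLp P s = indLp P t) : s =ᵐ[P] t := by
  rw [← measure_symmDiff_eq_zero_iff]
  have := norm_indLp_sub_sq (P := P) hs ht
  rw [h, sub_self, norm_zero] at this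
  simpa [Measure.real, ENNReal.toReal_eq_zero_iff] using this.symm

theorem indLp_compl {s : Set Ω} (hs : MeasurableSet s) :
    indLp P sᶜ = indLp P univ - indLp P s := by
  refine Lp.ext ?_
  filter_upwards [coeFn_indLp (P := P) hs, coeFn_indLp (P := P) hs.compl,
    coeFn_indLp (P := P) MeasurableSet.univ,
    Lp.coeFn_sub (indLp P univ) (indLp P s)] with x h1 h2 h3 h4
  rw [h4, Pi.sub_apply, h1, h2, h3]
  by_cases hx : x ∈ s <;> simp [hx]

theorem indLp_union {s t : Set Ω} (hs : MeasurableSet s) (ht : MeasurableSet t)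
    (h : Disjoint s t) : indLp P (s ∪ t) = indLp P s + indLp P t := by
  refine Lp.ext ?_
  filter_upwards [coeFn_indLp (P := P) hs, coeFn_indLp (P := P) (hs.union ht),
    coeFn_indLp (P := P) ht,
    Lp.coeFn_add (indLp P s) (indLp P t)] with x h1 h2 h3 h4
  rw [h4, Pi.add_apply, h1, h2, h3, indicator_union_of_disjoint h]

theorem indLp_empty : indLp P (∅ : Set Ω) = 0 := by
  rw [indLp_of_measurableSet MeasurableSet.empty]
  exact indicatorConstLp_empty

theorem tendsto_indLp_iUnion {s : ℕ → Set Ω} (hs : ∀ n, MeasurableSet (s n)) (hm : Monotone s) :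
    Filter.Tendsto (fun n => indLp P (s n)) Filter.atTop (𝓝 (indLp P (⋃ n, s n))) := by
  rw [indLp_of_measurableSet (MeasurableSet.iUnion hs)]
  simp_rw [fun n => indLp_of_measurableSet (P := P) (hs n)]
  refine tendsto_indicatorConstLp_set (by norm_num) ?_
  have h1 := tendsto_measure_iInter_atTop (μ := P) (s := fun n => (⋃ n, s n) \ s n)
    (fun n => ((MeasurableSet.iUnion hs).diff (hs n)).nullMeasurableSet)
    (fun a b h => sdiff_subset_sdiff_right (hm h)) ⟨0, measure_ne_top _ _⟩
  have h2 : ⋂ n, (⋃ n, s n) \ s n = ∅ := by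
    rw [← sdiff_iUnion, sdiff_self]
  rw [h2, measure_empty] at h1
  refine h1.congr fun n => ?_
  rw [Set.symmDiff_def, sdiff_eq_empty.2 (subset_iUnion s n), empty_union]
  rfl

/-- A closed subspace of `L²(P)` containing the indicators of a π-system contains `L²` of the
σ-field generated by it. -/
theorem mem_of_aestronglyMeasurable {Ω : Type*} {m mΩ : MeasurableSpace Ω} {P : Measure Ω}
    [IsProbabilityMeasure P] {V : Submodule ℝ (Lp ℝ 2 P)}
    (hV : IsClosed (V : Set (Lp ℝ 2 P))) (hm : m ≤ mΩ)
    {C : Set (Set Ω)} (hmC : m = MeasurableSpace.generateFrom C) (hC : IsPiSystem C)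
    (huniv : indLp P univ ∈ V) (hCV : ∀ s ∈ C, indLp P s ∈ V)
    {f : Lp ℝ 2 P} (hf : AEStronglyMeasurable[m] f P) : f ∈ V := by
  have hset : ∀ s, MeasurableSet[m] s → indLp P s ∈ V := by
    refine MeasurableSpace.induction_on_inter (C := fun s _ => indLp P s ∈ V) hmC hC ?_ hCV ?_ ?_
    · rw [indLp_empty]
      exact V.zero_mem
    · intro s hs h
      rw [indLp_compl (hm s hs)]
      exact V.sub_mem huniv h
    -- Finite partial unions have indicators that are sums, and these converge in L² to the
    -- indicator of the whole union.
    · intro g hd hg h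
      have hacc : ∀ n, MeasurableSet (accumulate g n) := fun n =>
        MeasurableSet.biUnion (to_countable _) fun i _ => hm _ (hg i)
      have h1 : ∀ n, indLp P (accumulate g n) ∈ V := by
        intro n
        induction n with
        | zero => simpa using h 0
        | succ n ih =>
          rw [accumulate_succ, indLp_union (hacc n) (hm _ (hg _))
            (disjoint_accumulate hd (Nat.lt_succ_self n))]
          exact V.add_mem ih (h _)
      have h2 := tendsto_indLp_iUnion (P := P) hacc monotone_accumulate
      rw [iUnion_accumulate] at h2
      exact hV.mem_of_tendsto h2 (Filter.Eventually.of_forall h1)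
  refine Lp.induction_stronglyMeasurable hm (by norm_num) (fun f => f ∈ V) ?_ ?_ ?_ f hf
  · intro c s hs hμs
    have h1 : ((Lp.simpleFunc.indicatorConst 2 (hm s hs) hμs.ne c : Lp.simpleFunc ℝ 2 P) :
        Lp ℝ 2 P) = c • indLp P s := by
      rw [Lp.simpleFunc.coe_indicatorConst, indLp_of_measurableSet (hm s hs)]
      refine Lp.ext ?_
      filter_upwards [indicatorConstLp_coeFn (p := 2) (hs := hm s hs) (hμs := hμs.ne) (c := c),
        indicatorConstLp_coeFn (p := 2) (hs := hm s hs) (hμs := hμs.ne) (c := (1 : ℝ)),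
        Lp.coeFn_smul c (indicatorConstLp 2 (hm s hs) hμs.ne (1 : ℝ))] with x h1 h2 h3
      rw [h1, h3, Pi.smul_apply, h2]
      by_cases hx : x ∈ s <;> simp [hx]
    rw [h1]
    exact V.smul_mem c (hset s hs)
  · intro f g hf hg _ _ _ h1 h2
    exact V.add_mem h1 h2
  · exact hV.preimage continuous_subtype_val

/-! ### Conditional expectations as orthogonal projections in L². -/

namespace SubSigmaField

instance (E : SubSigmaField P) : CompleteSpace (lpMeas ℝ ℝ E.toMS 2 P) := by
  have : Fact (E.toMS ≤ mΩ) := ⟨E.le⟩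
  infer_instance

/-- The orthogonal projection onto `L²(E)`, that is, the conditional expectation given `E`. -/
noncomputable def proj (E : SubSigmaField P) : Lp ℝ 2 P →L[ℝ] Lp ℝ 2 P :=
  (lpMeas ℝ ℝ E.toMS 2 P).starProjection

variable (E : SubSigmaField P)

theorem aestronglyMeasurable_proj (f : Lp ℝ 2 P) : AEStronglyMeasurable[E.toMS] (E.proj f) P :=
  mem_lpMeas_iff_aestronglyMeasurable.1
    (Submodule.starProjection_apply_mem (lpMeas ℝ ℝ E.toMS 2 P) f)

theorem proj_eq_self {f : Lp ℝ 2 P} : E.proj f = f ↔ AEStronglyMeasurable[E.toMS] f P :=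
  Submodule.starProjection_eq_self_iff.trans mem_lpMeas_iff_aestronglyMeasurable

theorem norm_proj_le (f : Lp ℝ 2 P) : ‖E.proj f‖ ≤ ‖f‖ :=
  Submodule.norm_starProjection_apply_le _ f

theorem inner_proj_left (f g : Lp ℝ 2 P) : inner ℝ (E.proj f) g = inner ℝ f (E.proj g) :=
  Submodule.inner_starProjection_left_eq_right _ f g

theorem proj_proj (f : Lp ℝ 2 P) : E.proj (E.proj f) = E.proj f :=
  E.proj_eq_self.2 (E.aestronglyMeasurable_proj f)

theorem inner_proj_self (f : Lp ℝ 2 P) : inner ℝ (E.proj f) f = ‖E.proj f‖ ^ 2 := by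
  rw [← real_inner_self_eq_norm_sq, inner_proj_left, inner_proj_left, proj_proj]

theorem infDist_eq (f : Lp ℝ 2 P) :
    Metric.infDist f (lpMeas ℝ ℝ E.toMS 2 P : Set (Lp ℝ 2 P)) = ‖f - E.proj f‖ := by
  rw [Metric.infDist_eq_iInf, proj, Submodule.starProjection_minimal]
  simp only [dist_eq_norm]
  rfl

/-- Pythagoras: the distances that define the topology are traded for norms of projections. -/
theorem norm_proj_sq (f : Lp ℝ 2 P) :
    ‖E.proj f‖ ^ 2 = ‖f‖ ^ 2 -
      Metric.infDist f (lpMeas ℝ ℝ E.toMS 2 P : Set (Lp ℝ 2 P)) ^ 2 := by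
  rw [infDist_eq, norm_sub_sq_real, real_inner_comm, inner_proj_self]
  ring

theorem proj_eq_of_inner {f g : Lp ℝ 2 P} (hg : AEStronglyMeasurable[E.toMS] g P)
    (h : ∀ w : Lp ℝ 2 P, AEStronglyMeasurable[E.toMS] w P → inner ℝ (f - g) w = 0) :
    E.proj f = g :=
  (Submodule.eq_starProjection_of_mem_of_inner_eq_zero
    (mem_lpMeas_iff_aestronglyMeasurable.2 hg)
    fun w hw => h w (mem_lpMeas_iff_aestronglyMeasurable.1 hw))

theorem proj_proj_of_le {E F : SubSigmaField P} (h : E ≤ F) (f : Lp ℝ 2 P) :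
    E.proj (F.proj f) = E.proj f := by
  refine E.proj_eq_of_inner (E.aestronglyMeasurable_proj f) fun w hw => ?_
  rw [inner_sub_left, inner_proj_left, inner_proj_left, F.proj_eq_self.2 (hw.mono h),
    E.proj_eq_self.2 hw, sub_self]

theorem proj_toLp_ae_eq {f : Ω → ℝ} (hf : MemLp f 2 P) :
    E.proj (hf.toLp f) =ᵐ[P] P[f | E.toMS] :=
  hf.condExpL2_ae_eq_condExp (𝕜 := ℝ) E.le

theorem proj_indLp_ae_eq {s : Set Ω} (hs : MeasurableSet s) :
    E.proj (indLp P s) =ᵐ[P] P⟦s | E.toMS⟧ := by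
  rw [indLp_of_measurableSet hs]
  exact E.proj_toLp_ae_eq (memLp_indicator_const 2 hs (1 : ℝ) (Or.inr (measure_ne_top P s)))

theorem aestronglyMeasurable_indLp {s : Set Ω} (hs : MeasurableSet[E.toMS] s) :
    AEStronglyMeasurable[E.toMS] (indLp P s) P := by
  have h1 : StronglyMeasurable[E.toMS] (s.indicator fun _ => (1 : ℝ)) :=
    stronglyMeasurable_const.indicator hs
  exact ⟨_, h1, coeFn_indLp (E.le s hs)⟩

/-- Sub-σ-fields contain all null sets, so a change on a null set does not affect measurability. -/
theorem measurable_of_ae_eq {f g : Ω → ℝ} (hf : Measurable f)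
    (hg : Measurable[E.toMS] g) (h : f =ᵐ[P] g) : Measurable[E.toMS] f := by
  intro s hs
  refine E.measurableSet_congr (hg hs) (hf hs) ?_
  filter_upwards [h] with x hx
  exact propext (by simp only [mem_preimage, hx] : x ∈ g ⁻¹' s ↔ x ∈ f ⁻¹' s)

theorem measurable_of_aestronglyMeasurable {f : Ω → ℝ} (hf : Measurable f)
    (h : AEStronglyMeasurable[E.toMS] f P) : Measurable[E.toMS] f :=
  E.measurable_of_ae_eq hf h.stronglyMeasurable_mk.measurable h.ae_eq_mk

theorem measurableSet_iff_proj {s : Set Ω} (hs : MeasurableSet s) :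
    MeasurableSet[E.toMS] s ↔ E.proj (indLp P s) = indLp P s := by
  rw [proj_eq_self]
  refine ⟨E.aestronglyMeasurable_indLp, fun h => ?_⟩
  have h1 : AEStronglyMeasurable[E.toMS] (s.indicator fun _ => (1 : ℝ)) P :=
    h.congr (coeFn_indLp hs)
  have h2 := E.measurable_of_aestronglyMeasurable (measurable_const.indicator hs) h1
  have h3 : s = (s.indicator fun _ => (1 : ℝ)) ⁻¹' {1} := by
    ext x
    by_cases hx : x ∈ s <;> simp [hx]
  rw [h3]
  exact h2 (measurableSet_singleton 1)

theorem proj_injective : Function.Injective (proj : SubSigmaField P → _) := by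
  intro E F h
  refine ext' (MeasurableSpace.ext fun s => ?_)
  constructor
  · intro hs
    rw [F.measurableSet_iff_proj (E.le s hs), ← h]
    exact (E.measurableSet_iff_proj (E.le s hs)).1 hs
  · intro hs
    rw [E.measurableSet_iff_proj (F.le s hs), h]
    exact (F.measurableSet_iff_proj (F.le s hs)).1 hs

theorem continuous_norm_proj_sq (f : Lp ℝ 2 P) :
    Continuous fun E : SubSigmaField P => ‖E.proj f‖ ^ 2 := by
  simp_rw [norm_proj_sq]
  have h1 : Continuous fun (E : SubSigmaField P) (f : Lp ℝ 2 P) =>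
      Metric.infDist f (lpMeas ℝ ℝ E.toMS 2 P : Set (Lp ℝ 2 P)) := continuous_induced_dom
  exact continuous_const.sub (((continuous_apply f).comp h1).pow 2)

/-- Polarization; continuity of the norms of projections thereby yields continuity of their matrix
coefficients. -/
theorem inner_proj_eq (f g : Lp ℝ 2 P) :
    inner ℝ (E.proj f) g = (‖E.proj (f + g)‖ ^ 2 - ‖E.proj (f - g)‖ ^ 2) / 4 := by
  have h1 : inner ℝ (E.proj f) g = inner ℝ (E.proj f) (E.proj g) := by
    rw [← inner_proj_left, proj_proj]
  rw [map_add, map_sub, norm_add_sq_real, norm_sub_sq_real, h1]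
  ring

/-- Weak convergence together with convergence of norms is strong convergence: expanding ‖F.proj f -
E.proj f‖² leaves only terms continuous in `F`. -/
theorem continuous_proj (f : Lp ℝ 2 P) : Continuous fun E : SubSigmaField P => E.proj f := by
  rw [continuous_iff_continuousAt]
  intro E
  rw [ContinuousAt, tendsto_iff_norm_sub_tendsto_zero]
  have h1 : Filter.Tendsto (fun F : SubSigmaField P => ‖F.proj f - E.proj f‖ ^ 2) (𝓝 E) (𝓝 0) := by
    have h2 : Continuous fun F : SubSigmaField P => ‖F.proj f‖ ^ 2 -
        2 * ((‖F.proj (f + E.proj f)‖ ^ 2 - ‖F.proj (f - E.proj f)‖ ^ 2) / 4) +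
          ‖E.proj f‖ ^ 2 :=
      ((continuous_norm_proj_sq _).sub (continuous_const.mul
        (((continuous_norm_proj_sq _).sub (continuous_norm_proj_sq _)).div_const 4))).add
          continuous_const
    have h3 := h2.tendsto E
    simp_rw [← inner_proj_eq, ← norm_sub_sq_real] at h3
    simpa using h3
  have h4 := h1.sqrt
  simpa [Real.sqrt_sq (norm_nonneg _)] using h4

/-- The distance to L₂(E) is a continuous function of the projection, and the projection depends
continuously on E by `continuous_proj`; so the Wijsman topology is the strong operator topology. -/
theorem isInducing_proj :
    IsInducing fun (E : SubSigmaField P) (f : Lp ℝ 2 P) => E.proj f := by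
  refine IsInducing.of_comp (g := fun (p : Lp ℝ 2 P → Lp ℝ 2 P) f => ‖f - p f‖)
    (continuous_pi continuous_proj)
    (continuous_pi fun f => (continuous_const.sub (continuous_apply f)).norm) ?_
  have h1 : ((fun (p : Lp ℝ 2 P → Lp ℝ 2 P) f => ‖f - p f‖) ∘
      fun (E : SubSigmaField P) (f : Lp ℝ 2 P) => E.proj f) =
      fun (E : SubSigmaField P) (f : Lp ℝ 2 P) =>
        Metric.infDist f (lpMeas ℝ ℝ E.toMS 2 P : Set (Lp ℝ 2 P)) := by
    funext E f
    exact (E.infDist_eq f).symm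
  rw [h1]
  exact ⟨rfl⟩

theorem tendsto_iff_proj {α : Type*} {l : Filter α} {u : α → SubSigmaField P}
    {E : SubSigmaField P} :
    Filter.Tendsto u l (𝓝 E) ↔ ∀ f, Filter.Tendsto (fun a => (u a).proj f) l (𝓝 (E.proj f)) := by
  rw [isInducing_proj.tendsto_nhds_iff, tendsto_pi_nhds]
  rfl

theorem continuous_iff_proj {α : Type*} [TopologicalSpace α] {u : α → SubSigmaField P} :
    Continuous u ↔ ∀ f, Continuous fun a => (u a).proj f := by
  rw [isInducing_proj.continuous_iff, continuous_pi_iff]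
  rfl

theorem lipschitzWith_proj : LipschitzWith 1 E.proj :=
  LipschitzWith.of_dist_le_mul fun f g => by
    rw [dist_eq_norm, dist_eq_norm, ← map_sub, NNReal.coe_one, one_mul]
    exact E.norm_proj_le _

end SubSigmaField

end SigmaFields

namespace SigmaFields

variable {Ω : Type*} [mΩ : MeasurableSpace Ω] {P : Measure Ω} [IsProbabilityMeasure P]

/-! ### The space of sub-σ-fields is Polish -/

/-- The vectors on which two families of operators are asymptotically equal along a filter. -/
def asymptoticallyEqual {α H : Type*} [NormedAddCommGroup H] [NormedSpace ℝ H] (l : Filter α)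
    (Q Q' : α → H →L[ℝ] H) : Submodule ℝ H where
  carrier := {f | Filter.Tendsto (fun a => ‖Q a f - Q' a f‖) l (𝓝 0)}
  add_mem' {f g} hf hg := by
    refine squeeze_zero (fun _ => norm_nonneg _) (fun a => ?_) (by simpa using hf.add hg)
    rw [map_add, map_add, add_sub_add_comm]
    exact norm_add_le _ _
  zero_mem' := by simp [tendsto_const_nhds]
  smul_mem' c f hf := by
    have h := hf.const_mul ‖c‖
    simpa only [mem_ofPred_eq, map_smul, ← smul_sub, norm_smul, mul_zero] using h

/-- An ε/3 argument for contractions. Combined with `mem_of_aestronglyMeasurable`, it reduces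
asymptotic statements to indicators of a π-system. -/
theorem isClosed_asymptoticallyEqual {α H : Type*} [NormedAddCommGroup H] [NormedSpace ℝ H]
    {l : Filter α} {Q Q' : α → H →L[ℝ] H} (hQ : ∀ a f, ‖Q a f‖ ≤ ‖f‖)
    (hQ' : ∀ a f, ‖Q' a f‖ ≤ ‖f‖) : IsClosed (asymptoticallyEqual l Q Q' : Set H) := by
  refine isClosed_of_closure_subset fun f hf => ?_
  change Filter.Tendsto (fun a => ‖Q a f - Q' a f‖) l (𝓝 0)
  rw [Metric.tendsto_nhds]
  intro ε hε
  obtain ⟨g, hg, hfg⟩ := Metric.mem_closure_iff.1 hf (ε / 3) (by positivity)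
  filter_upwards [Metric.tendsto_nhds.1 hg (ε / 3) (by positivity)] with a h1
  rw [Real.dist_eq, sub_zero, abs_norm] at h1 ⊢
  have h2 : Q a f - Q' a f = Q a (f - g) + (Q a g - Q' a g) - Q' a (f - g) := by
    rw [map_sub, map_sub]; abel
  have h3 := hQ a (f - g)
  have h4 := hQ' a (f - g)
  rw [dist_eq_norm] at hfg
  rw [h2]
  have h5 := norm_sub_le (Q a (f - g) + (Q a g - Q' a g)) (Q' a (f - g))
  have h6 := norm_add_le (Q a (f - g)) (Q a g - Q' a g)
  linarith

theorem indLp_inter {s t : Set Ω} (hs : MeasurableSet s) (ht : MeasurableSet t) :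
    indLp P (s ∩ t) = indLp P s ⊓ indLp P t := by
  refine Lp.ext ?_
  filter_upwards [coeFn_indLp (P := P) hs, coeFn_indLp (P := P) ht,
    coeFn_indLp (P := P) (hs.inter ht), Lp.coeFn_inf (indLp P s) (indLp P t)] with x h1 h2 h3 h4
  rw [h4, Pi.inf_apply, h1, h2, h3]
  by_cases hxs : x ∈ s <;> by_cases hxt : x ∈ t <;> simp [hxs, hxt]

namespace SubSigmaField

/-- The functions fixed by the pointwise limit of a sequence of conditional expectations. -/
noncomputable def limitFixed (u : ℕ → SubSigmaField P) : Submodule ℝ (Lp ℝ 2 P) :=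
  asymptoticallyEqual Filter.atTop (fun n => (u n).proj) fun _ => ContinuousLinearMap.id ℝ _

variable {u : ℕ → SubSigmaField P}

theorem mem_limitFixed {f : Lp ℝ 2 P} :
    f ∈ limitFixed u ↔ Filter.Tendsto (fun n => ‖(u n).proj f - f‖) Filter.atTop (𝓝 0) :=
  Iff.rfl

theorem isClosed_limitFixed : IsClosed (limitFixed u : Set (Lp ℝ 2 P)) :=
  isClosed_asymptoticallyEqual (fun n => (u n).norm_proj_le) fun _ _ => le_rfl

/-- The function |E_n f| is E_n-measurable and within ‖E_n f - f‖ of |f|, so projecting |f| moves it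
by at most twice that amount. This makes the fixed space a vector lattice. -/
theorem abs_mem_limitFixed {f : Lp ℝ 2 P} (hf : f ∈ limitFixed u) : |f| ∈ limitFixed u := by
  rw [mem_limitFixed] at *
  refine squeeze_zero (fun n => norm_nonneg _) (fun n => ?_)
    (by simpa using hf.const_mul 2)
  have h1 : (u n).proj |(u n).proj f| = |(u n).proj f| := by
    rw [proj_eq_self]
    have h := (u n).aestronglyMeasurable_proj f
    refine AEStronglyMeasurable.congr (f := fun x => ‖(u n).proj f x‖) ?_
      (Lp.coeFn_abs ((u n).proj f)).symm
    exact continuous_norm.comp_aestronglyMeasurable h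
  have h2 : (u n).proj |f| - |f| =
      (u n).proj (|f| - |(u n).proj f|) + (|(u n).proj f| - |f|) := by
    rw [map_sub, h1]; abel
  have h3 := (u n).norm_proj_le (|f| - |(u n).proj f|)
  have h4 := norm_abs_sub_abs f ((u n).proj f)
  have h5 := norm_abs_sub_abs ((u n).proj f) f
  have h6 : ‖f - (u n).proj f‖ = ‖(u n).proj f - f‖ := norm_sub_rev _ _
  rw [h2]
  have h7 := norm_add_le ((u n).proj (|f| - |(u n).proj f|)) (|(u n).proj f| - |f|)
  linarith

theorem inf_mem_limitFixed {f g : Lp ℝ 2 P} (hf : f ∈ limitFixed u) (hg : g ∈ limitFixed u) :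
    f ⊓ g ∈ limitFixed u := by
  have h : f ⊓ g = (2⁻¹ : ℝ) • (f + g - |f - g|) := by
    refine Lp.ext ?_
    filter_upwards [Lp.coeFn_inf f g, Lp.coeFn_smul (2⁻¹ : ℝ) (f + g - |f - g|),
      Lp.coeFn_sub (f + g) |f - g|, Lp.coeFn_add f g, Lp.coeFn_abs (f - g),
      Lp.coeFn_sub f g] with x h1 h2 h3 h4 h5 h6
    rw [h1, h2, Pi.smul_apply, h3, Pi.sub_apply, h4, h5, h6, Pi.inf_apply, Pi.add_apply,
      Pi.sub_apply, smul_eq_mul]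
    rcases le_total (f x) (g x) with h | h
    · rw [inf_eq_left.2 h, abs_of_nonpos (by linarith)]; ring
    · rw [inf_eq_right.2 h, abs_of_nonneg (by linarith)]; ring
  rw [h]
  exact Submodule.smul_mem _ _ (Submodule.sub_mem _ (Submodule.add_mem _ hf hg)
    (abs_mem_limitFixed (Submodule.sub_mem _ hf hg)))

theorem sup_mem_limitFixed {f g : Lp ℝ 2 P} (hf : f ∈ limitFixed u) (hg : g ∈ limitFixed u) :
    f ⊔ g ∈ limitFixed u := by
  have h := Submodule.neg_mem _ (inf_mem_limitFixed (Submodule.neg_mem _ hf)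
    (Submodule.neg_mem _ hg))
  rwa [← neg_sup, neg_neg] at h

theorem indLp_univ_mem_limitFixed : indLp P univ ∈ limitFixed u := by
  rw [mem_limitFixed]
  have h : ∀ n, (u n).proj (indLp P univ) = indLp P univ := fun n =>
    ((u n).measurableSet_iff_proj MeasurableSet.univ).1 (@MeasurableSet.univ _ (u n).toMS)
  simp [h]

/-- The truncations min(1, k (f - c)⁺) lie in the closed lattice and converge in L² to the indicator
of {f > c}. -/
theorem indLp_mem_limitFixed {f : Lp ℝ 2 P} (hf : f ∈ limitFixed u) (c : ℝ) :
    indLp P {x | c < f x} ∈ limitFixed u := by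
  let one := indLp P (univ : Set Ω)
  let h : ℕ → Lp ℝ 2 P := fun k => one ⊓ ((k : ℝ) • ((f - c • one) ⊔ 0))
  have hmeas : MeasurableSet {x | c < f x} :=
    measurableSet_lt measurable_const (Lp.stronglyMeasurable f).measurable
  have hh : ∀ k, h k ∈ limitFixed u := fun k =>
    inf_mem_limitFixed indLp_univ_mem_limitFixed (Submodule.smul_mem _ _
      (sup_mem_limitFixed (Submodule.sub_mem _ hf
        (Submodule.smul_mem _ _ indLp_univ_mem_limitFixed)) (Submodule.zero_mem _)))
  have hae : ∀ k, h k =ᵐ[P] fun x => min 1 (k * max (f x - c) 0) := by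
    intro k
    filter_upwards [Lp.coeFn_inf one ((k : ℝ) • ((f - c • one) ⊔ 0)),
      Lp.coeFn_smul (k : ℝ) ((f - c • one) ⊔ 0), Lp.coeFn_sup (f - c • one) 0,
      Lp.coeFn_sub f (c • one), Lp.coeFn_smul c one, coeFn_indLp (P := P) MeasurableSet.univ,
      Lp.coeFn_zero ℝ 2 P] with x h1 h2 h3 h4 h5 h6 h7
    have h8 : one x = 1 := by rw [h6]; simp
    change (one ⊓ ((k : ℝ) • ((f - c • one) ⊔ 0)) : Lp ℝ 2 P) x = _
    rw [h1, Pi.inf_apply, h2, Pi.smul_apply, h3, Pi.sup_apply, h4, Pi.sub_apply, h5,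
      Pi.smul_apply, h7, h8]
    simp
  have hlim : Filter.Tendsto h Filter.atTop (𝓝 (indLp P {x | c < f x})) := by
    rw [tendsto_iff_norm_sub_tendsto_zero]
    have h1 : Filter.Tendsto (fun k => ‖h k - indLp P {x | c < f x}‖ ^ 2) Filter.atTop (𝓝 0) := by
      simp_rw [norm_sq_eq_integral]
      have hae' : ∀ k, (h k - indLp P {x | c < f x} : Lp ℝ 2 P) =ᵐ[P] fun x =>
          min 1 (k * max (f x - c) 0) - ({x | c < f x}.indicator (fun _ => (1 : ℝ)) x) := by
        intro k
        filter_upwards [hae k, Lp.coeFn_sub (h k) (indLp P {x | c < f x}),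
          coeFn_indLp (P := P) hmeas] with x h1 h2 h3
        rw [h2, Pi.sub_apply, h1, h3]
      have h0 : (0 : ℝ) = ∫ _ : Ω, (0 : ℝ) ∂P := by simp
      rw [h0]
      refine tendsto_integral_of_dominated_convergence (fun _ => 1) (fun k => ?_)
        (integrable_const _) (fun k => ?_) ?_
      · exact (Lp.aestronglyMeasurable _).pow 2
      · filter_upwards [hae' k] with x hx
        rw [hx]
        have h2 : 0 ≤ k * max (f x - c) 0 := by positivity
        have h3 : 0 ≤ min 1 (k * max (f x - c) 0) := le_min zero_le_one h2
        have h4 : min 1 (k * max (f x - c) 0) ≤ 1 := min_le_left _ _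
        rw [Real.norm_eq_abs, abs_of_nonneg (sq_nonneg _), sq_le_one_iff_abs_le_one, abs_le]
        have h5 : 0 ≤ {x | c < f x}.indicator (fun _ => (1 : ℝ)) x :=
          indicator_nonneg (fun _ _ => zero_le_one) x
        have h6 : {x | c < f x}.indicator (fun _ => (1 : ℝ)) x ≤ 1 :=
          indicator_le_self' (fun _ _ => zero_le_one) x
        constructor <;> linarith
      · filter_upwards [ae_all_iff.2 hae'] with x hx
        simp_rw [hx]
        by_cases hx : c < f x
        · obtain ⟨K, hK⟩ := exists_nat_gt (1 / (f x - c))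
          refine tendsto_const_nhds.congr' ?_
          filter_upwards [Filter.eventually_ge_atTop K] with k hk
          have hpos : 0 < f x - c := by linarith
          have hk' : (K : ℝ) ≤ k := by exact_mod_cast hk
          have h2 : 1 ≤ (k : ℝ) * max (f x - c) 0 := by
            rw [max_eq_left hpos.le]
            rw [div_lt_iff₀ hpos] at hK
            nlinarith
          rw [min_eq_left h2]
          simp [hx]
        · have h2 : max (f x - c) 0 = 0 := max_eq_right (by linarith)
          simp [hx, h2]
    have h2 := h1.sqrt
    simpa [Real.sqrt_sq (norm_nonneg _)] using h2
  exact isClosed_limitFixed.mem_of_tendsto hlim (Filter.Eventually.of_forall hh)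

/-- The limit of a sequence of sub-σ-fields. -/
def limitField (u : ℕ → SubSigmaField P) : SubSigmaField P where
  toMS :=
    { MeasurableSet' := fun s => MeasurableSet s ∧ indLp P s ∈ limitFixed u
      measurableSet_empty := ⟨MeasurableSet.empty, by rw [indLp_empty]; exact Submodule.zero_mem _⟩
      measurableSet_compl := fun s hs => ⟨hs.1.compl, by
        rw [indLp_compl hs.1]
        exact Submodule.sub_mem _ indLp_univ_mem_limitFixed hs.2⟩
      measurableSet_iUnion := fun s hs => by
        have h1 : ∀ n, MeasurableSet (accumulate s n) ∧
            indLp P (accumulate s n) ∈ limitFixed u := by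
          intro n
          induction n with
          | zero => simpa using hs 0
          | succ n ih =>
            rw [accumulate_succ]
            refine ⟨ih.1.union (hs _).1, ?_⟩
            have h2 : accumulate s n ∪ s (n + 1) = ((accumulate s n)ᶜ ∩ (s (n + 1))ᶜ)ᶜ := by
              rw [compl_inter, compl_compl, compl_compl]
            rw [h2, indLp_compl (ih.1.compl.inter (hs _).1.compl),
              indLp_inter ih.1.compl (hs _).1.compl, indLp_compl ih.1, indLp_compl (hs _).1]
            have h3 := indLp_univ_mem_limitFixed (u := u)
            exact Submodule.sub_mem _ h3 (inf_mem_limitFixed (Submodule.sub_mem _ h3 ih.2)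
              (Submodule.sub_mem _ h3 (hs _).2))
        refine ⟨MeasurableSet.iUnion fun n => (hs n).1, ?_⟩
        have h2 := tendsto_indLp_iUnion (P := P) (fun n => (h1 n).1) monotone_accumulate
        rw [iUnion_accumulate] at h2
        exact isClosed_limitFixed.mem_of_tendsto h2 (Filter.Eventually.of_forall fun n => (h1 n).2) }
  le := fun _ hs => hs.1
  null_mem := fun s hs h0 => ⟨hs, by
    rw [indLp_congr hs MeasurableSet.empty (ae_eq_empty.2 h0), indLp_empty]
    exact Submodule.zero_mem _⟩

/-- The fixed space is exactly L² of the limit field: the level sets of its elements belong to the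
field, and conversely it is closed and contains the indicators of the field. -/
theorem mem_limitFixed_iff {f : Lp ℝ 2 P} :
    f ∈ limitFixed u ↔ AEStronglyMeasurable[(limitField u).toMS] f P := by
  constructor
  · intro hf
    have h : Measurable[(limitField u).toMS] f := by
      refine @measurable_of_Ioi _ _ _ _ _ (limitField u).toMS _ _ _ _ fun c => ?_
      exact ⟨(Lp.stronglyMeasurable f).measurable measurableSet_Ioi, indLp_mem_limitFixed hf c⟩
    exact h.stronglyMeasurable.aestronglyMeasurable
  · intro hf
    exact mem_of_aestronglyMeasurable isClosed_limitFixed (limitField u).le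
      (@MeasurableSpace.generateFrom_measurableSet _ (limitField u).toMS).symm
      (@MeasurableSpace.isPiSystem_measurableSet _ (limitField u).toMS)
      indLp_univ_mem_limitFixed (fun s hs => hs.2) hf

/-- A strong limit `p` of projections is idempotent and self-adjoint: p f is fixed in the limit, and
f - p f is orthogonal to the fixed space, which is L² of `limitField u`. -/
theorem exists_proj_eq_of_tendsto (u : ℕ → SubSigmaField P) (p : Lp ℝ 2 P → Lp ℝ 2 P)
    (h : ∀ f, Filter.Tendsto (fun n => (u n).proj f) Filter.atTop (𝓝 (p f))) :
    ∃ E : SubSigmaField P, (fun f => E.proj f) = p := by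
  refine ⟨limitField u, funext fun f => proj_eq_of_inner _ ?_ fun w hw => ?_⟩
  · rw [← mem_limitFixed_iff, mem_limitFixed]
    have h1 := tendsto_iff_norm_sub_tendsto_zero.1 (h f)
    refine squeeze_zero (fun n => norm_nonneg _) (fun n => ?_) (by simpa using h1.const_mul 2)
    have h2 : (u n).proj (p f) - p f = (u n).proj (p f - (u n).proj f) + ((u n).proj f - p f) := by
      rw [map_sub, proj_proj]; abel
    have h3 := (u n).norm_proj_le (p f - (u n).proj f)
    rw [norm_sub_rev (p f)] at h3
    rw [h2]
    have h4 := norm_add_le ((u n).proj (p f - (u n).proj f)) ((u n).proj f - p f)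
    linarith
  · rw [← mem_limitFixed_iff] at hw
    have h1 : Filter.Tendsto (fun n => inner ℝ (f - (u n).proj f) ((u n).proj w)) Filter.atTop
        (𝓝 (inner ℝ (f - p f) w)) := (tendsto_const_nhds.sub (h f)).inner
        (tendsto_iff_norm_sub_tendsto_zero.2 (mem_limitFixed.1 hw))
    refine tendsto_nhds_unique h1 (tendsto_const_nhds.congr fun n => ?_)
    rw [inner_sub_left, ← inner_proj_left, ← inner_proj_left, proj_proj, sub_self]

instance [MeasurableSpace.CountablyGenerated Ω] : PolishSpace (SubSigmaField P) := by
  have : Fact ((1 : ℝ≥0∞) ≤ 2) := ⟨by norm_num⟩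
  have : Fact ((2 : ℝ≥0∞) ≠ ∞) := ⟨by norm_num⟩
  refine polishSpace_of_nonexpansive (fun (E : SubSigmaField P) (f : Lp ℝ 2 P) => E.proj f)
    isInducing_proj (fun E F h => proj_injective ?_) lipschitzWith_proj
    exists_proj_eq_of_tendsto
  exact ContinuousLinearMap.ext fun f => congrFun h f

end SubSigmaField

end SigmaFields

namespace SigmaFields

variable {Ω : Type*} [mΩ : MeasurableSpace Ω] {P : Measure Ω}

/-! ### Automorphisms of the measure algebra are induced by point maps -/

namespace Aut

/-- `g` maps the class of `t` to the class of `s`. -/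
def MapsSet (g : Aut P) (t s : Set Ω) : Prop :=
  ∃ (ht : MeasurableSet t) (hs : MeasurableSet s),
    g.1 (MeasureAlgebra.mk P t ht) = MeasureAlgebra.mk P s hs

theorem MapsSet.empty (g : Aut P) : MapsSet g ∅ ∅ := by
  refine ⟨MeasurableSet.empty, MeasurableSet.empty, ?_⟩
  refine le_antisymm ?_ (MeasureAlgebra.isBot_mk_empty _)
  exact g.1.le_symm_apply.1 (MeasureAlgebra.isBot_mk_empty (P := P)
    (g.1.symm (MeasureAlgebra.mk P ∅ MeasurableSet.empty)))

theorem MapsSet.compl {g : Aut P} {t s : Set Ω} (h : MapsSet g t s) : MapsSet g tᶜ sᶜ := by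
  obtain ⟨ht, hs, e⟩ := h
  refine ⟨ht.compl, hs.compl, ?_⟩
  refine eq_of_forall_le_iff fun a => ?_
  obtain ⟨a, rfl⟩ := g.1.surjective a
  rw [g.1.le_iff_le, MeasureAlgebra.le_mk_compl_iff hs, ← e,
    MeasureAlgebra.le_mk_compl_iff ht]
  refine Iff.trans (forall_congr' fun d => ?_) g.1.surjective.forall.symm
  have : IsBot (g.1 d) ↔ IsBot d :=
    g.1.surjective.forall.trans (forall_congr' fun x => g.1.le_iff_le)
  rw [g.1.le_iff_le, g.1.le_iff_le, this]

theorem MapsSet.iUnion {g : Aut P} {t s : ℕ → Set Ω} (h : ∀ n, MapsSet g (t n) (s n)) :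
    MapsSet g (⋃ n, t n) (⋃ n, s n) := by
  choose ht hs e using h
  refine ⟨MeasurableSet.iUnion ht, MeasurableSet.iUnion hs, ?_⟩
  have h1 := (g.1.isLUB_image'.2 (MeasureAlgebra.isLUB_mk_iUnion (P := P) ht))
  rw [← range_comp] at h1
  have h2 := MeasureAlgebra.isLUB_mk_iUnion (P := P) hs
  have h3 : (fun n => MeasureAlgebra.mk P (s n) (hs n)) =
      g.1 ∘ fun n => MeasureAlgebra.mk P (t n) (ht n) := funext fun n => (e n).symm
  rw [h3] at h2
  exact h1.unique h2

theorem MapsSet.measure_eq {g : Aut P} {t s : Set Ω} (h : MapsSet g t s) : P s = P t := by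
  obtain ⟨ht, hs, e⟩ := h
  have h1 := g.2 (MeasureAlgebra.mk P t ht)
  rw [e] at h1
  exact h1

theorem MapsSet.congr {g : Aut P} {t s t' s' : Set Ω} (h : MapsSet g t s) (ht : MeasurableSet t')
    (hs : MeasurableSet s') (h1 : t =ᵐ[P] t') (h2 : s =ᵐ[P] s') : MapsSet g t' s' := by
  obtain ⟨ht', hs', e⟩ := h
  exact ⟨ht, hs, (congrArg g.1 (MeasureAlgebra.mk_eq_mk.2 h1.symm)).trans
    (e.trans (MeasureAlgebra.mk_eq_mk.2 h2))⟩

theorem exists_mapsSet (g : Aut P) {t : Set Ω} (ht : MeasurableSet t) : ∃ s, MapsSet g t s := by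
  obtain ⟨s, hs, e⟩ := MeasureAlgebra.exists_rep (g.1 (MeasureAlgebra.mk P t ht))
  exact ⟨s, ht, hs, e.symm⟩

variable [StandardBorelSpace Ω] [IsProbabilityMeasure P]

/-- Embed Ω into the Cantor space by X, let `B n` represent the image under g of the n-th coordinate
event of X, and let Y have the events `B n` as coordinates. The Borel sets C for which g takes X⁻¹C
to Y⁻¹C form a σ-field containing the coordinate events, so all C qualify. In particular Y lies
almost surely in the range of X, and X⁻¹ ∘ Y induces g. -/
theorem exists_pointMap (g : Aut P) :
    ∃ φ : Ω → Ω, Measurable φ ∧ ∀ t, MeasurableSet t → MapsSet g t (φ ⁻¹' t) := by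
  let X : Ω → ℕ → Bool := MeasurableSpace.mapNatBool Ω
  have hX : MeasurableEmbedding X := (MeasurableSpace.measurable_mapNatBool Ω).measurableEmbedding
    (MeasurableSpace.injective_mapNatBool Ω)
  have hA : ∀ n, MeasurableSet {ω | X ω n = true} := fun n =>
    (measurable_pi_apply n).comp hX.measurable (measurableSet_singleton true)
  choose B hB using fun n => exists_mapsSet g (hA n)
  classical
  let Y : Ω → ℕ → Bool := fun ω n => decide (ω ∈ B n)
  have hY : Measurable Y := by
    refine measurable_pi_iff.2 fun n => measurable_to_bool ?_
    convert (hB n).2.1 using 1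
    ext ω
    simp [Y]
  have hXY : ∀ C : Set (ℕ → Bool), MeasurableSet C → MapsSet g (X ⁻¹' C) (Y ⁻¹' C) := by
    let m' : MeasurableSpace (ℕ → Bool) :=
      { MeasurableSet' := fun C => MapsSet g (X ⁻¹' C) (Y ⁻¹' C)
        measurableSet_empty := MapsSet.empty g
        measurableSet_compl := fun _ h => h.compl
        measurableSet_iUnion := fun f h => by
          rw [preimage_iUnion, preimage_iUnion]
          exact MapsSet.iUnion h }
    have hle : MeasurableSpace.pi ≤ m' := by
      refine iSup_le fun n => Measurable.comap_le ?_
      refine @measurable_to_bool _ m' _ ?_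
      change MapsSet g _ _
      convert hB n using 1
      · ext ω
        simp
      · ext ω
        simp [Y]
    exact hle
  have hr : ∀ᵐ ω ∂P, Y ω ∈ range X := by
    have h1 := (hXY _ hX.measurableSet_range).measure_eq
    rw [preimage_range, measure_univ] at h1
    exact mem_ae_iff_prob_eq_one (hY hX.measurableSet_range) |>.2 h1
  have hne : Nonempty Ω := (inferInstance : (ae P).NeBot).nonempty_of_mem Filter.univ_mem |>.to_type
  have hinv : Measurable hX.invFun := hX.measurable_invFun
  refine ⟨hX.invFun ∘ Y, hinv.comp hY, fun t ht => ?_⟩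
  refine (hXY _ (hX.measurableSet_image.2 ht)).congr ht ((hinv.comp hY) ht) ?_ ?_
  · rw [preimage_image_eq _ hX.injective]
    exact Filter.EventuallyEq.rfl
  · filter_upwards [hr] with ω hω
    obtain ⟨x, hx⟩ := hω
    refine propext ?_
    change Y ω ∈ X '' t ↔ hX.invFun (Y ω) ∈ t
    rw [← hx, hX.leftInverse_invFun x, hX.injective.mem_set_image]

/-- A measure preserving point map inducing an automorphism of the measure algebra. -/
noncomputable def pointMap (g : Aut P) : Ω → Ω := (exists_pointMap g).choose

theorem mapsSet_pointMap (g : Aut P) {t : Set Ω} (ht : MeasurableSet t) :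
    MapsSet g t (g.pointMap ⁻¹' t) := (exists_pointMap g).choose_spec.2 t ht

theorem measurePreserving_pointMap (g : Aut P) : MeasurePreserving g.pointMap P P :=
  ⟨(exists_pointMap g).choose_spec.1, Measure.ext fun t ht => by
    rw [pointMap, Measure.map_apply (exists_pointMap g).choose_spec.1 ht]
    exact (g.mapsSet_pointMap ht).measure_eq⟩

/-- The Koopman operator of an automorphism. -/
noncomputable def koopman (g : Aut P) : Lp ℝ 2 P →ₗᵢ[ℝ] Lp ℝ 2 P :=
  Lp.compMeasurePreservingₗᵢ ℝ g.pointMap g.measurePreserving_pointMap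

theorem koopman_indLp (g : Aut P) {t s : Set Ω} (h : MapsSet g t s) :
    g.koopman (indLp P t) = indLp P s := by
  have h1 : g.koopman (indLp P t) = indLp P (g.pointMap ⁻¹' t) := by
    rw [indLp_of_measurableSet h.1,
      indLp_of_measurableSet (g.measurePreserving_pointMap.measurable h.1)]
    rfl
  rw [h1]
  have h2 := g.mapsSet_pointMap h.1
  exact indLp_congr h2.2.1 h.2.1 (MeasureAlgebra.mk_eq_mk.1 (h2.2.2.symm.trans h.2.2))

theorem eq_of_indLp {S T : Lp ℝ 2 P →L[ℝ] Lp ℝ 2 P}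
    (h : ∀ s, MeasurableSet s → S (indLp P s) = T (indLp P s)) : S = T := by
  refine ContinuousLinearMap.ext fun f => ?_
  exact mem_of_aestronglyMeasurable (V := (S : Lp ℝ 2 P →ₗ[ℝ] Lp ℝ 2 P).eqLocus T)
    (isClosed_eq S.continuous T.continuous) le_rfl
    MeasurableSpace.generateFrom_measurableSet.symm MeasurableSpace.isPiSystem_measurableSet
    (h _ MeasurableSet.univ) h (Lp.aestronglyMeasurable f)

theorem koopman_mul (g h : Aut P) (f : Lp ℝ 2 P) :
    (g * h).koopman f = g.koopman (h.koopman f) := by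
  refine DFunLike.congr_fun (eq_of_indLp (S := (g * h).koopman.toContinuousLinearMap)
    (T := g.koopman.toContinuousLinearMap.comp h.koopman.toContinuousLinearMap) fun s hs => ?_) f
  obtain ⟨t, ht⟩ := exists_mapsSet h hs
  obtain ⟨r, hr⟩ := exists_mapsSet g ht.2.1
  have h1 : MapsSet (g * h) s r := ⟨hs, hr.2.1, by
    rw [← hr.2.2, ← ht.2.2]
    rfl⟩
  change (g * h).koopman _ = g.koopman (h.koopman _)
  rw [koopman_indLp _ h1, koopman_indLp _ ht, koopman_indLp _ hr]

theorem koopman_one (f : Lp ℝ 2 P) : (1 : Aut P).koopman f = f := by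
  refine DFunLike.congr_fun (eq_of_indLp (S := (1 : Aut P).koopman.toContinuousLinearMap)
    (T := ContinuousLinearMap.id ℝ _) fun s hs => ?_) f
  exact koopman_indLp 1 ⟨hs, hs, rfl⟩

theorem koopman_koopman_inv (g : Aut P) (f : Lp ℝ 2 P) : g.koopman (g⁻¹.koopman f) = f := by
  rw [← koopman_mul, mul_inv_cancel, koopman_one]

end Aut

/-! ### The measure algebra as a closed subset of L². -/

namespace MeasureAlgebra

variable [IsProbabilityMeasure P]

/-- The indicator of an element of the measure algebra. -/
noncomputable def ind (a : MeasureAlgebra P) : Lp ℝ 2 P :=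
  indLp P a.exists_rep.choose

theorem ind_mk {s : Set Ω} (hs : MeasurableSet s) : ind (mk P s hs) = indLp P s := by
  obtain ⟨hs', h⟩ := (mk P s hs).exists_rep.choose_spec
  exact indLp_congr hs' hs (mk_eq_mk.1 h)

theorem ind_injective : Function.Injective (ind : MeasureAlgebra P → _) := by
  intro a b h
  obtain ⟨s, hs, rfl⟩ := exists_rep a
  obtain ⟨t, ht, rfl⟩ := exists_rep b
  rw [ind_mk, ind_mk] at h
  exact mk_eq_mk.2 (ae_eq_of_indLp_eq hs ht h)

theorem norm_ind_sq (a : MeasureAlgebra P) : ‖a.ind‖ ^ 2 = a.measure.toReal := by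
  obtain ⟨s, hs, rfl⟩ := exists_rep a
  rw [ind_mk, norm_indLp_sq hs]
  rfl

theorem measure_ne_top (a : MeasureAlgebra P) : a.measure ≠ ∞ := by
  obtain ⟨s, hs, rfl⟩ := exists_rep a
  exact MeasureTheory.measure_ne_top P s

theorem ind_le_ind {a b : MeasureAlgebra P} : a.ind ≤ b.ind ↔ a ≤ b := by
  obtain ⟨s, hs, rfl⟩ := exists_rep a
  obtain ⟨t, ht, rfl⟩ := exists_rep b
  rw [ind_mk, ind_mk, mk_le_mk, ← Lp.coeFn_le]
  constructor
  · intro h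
    filter_upwards [h, coeFn_indLp (P := P) hs, coeFn_indLp (P := P) ht] with x h1 h2 h3 hx
    rw [h2, h3, indicator_of_mem hx] at h1
    by_contra hxt
    have hxt' : x ∉ t := hxt
    rw [indicator_of_notMem hxt'] at h1
    linarith
  · intro h
    filter_upwards [h, coeFn_indLp (P := P) hs, coeFn_indLp (P := P) ht] with x h1 h2 h3
    rw [h2, h3]
    by_cases hx : x ∈ s
    · have hxt : x ∈ t := h1 hx
      simp [hx, hxt]
    · rw [indicator_of_notMem hx]
      exact indicator_nonneg (fun _ _ => zero_le_one) x

/-- The measure of a symmetric difference is a squared L² distance, so `ind` is a homeomorphism onto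
its image. -/
theorem edist_eq (a b : MeasureAlgebra P) : edist a b = ENNReal.ofReal (‖a.ind - b.ind‖ ^ 2) := by
  obtain ⟨s, hs, rfl⟩ := exists_rep a
  obtain ⟨t, ht, rfl⟩ := exists_rep b
  rw [ind_mk, ind_mk, norm_indLp_sub_sq hs ht, Measure.real,
    ENNReal.ofReal_toReal (MeasureTheory.measure_ne_top _ _)]
  rfl

theorem tendsto_iff_ind {α : Type*} {l : Filter α} {u : α → MeasureAlgebra P}
    {a : MeasureAlgebra P} :
    Filter.Tendsto u l (𝓝 a) ↔ Filter.Tendsto (fun x => (u x).ind) l (𝓝 a.ind) := by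
  rw [tendsto_iff_edist_tendsto_0, tendsto_iff_norm_sub_tendsto_zero]
  simp_rw [edist_eq]
  constructor
  · intro h
    have h1 := ((ENNReal.tendsto_toReal ENNReal.zero_ne_top).comp h).sqrt
    simpa [Function.comp_def, ENNReal.toReal_ofReal (sq_nonneg _),
      Real.sqrt_sq (norm_nonneg _)] using h1
  · intro h
    have h1 := ENNReal.tendsto_ofReal (h.pow 2)
    simpa using h1

/-- Indicators are singled out by the closed condition |2f - 1| = 1. -/
theorem isClosed_range_ind : IsClosed (range (ind : MeasureAlgebra P → _)) := by
  refine IsSeqClosed.isClosed fun v f hv hf => ?_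
  choose a ha using hv
  let one := indLp P (univ : Set Ω)
  have hone : ∀ᵐ x ∂P, one x = 1 := by
    filter_upwards [coeFn_indLp (P := P) MeasurableSet.univ] with x hx
    change indLp P univ x = 1
    rw [hx]
    simp
  have h1 : ∀ n, |(2 : ℝ) • v n - one| = one := by
    intro n
    obtain ⟨s, hs, e⟩ := exists_rep (a n)
    rw [← ha n, ← e, ind_mk]
    refine Lp.ext ?_
    filter_upwards [Lp.coeFn_abs ((2 : ℝ) • indLp P s - one), hone,
      Lp.coeFn_sub ((2 : ℝ) • indLp P s) one, Lp.coeFn_smul (2 : ℝ) (indLp P s),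
      coeFn_indLp (P := P) hs] with x h1 h2 h3 h4 h5
    rw [h1, h3, Pi.sub_apply, h4, Pi.smul_apply, h5, h2]
    by_cases hx : x ∈ s <;> norm_num [hx]
  have h2 : |(2 : ℝ) • f - one| = one := by
    have h3 : Filter.Tendsto (fun n => |(2 : ℝ) • v n - one|) Filter.atTop
        (𝓝 |(2 : ℝ) • f - one|) := by
      have h4 := (hf.const_smul (2 : ℝ)).sub_const one
      rw [tendsto_iff_norm_sub_tendsto_zero] at h4 ⊢
      exact squeeze_zero (fun _ => norm_nonneg _) (fun _ => norm_abs_sub_abs _ _) h4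
    simp_rw [h1] at h3
    exact tendsto_nhds_unique h3 tendsto_const_nhds
  have hs : MeasurableSet {x | f x = 1} :=
    (Lp.stronglyMeasurable f).measurable (measurableSet_singleton 1)
  refine ⟨mk P _ hs, ?_⟩
  rw [ind_mk]
  refine Lp.ext ?_
  have h3 : ∀ᵐ x ∂P, |2 * f x - 1| = 1 := by
    filter_upwards [Lp.coeFn_abs ((2 : ℝ) • f - one), hone,
      Lp.coeFn_sub ((2 : ℝ) • f) one, Lp.coeFn_smul (2 : ℝ) f] with x h4 h5 h6 h7
    rw [h2, h6, Pi.sub_apply, h7, Pi.smul_apply, h5] at h4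
    exact h4.symm
  filter_upwards [coeFn_indLp (P := P) hs, h3] with x h4 h5
  rw [h4]
  rcases abs_eq (zero_le_one' ℝ) |>.1 h5 with h | h
  · have : f x = 1 := by linarith
    rw [indicator_of_mem (by exact this), this]
  · have h6 : f x = 0 := by linarith
    rw [indicator_of_notMem (by rw [mem_ofPred_eq, h6]; norm_num), h6]

end MeasureAlgebra

end SigmaFields

namespace SigmaFields

variable {Ω : Type*} [mΩ : MeasurableSpace Ω] [StandardBorelSpace Ω]
  {P : Measure Ω} [IsProbabilityMeasure P]

/-! ### `Aut P` is a Polish group -/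

namespace Aut

theorem koopman_ind (g : Aut P) (a : MeasureAlgebra P) : g.koopman a.ind = (g.1 a).ind := by
  obtain ⟨s, hs, rfl⟩ := MeasureAlgebra.exists_rep a
  obtain ⟨t, ht, e⟩ := MeasureAlgebra.exists_rep (g.1 (MeasureAlgebra.mk P s hs))
  rw [← e, MeasureAlgebra.ind_mk, MeasureAlgebra.ind_mk]
  exact koopman_indLp g ⟨hs, ht, e.symm⟩

theorem tendsto_iff {α : Type*} {l : Filter α} {u : α → Aut P} {g : Aut P} :
    Filter.Tendsto u l (𝓝 g) ↔ ∀ a, Filter.Tendsto (fun x => (u x).1 a) l (𝓝 (g.1 a)) := by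
  have h : IsInducing (fun (g : Aut P) (a : MeasureAlgebra P) =>
      (g : MeasureAlgebra P ≃o MeasureAlgebra P) a) := ⟨rfl⟩
  rw [h.tendsto_nhds_iff, tendsto_pi_nhds]
  rfl

/-- Pointwise convergence on the measure algebra is strong convergence on indicators; it extends to
L² since all the operators are isometries. -/
theorem continuous_koopman (f : Lp ℝ 2 P) : Continuous fun g : Aut P => g.koopman f := by
  rw [continuous_iff_continuousAt]
  intro g
  rw [ContinuousAt, tendsto_iff_norm_sub_tendsto_zero]
  let Q : Aut P → Lp ℝ 2 P →L[ℝ] Lp ℝ 2 P := fun g => g.koopman.toContinuousLinearMap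
  have hind : ∀ s : Set Ω, MeasurableSet s →
      indLp P s ∈ asymptoticallyEqual (𝓝 g) Q fun _ => Q g := by
    intro s hs
    change Filter.Tendsto (fun h : Aut P => ‖h.koopman (indLp P s) - g.koopman (indLp P s)‖) _ _
    rw [← tendsto_iff_norm_sub_tendsto_zero, ← MeasureAlgebra.ind_mk hs]
    simp_rw [koopman_ind]
    exact MeasureAlgebra.tendsto_iff_ind.1 (tendsto_iff.1 Filter.tendsto_id _)
  exact mem_of_aestronglyMeasurable (V := asymptoticallyEqual (𝓝 g) Q fun _ => Q g)
    (isClosed_asymptoticallyEqual (fun h f => (h.koopman.norm_map f).le)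
      fun _ f => (g.koopman.norm_map f).le) le_rfl
    MeasurableSpace.generateFrom_measurableSet.symm MeasurableSpace.isPiSystem_measurableSet
    (hind _ MeasurableSet.univ) hind (Lp.aestronglyMeasurable f)

theorem tendsto_iff_koopman {α : Type*} {l : Filter α} {u : α → Aut P} {g : Aut P} :
    Filter.Tendsto u l (𝓝 g) ↔
      ∀ f, Filter.Tendsto (fun x => (u x).koopman f) l (𝓝 (g.koopman f)) := by
  refine ⟨fun h f => ((continuous_koopman f).tendsto g).comp h, fun h => tendsto_iff.2 fun a => ?_⟩
  rw [MeasureAlgebra.tendsto_iff_ind]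
  simp_rw [← koopman_ind]
  exact h _

theorem continuous_iff_koopman {α : Type*} [TopologicalSpace α] {u : α → Aut P} :
    Continuous u ↔ ∀ f, Continuous fun x => (u x).koopman f := by
  simp_rw [continuous_iff_continuousAt, ContinuousAt, tendsto_iff_koopman]
  exact forall_comm

theorem continuous_koopman_uncurry :
    Continuous fun p : Aut P × Lp ℝ 2 P => p.1.koopman p.2 :=
  continuous_prod_of_continuous_lipschitzWith' _ 1
    (fun g => g.koopman.lipschitz) continuous_koopman

theorem _root_.Continuous.koopman {α : Type*} [TopologicalSpace α] {u : α → Aut P}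
    {v : α → Lp ℝ 2 P} (hu : Continuous u) (hv : Continuous v) :
    Continuous fun x => (u x).koopman (v x) := by
  have h : Continuous fun x => (u x, v x) := hu.prodMk hv
  have h1 := Continuous.comp continuous_koopman_uncurry h
  exact h1

/-- By isometry, the distance from u⁻¹v to f equals the distance from v to u f. -/
theorem tendsto_koopman_inv {α : Type*} {l : Filter α} {u : α → Aut P} {f v : Lp ℝ 2 P}
    (h : Filter.Tendsto (fun x => (u x).koopman f) l (𝓝 v)) :
    Filter.Tendsto (fun x => (u x)⁻¹.koopman v) l (𝓝 f) := by
  rw [tendsto_iff_norm_sub_tendsto_zero] at h ⊢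
  refine h.congr fun x => ?_
  rw [← (u x).koopman.norm_map ((u x)⁻¹.koopman v - f), map_sub, koopman_koopman_inv,
    norm_sub_rev]

instance : IsTopologicalGroup (Aut P) where
  continuous_mul := by
    rw [continuous_iff_koopman]
    intro f
    simp_rw [koopman_mul]
    exact continuous_fst.koopman (continuous_snd.koopman continuous_const)
  continuous_inv := by
    rw [continuous_iff_koopman]
    intro f
    rw [continuous_iff_continuousAt]
    intro g
    have h := tendsto_koopman_inv ((continuous_koopman (g⁻¹.koopman f)).tendsto g)
    rwa [koopman_koopman_inv] at h

theorem koopman_injective {g h : Aut P} (H : ∀ f, g.koopman f = h.koopman f) : g = h := by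
  refine Subtype.ext (RelIso.ext fun a => MeasureAlgebra.ind_injective ?_)
  rw [← koopman_ind, ← koopman_ind, H]

/-- If the Koopman operators of a sequence of automorphisms and of their inverses converge
pointwise, then the limits come from an automorphism. -/
theorem exists_koopman_eq_of_tendsto (u : ℕ → Aut P) (p q : Lp ℝ 2 P → Lp ℝ 2 P)
    (hp : ∀ f, Filter.Tendsto (fun n => (u n).koopman f) Filter.atTop (𝓝 (p f)))
    (hq : ∀ f, Filter.Tendsto (fun n => (u n)⁻¹.koopman f) Filter.atTop (𝓝 (q f))) :
    ∃ g : Aut P, (∀ f, g.koopman f = p f) ∧ ∀ f, g⁻¹.koopman f = q f := by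
  have hqp : ∀ f, q (p f) = f := fun f =>
    tendsto_nhds_unique (hq _) (tendsto_koopman_inv (hp f))
  have hpq : ∀ f, p (q f) = f := fun f => by
    have h := tendsto_koopman_inv (u := fun n => (u n)⁻¹) (hq f)
    simp only [inv_inv] at h
    exact tendsto_nhds_unique (hp _) h
  -- A strong limit preserves the closed set of indicators and the order, so it acts on the measure
  -- algebra; applied to `p` and to `q`, this gives two mutually inverse order maps.
  have key : ∀ (v : ℕ → Aut P) (r : Lp ℝ 2 P → Lp ℝ 2 P),
      (∀ f, Filter.Tendsto (fun n => (v n).koopman f) Filter.atTop (𝓝 (r f))) →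
      (∀ a : MeasureAlgebra P, ∃ b : MeasureAlgebra P, b.ind = r a.ind) ∧
      ∀ a b : MeasureAlgebra P, a ≤ b → r a.ind ≤ r b.ind := by
    intro v r hr
    constructor
    · intro a
      refine MeasureAlgebra.isClosed_range_ind.mem_of_tendsto (hr a.ind)
        (Filter.Eventually.of_forall fun n => ?_)
      rw [koopman_ind]
      exact mem_range_self _
    · intro a b hab
      refine le_of_tendsto_of_tendsto (hr a.ind) (hr b.ind)
        (Filter.Eventually.of_forall fun n => ?_)
      change (v n).koopman a.ind ≤ (v n).koopman b.ind
      rw [koopman_ind, koopman_ind, MeasureAlgebra.ind_le_ind]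
      exact (v n).1.monotone hab
  obtain ⟨hp1, hp2⟩ := key u p hp
  obtain ⟨hq1, hq2⟩ := key _ q hq
  choose G hG using hp1
  choose G' hG' using hq1
  have h1 : ∀ a, G' (G a) = a := fun a => MeasureAlgebra.ind_injective (by rw [hG', hG, hqp])
  have h2 : ∀ a, G (G' a) = a := fun a => MeasureAlgebra.ind_injective (by rw [hG, hG', hpq])
  let g : Aut P := ⟨{
      toFun := G
      invFun := G'
      left_inv := h1
      right_inv := h2
      map_rel_iff' := by
        intro a b
        change G a ≤ G b ↔ a ≤ b
        constructor
        · intro h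
          have h3 := hq2 _ _ h
          rwa [← hG', ← hG', h1, h1, MeasureAlgebra.ind_le_ind] at h3
        · intro h
          have h3 := hp2 _ _ h
          rwa [← hG, ← hG, MeasureAlgebra.ind_le_ind] at h3 }, fun a => by
      change (G a).measure = a.measure
      rw [← ENNReal.toReal_eq_toReal_iff' (MeasureAlgebra.measure_ne_top _)
        (MeasureAlgebra.measure_ne_top _), ← MeasureAlgebra.norm_ind_sq,
        ← MeasureAlgebra.norm_ind_sq, hG]
      have h3 := ((hp a.ind).norm.pow 2)
      simp_rw [LinearIsometry.norm_map] at h3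
      exact tendsto_nhds_unique h3 tendsto_const_nhds⟩
  have hug : Filter.Tendsto u Filter.atTop (𝓝 g) := by
    refine tendsto_iff.2 fun a => MeasureAlgebra.tendsto_iff_ind.2 ?_
    simp_rw [← koopman_ind]
    have h3 : g.koopman a.ind = p a.ind := by
      rw [koopman_ind]
      exact hG a
    rw [h3]
    exact hp _
  exact ⟨g, fun f => tendsto_nhds_unique (tendsto_iff_koopman.1 hug f) (hp f),
    fun f => tendsto_nhds_unique (tendsto_iff_koopman.1 hug.inv f) (hq f)⟩

/-- The operators of g and g⁻¹ are recorded together, since a strong limit of invertible isometries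
alone might fail to be surjective. -/
instance : PolishSpace (Aut P) := by
  have : Fact ((1 : ℝ≥0∞) ≤ 2) := ⟨by norm_num⟩
  have : Fact ((2 : ℝ≥0∞) ≠ ∞) := ⟨by norm_num⟩
  refine polishSpace_of_nonexpansive
    (fun (g : Aut P) (f : Lp ℝ 2 P × Lp ℝ 2 P) => (g.koopman f.1, g⁻¹.koopman f.2)) ?_ ?_ ?_ ?_
  · rw [isInducing_iff_nhds]
    intro g
    refine le_antisymm (Filter.map_le_iff_le_comap.1 ?_) ?_
    · refine tendsto_pi_nhds.2 fun f => Filter.Tendsto.prodMk_nhds ?_ ?_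
      · exact (continuous_koopman f.1).tendsto g
      · exact ((continuous_koopman f.2).comp continuous_inv).tendsto g
    · refine Filter.tendsto_id'.1 ?_
      refine tendsto_iff_koopman.2 fun f => ?_
      have h := tendsto_pi_nhds.1 (Filter.tendsto_comap (f := fun (g : Aut P)
        (f : Lp ℝ 2 P × Lp ℝ 2 P) => (g.koopman f.1, g⁻¹.koopman f.2))
        (x := 𝓝 fun f => (g.koopman f.1, g⁻¹.koopman f.2))) (f, 0)
      exact h.fst_nhds
  · intro g h H
    exact koopman_injective fun f => congrArg Prod.fst (congrFun H (f, 0))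
  · intro g
    exact (g.koopman.isometry.prodMap g⁻¹.koopman.isometry).lipschitz
  · intro u r hr
    obtain ⟨g, h1, h2⟩ := exists_koopman_eq_of_tendsto u (fun f => (r (f, 0)).1)
      (fun f => (r (0, f)).2) (fun f => (hr (f, 0)).fst_nhds) (fun f => (hr (0, f)).snd_nhds)
    refine ⟨g, funext fun f => Prod.ext ?_ ?_⟩
    · exact (h1 f.1).trans (tendsto_nhds_unique (hr (f.1, 0)).fst_nhds (hr f).fst_nhds)
    · exact (h2 f.2).trans (tendsto_nhds_unique (hr (0, f.2)).snd_nhds (hr f).snd_nhds)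

end Aut

/-! ### The action on sub-σ-fields -/

namespace SubSigmaField

theorem measurableSet_smul_preimage (g : Aut P) (E : SubSigmaField P) {s : Set Ω}
    (hs : MeasurableSet[E.toMS] s) : MeasurableSet[(g • E).toMS] (g.pointMap ⁻¹' s) := by
  obtain ⟨_, h1, h2⟩ := g.mapsSet_pointMap (E.le s hs)
  exact ⟨h1, s, hs, h2⟩

theorem measurable_pointMap_smul (g : Aut P) (E : SubSigmaField P) :
    Measurable[(g • E).toMS, E.toMS] g.pointMap :=
  fun _ hs => measurableSet_smul_preimage g E hs

theorem aestronglyMeasurable_koopman (g : Aut P) (E : SubSigmaField P) {f : Lp ℝ 2 P}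
    (hf : AEStronglyMeasurable[E.toMS] f P) :
    AEStronglyMeasurable[(g • E).toMS] (g.koopman f) P := by
  obtain ⟨f', hf', h⟩ := hf
  refine ⟨f' ∘ g.pointMap, hf'.comp_measurable (measurable_pointMap_smul g E), ?_⟩
  exact (Lp.coeFn_compMeasurePreserving f g.measurePreserving_pointMap).trans
    (g.measurePreserving_pointMap.quasiMeasurePreserving.ae_eq_comp h)

/-- The Koopman operator of g is unitary and carries L₂(E) onto L₂(g E), hence intertwines the two
projections. -/
theorem proj_smul_koopman (g : Aut P) (E : SubSigmaField P) (f : Lp ℝ 2 P) :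
    (g • E).proj (g.koopman f) = g.koopman (E.proj f) := by
  refine proj_eq_of_inner _ (aestronglyMeasurable_koopman g E (E.aestronglyMeasurable_proj f))
    fun w hw => ?_
  have h1 := aestronglyMeasurable_koopman g⁻¹ _ hw
  rw [inv_smul_smul] at h1
  rw [← map_sub, ← g.koopman_koopman_inv w, LinearIsometry.inner_map_map, inner_sub_left,
    inner_proj_left, E.proj_eq_self.2 h1, sub_self]

theorem proj_smul (g : Aut P) (E : SubSigmaField P) (f : Lp ℝ 2 P) :
    (g • E).proj f = g.koopman (E.proj (g⁻¹.koopman f)) := by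
  rw [← proj_smul_koopman, Aut.koopman_koopman_inv]

theorem continuous_proj_uncurry :
    Continuous fun p : SubSigmaField P × Lp ℝ 2 P => p.1.proj p.2 :=
  continuous_prod_of_continuous_lipschitzWith' _ 1 lipschitzWith_proj continuous_proj

instance : ContinuousSMul (Aut P) (SubSigmaField P) where
  continuous_smul := by
    rw [continuous_iff_proj]
    intro f
    simp_rw [proj_smul]
    have h1 : Continuous fun p : Aut P × SubSigmaField P => p.1⁻¹.koopman f :=
      continuous_fst.inv.koopman continuous_const
    have h2 : Continuous fun p : Aut P × SubSigmaField P => (p.2, p.1⁻¹.koopman f) :=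
      continuous_snd.prodMk h1
    have h3 : Continuous fun p : Aut P × SubSigmaField P => p.2.proj (p.1⁻¹.koopman f) :=
      by
        have h4 := Continuous.comp continuous_proj_uncurry h2
        exact h4
    exact continuous_fst.koopman h3

theorem smul_mono (g : Aut P) {E F : SubSigmaField P} (h : E ≤ F) : g • E ≤ g • F := by
  rintro s ⟨hs, t, ht, e⟩
  exact ⟨hs, t, h t ht, e⟩

theorem IsTrivial.smul (g : Aut P) {E : SubSigmaField P} (h : E.IsTrivial) :
    (g • E).IsTrivial := by
  rintro s ⟨hs, t, ht, e⟩
  have h1 : P s = P t := Aut.MapsSet.measure_eq ⟨E.le t ht, hs, e⟩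
  rw [h1]
  exact h t ht

end SubSigmaField

end SigmaFields

namespace SigmaFields

variable {Ω : Type*} [mΩ : MeasurableSpace Ω] {P : Measure Ω} [IsProbabilityMeasure P]

/-! ### Relative nonatomicity -/

namespace SubSigmaField

/-- `F` is nonatomic relative to `E`: there are finite `F`-measurable partitions all of whose
cells have a small conditional probability given `E`. -/
def RelNonatomic (E F : SubSigmaField P) : Prop :=
  ∀ ε > 0, ∃ (N : ℕ) (φ : Ω → Fin N → Bool), Measurable[F.toMS] φ ∧
    ∑ b, ‖E.proj (indLp P (φ ⁻¹' {b}))‖ ^ 2 < ε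

theorem RelNonatomic.mono {E E' F F' : SubSigmaField P} (h : RelNonatomic E F) (hE : E' ≤ E)
    (hF : F ≤ F') : RelNonatomic E' F' := by
  intro ε hε
  obtain ⟨N, φ, hφ, h1⟩ := h ε hε
  refine ⟨N, φ, hφ.mono hF le_rfl, lt_of_le_of_lt (Finset.sum_le_sum fun b _ => ?_) h1⟩
  rw [← proj_proj_of_le hE]
  gcongr
  exact E'.norm_proj_le _

/-- An open condition approximating relative nonatomicity. -/
def nearlyRelNonatomic (P : Measure Ω) [IsProbabilityMeasure P] (ε : ℝ) :
    Set (SubSigmaField P × SubSigmaField P) :=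
  {p | ∃ (N : ℕ) (φ : Ω → Fin N → Bool), Measurable φ ∧
    ∑ b, ‖p.1.proj (indLp P (φ ⁻¹' {b}))‖ ^ 2 +
      ∑ i, ‖indLp P {ω | φ ω i = true} - p.2.proj (indLp P {ω | φ ω i = true})‖ ^ 2 < ε}

/-- For a fixed partition φ both sums depend continuously on the pair: φ need not be F-measurable,
its distance from F-measurability is penalized instead. The condition is thus a union of open ones.
-/
theorem isOpen_nearlyRelNonatomic (ε : ℝ) : IsOpen (nearlyRelNonatomic P ε) := by
  have h : nearlyRelNonatomic P ε = ⋃ (N : ℕ) (φ : Ω → Fin N → Bool) (_ : Measurable φ),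
      {p | ∑ b, ‖p.1.proj (indLp P (φ ⁻¹' {b}))‖ ^ 2 +
        ∑ i, ‖indLp P {ω | φ ω i = true} - p.2.proj (indLp P {ω | φ ω i = true})‖ ^ 2 < ε} := by
    ext p
    simp [nearlyRelNonatomic]
  rw [h]
  refine isOpen_iUnion fun N => isOpen_iUnion fun φ => isOpen_iUnion fun _ => ?_
  refine isOpen_lt (Continuous.add ?_ ?_) continuous_const
  · exact continuous_finsetSum _ fun b _ =>
      (((continuous_proj _).comp continuous_fst).norm.pow 2)
  · exact continuous_finsetSum _ fun b _ =>
      ((continuous_const.sub ((continuous_proj _).comp continuous_snd)).norm.pow 2)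

theorem sum_measureReal_preimage_inter {ι : Type*} [Fintype ι] [MeasurableSpace ι]
    [MeasurableSingletonClass ι] {φ : Ω → ι} (hφ : Measurable φ) (D : Set Ω) :
    ∑ b, P.real (φ ⁻¹' {b} ∩ D) = P.real D := by
  have h := sum_measureReal_preimage_singleton (μ := P.restrict D) (f := φ) Finset.univ
    fun b _ => hφ (measurableSet_singleton b)
  simpa [measureReal_restrict_apply, hφ (measurableSet_singleton _)] using h

theorem measureReal_half_le (f : Lp ℝ 2 P) :
    P.real {ω | 1 / 2 ≤ |f ω|} ≤ 4 * ‖f‖ ^ 2 := by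
  have h1 : Integrable (fun ω => f ω ^ 2) P := (Lp.memLp f).integrable_sq
  have h2 := mul_meas_ge_le_integral_of_nonneg
    (Filter.Eventually.of_forall fun ω => sq_nonneg (f ω)) h1 (1 / 4)
  rw [← norm_sq_eq_integral] at h2
  have h3 : {ω | 1 / 2 ≤ |f ω|} = {ω | 1 / 4 ≤ f ω ^ 2} := by
    ext ω
    simp only [mem_ofPred_eq]
    rw [← sq_abs]
    constructor <;> intro h <;> nlinarith [abs_nonneg (f ω)]
  rw [h3]
  linarith

/-- For the converse, round the F-conditional probabilities of the coordinate events of φ at the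
level 1/2 to get an F-measurable ψ. By Chebyshev, ψ ≠ φ has probability at most 4 times the penalty,
and the energy of ψ exceeds twice that of φ by at most 4 P(ψ ≠ φ). -/
theorem relNonatomic_iff {E F : SubSigmaField P} :
    RelNonatomic E F ↔ ∀ n : ℕ, (E, F) ∈ nearlyRelNonatomic P (1 / (n + 1)) := by
  constructor
  · intro h n
    obtain ⟨N, φ, hφ, h1⟩ := h (1 / (n + 1)) (by positivity)
    refine ⟨N, φ, hφ.mono F.le le_rfl, ?_⟩
    have h2 : ∀ i, F.proj (indLp P {ω | φ ω i = true}) = indLp P {ω | φ ω i = true} := by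
      intro i
      have h3 : MeasurableSet[F.toMS] {ω | φ ω i = true} :=
        ((measurable_pi_apply i).comp hφ) (measurableSet_singleton true)
      exact (F.measurableSet_iff_proj (F.le _ h3)).1 h3
    simpa [h2] using h1
  · intro h ε hε
    -- With energy a and penalty b of φ, the final bound is 2a + 16b, where a + b < ε / 18.
    obtain ⟨n, hn⟩ := exists_nat_one_div_lt (show 0 < ε / 18 by positivity)
    obtain ⟨N, φ, hφ, h1⟩ := h n
    have hS : ∀ i, MeasurableSet {ω | φ ω i = true} := fun i =>
      ((measurable_pi_apply i).comp hφ) (measurableSet_singleton true)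
    let f : Fin N → Lp ℝ 2 P := fun i => F.proj (indLp P {ω | φ ω i = true})
    have hf : ∀ i, Measurable[F.toMS] (f i) := fun i =>
      F.measurable_of_aestronglyMeasurable (Lp.stronglyMeasurable _).measurable
        (F.aestronglyMeasurable_proj _)
    classical
    let ψ : Ω → Fin N → Bool := fun ω i => decide (1 / 2 < f i ω)
    have hψ : Measurable[F.toMS] ψ := by
      refine @measurable_pi_lambda _ _ _ F.toMS _ _ fun i => @measurable_to_bool _ F.toMS _ ?_
      have : (fun ω => ψ ω i) ⁻¹' {true} = f i ⁻¹' Ioi (1 / 2) := by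
        ext ω
        simp [ψ]
      rw [this]
      exact hf i measurableSet_Ioi
    have hψ' : Measurable ψ := hψ.mono F.le le_rfl
    let D : Set Ω := {ω | φ ω ≠ ψ ω}
    have hD : MeasurableSet D := (measurableSet_eq_fun hφ hψ').compl
    have hPD : P.real D ≤ 4 * ∑ i, ‖indLp P {ω | φ ω i = true} - f i‖ ^ 2 := by
      rw [Finset.mul_sum]
      refine le_trans ?_ (Finset.sum_le_sum fun i _ => measureReal_half_le _)
      refine le_trans ?_ (measureReal_iUnion_fintype_le _)
      refine ENNReal.toReal_mono (measure_ne_top _ _) (measure_mono_ae ?_)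
      have h2 : ∀ᵐ ω ∂P, ∀ i, (indLp P {ω | φ ω i = true} - f i : Lp ℝ 2 P) ω =
          ({ω | φ ω i = true}.indicator (fun _ => (1 : ℝ)) ω) - f i ω := by
        refine ae_all_iff.2 fun i => ?_
        filter_upwards [Lp.coeFn_sub (indLp P {ω | φ ω i = true}) (f i),
          coeFn_indLp (P := P) (hS i)] with ω h3 h4
        rw [h3, Pi.sub_apply, h4]
      filter_upwards [h2] with ω hω hωD
      by_contra hcon
      refine hωD (funext fun i => ?_)
      have h3 : ¬ 1 / 2 ≤ |(indLp P {ω | φ ω i = true} - f i : Lp ℝ 2 P) ω| := fun h4 =>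
        hcon (mem_iUnion.2 ⟨i, h4⟩)
      rw [hω i, not_le, abs_lt] at h3
      by_cases hi : φ ω i = true
      · have : 1 / 2 < f i ω := by
          rw [indicator_of_mem (by exact hi)] at h3
          linarith
        rw [hi]
        exact (decide_eq_true this).symm
      · have : ¬ 1 / 2 < f i ω := by
          rw [indicator_of_notMem (by exact hi)] at h3
          linarith
        rw [Bool.not_eq_true] at hi
        rw [hi]
        exact (decide_eq_false this).symm
    refine ⟨N, ψ, hψ, ?_⟩
    have hb : ∀ b, ‖E.proj (indLp P (ψ ⁻¹' {b}))‖ ^ 2 ≤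
        2 * ‖E.proj (indLp P (φ ⁻¹' {b}))‖ ^ 2 +
          2 * (P.real (φ ⁻¹' {b} ∩ D) + P.real (ψ ⁻¹' {b} ∩ D)) := by
      intro b
      have hA := hφ (measurableSet_singleton b)
      have hC := hψ' (measurableSet_singleton b)
      have h2 := norm_indLp_sub_sq (P := P) hC hA
      have h3 : P.real ((ψ ⁻¹' {b}) ∆ (φ ⁻¹' {b})) ≤
          P.real (φ ⁻¹' {b} ∩ D) + P.real (ψ ⁻¹' {b} ∩ D) := by
        refine le_trans (measureReal_mono ?_) (measureReal_union_le _ _)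
        intro ω hω
        rcases hω with ⟨h4, h5⟩ | ⟨h4, h5⟩
        · exact Or.inr ⟨h4, fun h6 => h5 (by rw [mem_preimage, h6]; exact h4)⟩
        · exact Or.inl ⟨h4, fun h6 => h5 (by rw [mem_preimage, ← h6]; exact h4)⟩
      have h4 := E.norm_proj_le (indLp P (ψ ⁻¹' {b}) - indLp P (φ ⁻¹' {b}))
      have h5 : E.proj (indLp P (ψ ⁻¹' {b})) = E.proj (indLp P (φ ⁻¹' {b})) +
          E.proj (indLp P (ψ ⁻¹' {b}) - indLp P (φ ⁻¹' {b})) := by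
        rw [map_sub]; abel
      have h6 := norm_add_le (E.proj (indLp P (φ ⁻¹' {b})))
        (E.proj (indLp P (ψ ⁻¹' {b}) - indLp P (φ ⁻¹' {b})))
      rw [← h5] at h6
      have h7 : ‖E.proj (indLp P (ψ ⁻¹' {b}) - indLp P (φ ⁻¹' {b}))‖ ^ 2 ≤
          P.real (φ ⁻¹' {b} ∩ D) + P.real (ψ ⁻¹' {b} ∩ D) := by
        refine le_trans ?_ (h2.le.trans h3)
        gcongr
      have h8 := norm_nonneg (E.proj (indLp P (ψ ⁻¹' {b})))
      nlinarith [sq_nonneg (‖E.proj (indLp P (φ ⁻¹' {b}))‖ -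
        ‖E.proj (indLp P (ψ ⁻¹' {b}) - indLp P (φ ⁻¹' {b}))‖)]
    have hsum := Finset.sum_le_sum fun b (_ : b ∈ Finset.univ) => hb b
    rw [Finset.sum_add_distrib, ← Finset.mul_sum, ← Finset.mul_sum, Finset.sum_add_distrib,
      sum_measureReal_preimage_inter hφ D, sum_measureReal_preimage_inter hψ' D] at hsum
    change _ + ∑ i, ‖indLp P {ω | φ ω i = true} - f i‖ ^ 2 < _ at h1
    have h9 : 0 ≤ ∑ b, ‖E.proj (indLp P (φ ⁻¹' {b}))‖ ^ 2 :=
      Finset.sum_nonneg fun _ _ => sq_nonneg _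
    linarith

/-- A sub-σ-field is generated modulo null sets by a countable family of its sets. -/
theorem exists_generator [MeasurableSpace.CountablyGenerated Ω] (F : SubSigmaField P) :
    ∃ Y : Ω → ℕ → Bool, Measurable[F.toMS] Y ∧ ∀ A, MeasurableSet[F.toMS] A →
      ∃ B, MeasurableSet B ∧ A =ᵐ[P] Y ⁻¹' B := by
  have : Fact ((1 : ℝ≥0∞) ≤ 2) := ⟨by norm_num⟩
  have : Fact ((2 : ℝ≥0∞) ≠ ∞) := ⟨by norm_num⟩
  -- L² is separable, so countably many sets of F have indicators dense among all indicators of sets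
  -- of F.
  let R : Set (Lp ℝ 2 P) := indLp P '' {A | MeasurableSet[F.toMS] A}
  have : Nonempty R := ⟨⟨_, univ, @MeasurableSet.univ _ F.toMS, rfl⟩⟩
  choose A hA hAR using fun n => (TopologicalSpace.denseSeq R n).2
  classical
  let Y : Ω → ℕ → Bool := fun ω n => decide (ω ∈ A n)
  have hY : Measurable[F.toMS] Y := by
    refine @measurable_pi_lambda _ _ _ F.toMS _ _ fun i => @measurable_to_bool _ F.toMS _ ?_
    have h : (fun ω => Y ω i) ⁻¹' {true} = A i := by
      ext ω
      simp [Y]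
    rw [h]
    exact hA i
  have hYm : Measurable Y := hY.mono F.le le_rfl
  refine ⟨Y, hY, fun B hB => ?_⟩
  have hm : MeasurableSpace.comap Y inferInstance ≤ mΩ := hYm.comap_le
  have hAm : ∀ n, MeasurableSet[MeasurableSpace.comap Y inferInstance] (A n) := by
    intro n
    refine ⟨(fun y => y n) ⁻¹' {true}, measurable_pi_apply n (measurableSet_singleton true), ?_⟩
    ext ω
    simp [Y]
  -- The functions measurable with respect to Y form a closed subspace, so it contains the indicator
  -- of every set of F and not just of the dense ones.
  have hcl := isClosed_aestronglyMeasurable (F := ℝ) (p := 2) (μ := P) hm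
  have hBcl : indLp P B ∈ {f : Lp ℝ 2 P |
      AEStronglyMeasurable[MeasurableSpace.comap Y inferInstance] f P} := by
    have h1 : (⟨indLp P B, B, hB, rfl⟩ : R) ∈ closure (range (TopologicalSpace.denseSeq R)) :=
      TopologicalSpace.denseRange_denseSeq R _
    have h2 := image_closure_subset_closure_image (continuous_subtype_val (p := fun x => x ∈ R))
      (mem_image_of_mem _ h1)
    refine hcl.closure_subset_iff.2 ?_ h2
    rintro _ ⟨_, ⟨n, rfl⟩, rfl⟩
    rw [← hAR n]
    refine ⟨_, ?_, coeFn_indLp (F.le _ (hA n))⟩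
    exact stronglyMeasurable_const.indicator (hAm n)
  obtain ⟨g, hg, hBg⟩ := hBcl
  have h3 : MeasurableSet[MeasurableSpace.comap Y inferInstance] (g ⁻¹' {1}) :=
    hg.measurable (measurableSet_singleton 1)
  obtain ⟨C, hC, hCg⟩ := h3
  refine ⟨C, hC, ?_⟩
  rw [hCg]
  filter_upwards [hBg, coeFn_indLp (P := P) (F.le _ hB)] with ω h4 h5
  refine propext ?_
  change ω ∈ B ↔ g ω = 1
  rw [← h4, h5]
  by_cases hω : ω ∈ B <;> simp [hω]

end SubSigmaField

end SigmaFields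

namespace SigmaFields

/-! ### Relative nonatomicity and conditional measures -/

/-- A measure on the Cantor space without point masses has small energy on fine cylinders. -/
theorem tendsto_sum_cylinder_sq (ν : Measure (ℕ → Bool)) [IsFiniteMeasure ν]
    (hν : ∀ y, ν {y} = 0) :
    Filter.Tendsto (fun N : ℕ => ∑ b : Fin N → Bool, ν {y | (fun i : Fin N => y i) = b} ^ 2)
      Filter.atTop (𝓝 0) := by
  have hπ : ∀ N : ℕ, Measurable fun (y : ℕ → Bool) (i : Fin N) => y i := fun N =>
    measurable_pi_lambda _ fun i => measurable_pi_apply _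
  -- The sum of squares is the probability that two independent points of law ν agree in their first
  -- N coordinates; these events decrease to the diagonal, which is null.
  let S : ℕ → Set ((ℕ → Bool) × (ℕ → Bool)) := fun N =>
    {p | (fun i : Fin N => p.1 i) = fun i : Fin N => p.2 i}
  have hS : ∀ N, MeasurableSet (S N) := fun N =>
    measurableSet_eq_fun ((hπ N).comp measurable_fst) ((hπ N).comp measurable_snd)
  have hanti : Antitone S := by
    intro N M hNM p hp
    funext i
    exact congrFun hp ⟨i, i.2.trans_le hNM⟩
  have hint : ⋂ N, S N = {p | p.1 = p.2} := by
    ext p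
    simp only [mem_iInter, mem_ofPred_eq]
    constructor
    · intro h
      funext n
      exact congrFun (h (n + 1)) ⟨n, Nat.lt_succ_self n⟩
    · intro h N
      change (fun i : Fin N => p.1 i) = fun i : Fin N => p.2 i
      rw [h]
  have hdiag : ν.prod ν {p | p.1 = p.2} = 0 := by
    rw [Measure.prod_apply (measurableSet_eq_fun measurable_fst measurable_snd)]
    have h : ∀ x, (Prod.mk x ⁻¹' {p : (ℕ → Bool) × (ℕ → Bool) | p.1 = p.2}) = {x} := by
      intro x
      ext y
      simp [eq_comm]
    simp [h, hν]
  have h1 := tendsto_measure_iInter_atTop (μ := ν.prod ν) (fun N => (hS N).nullMeasurableSet)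
    hanti ⟨0, measure_ne_top _ _⟩
  rw [hint, hdiag] at h1
  refine h1.congr fun N => ?_
  have hB : ∀ b : Fin N → Bool, MeasurableSet {y : ℕ → Bool | (fun i : Fin N => y i) = b} :=
    fun b => hπ N (measurableSet_singleton b)
  have h2 : S N = ⋃ b : Fin N → Bool,
      {y : ℕ → Bool | (fun i : Fin N => y i) = b} ×ˢ {y | (fun i : Fin N => y i) = b} := by
    ext p
    simp only [mem_iUnion, mem_prod, mem_ofPred_eq]
    constructor
    · intro h
      exact ⟨_, rfl, Eq.symm h⟩
    · rintro ⟨b, h3, h4⟩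
      exact h3.trans h4.symm
  change ν.prod ν (S N) = _
  rw [h2, measure_iUnion, tsum_fintype]
  · exact Finset.sum_congr rfl fun b _ => by rw [Measure.prod_prod, sq]
  · intro b c hbc
    refine Set.disjoint_left.2 fun p hp hq => hbc ?_
    exact (Eq.symm hp.1).trans hq.1
  · exact fun b => (hB b).prod (hB b)

variable {Ω : Type*} [mΩ : MeasurableSpace Ω] {P : Measure Ω}

namespace SubSigmaField

section Generator

variable [IsProbabilityMeasure P]

theorem measurable_take {m : MeasurableSpace Ω} {Y : Ω → ℕ → Bool} (hY : Measurable[m] Y) (N : ℕ) :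
    Measurable[m] fun ω (i : Fin N) => Y ω i :=
  @measurable_pi_lambda _ _ _ m _ _ fun _ => (measurable_pi_apply _).comp hY

/-- A nonatomic independent σ-field makes for relative nonatomicity. -/
theorem IsNonatomic.relNonatomic [MeasurableSpace.CountablyGenerated Ω] {E F : SubSigmaField P}
    (hF : F.IsNonatomic) (hi : Indep E.toMS F.toMS P) : RelNonatomic E F := by
  obtain ⟨Y, hY, hgen⟩ := F.exists_generator
  have hYm : Measurable Y := hY.mono F.le le_rfl
  -- A point mass of the law of Y would be an atom of F, as every set of F is almost a union of
  -- fibres of Y.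
  have hν : ∀ y, P.map Y {y} = 0 := by
    intro y
    rw [Measure.map_apply hYm (measurableSet_singleton y)]
    by_contra h0
    obtain ⟨t, hts, ht, h1, h2⟩ := hF _ (hY (measurableSet_singleton y)) (pos_iff_ne_zero.2 h0)
    obtain ⟨B, hB, htB⟩ := hgen t ht
    have h3 : t =ᵐ[P] (Y ⁻¹' B ∩ Y ⁻¹' {y} : Set Ω) := by
      have h4 := htB.inter (Filter.EventuallyEq.refl (ae P) (Y ⁻¹' {y}))
      rwa [inter_eq_self_of_subset_left hts] at h4
    by_cases hy : y ∈ B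
    · rw [inter_eq_self_of_subset_right (preimage_mono (singleton_subset_iff.2 hy))] at h3
      exact h2.ne (measure_congr h3)
    · have h5 : Y ⁻¹' B ∩ Y ⁻¹' {y} = ∅ := by
        rw [← preimage_inter, inter_singleton_eq_empty.2 hy, preimage_empty]
      rw [h5] at h3
      rw [measure_congr h3, measure_empty] at h1
      exact lt_irrefl _ h1
  have : IsProbabilityMeasure (P.map Y) := Measure.isProbabilityMeasure_map hYm.aemeasurable
  intro ε hε
  have h1 := tendsto_sum_cylinder_sq (P.map Y) hν
  obtain ⟨N, hN⟩ := ((ENNReal.tendsto_nhds_zero.1 h1 (ENNReal.ofReal (ε / 2))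
    (by positivity))).exists
  refine ⟨N, fun ω i => Y ω i, measurable_take hY N, ?_⟩
  have h2 : ∀ b : Fin N → Bool,
      ‖E.proj (indLp P ((fun ω (i : Fin N) => Y ω i) ⁻¹' {b}))‖ ^ 2 =
        (P.map Y {y | (fun i : Fin N => y i) = b} ^ 2).toReal := by
    intro b
    have hm : MeasurableSet[F.toMS] ((fun ω (i : Fin N) => Y ω i) ⁻¹' {b}) :=
      measurable_take hY N (measurableSet_singleton b)
    have hB : MeasurableSet {y : ℕ → Bool | (fun i : Fin N => y i) = b} :=
      measurable_take measurable_id N (measurableSet_singleton b)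
    rw [Measure.map_apply hYm hB, norm_sq_eq_integral]
    -- By independence the conditional probabilities are constant, so the energy of the cylinders is
    -- computed from the law of Y alone.
    have h3 : E.proj (indLp P ((fun ω (i : Fin N) => Y ω i) ⁻¹' {b})) =ᵐ[P]
        fun _ => P.real ((fun ω (i : Fin N) => Y ω i) ⁻¹' {b}) := by
      refine (E.proj_indLp_ae_eq (F.le _ hm)).trans ?_
      have h4 := condExp_indep_eq F.le E.le
        (f := ((fun ω (i : Fin N) => Y ω i) ⁻¹' {b}).indicator fun _ => (1 : ℝ))
        (stronglyMeasurable_const.indicator hm) hi.symm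
      refine h4.trans (Filter.Eventually.of_forall fun ω => ?_)
      exact integral_indicator_one (F.le _ hm)
    rw [integral_congr_ae (h3.mono fun ω h => congrArg (· ^ 2) h)]
    simp [Measure.real]
    rfl
  simp_rw [h2]
  rw [← ENNReal.toReal_sum (fun b _ => ENNReal.pow_ne_top (measure_ne_top _ _))]
  refine lt_of_le_of_lt (ENNReal.toReal_mono ENNReal.ofReal_ne_top hN) ?_
  rw [ENNReal.toReal_ofReal (by positivity)]
  linarith

end Generator

variable [StandardBorelSpace Ω] [IsProbabilityMeasure P]

theorem ofReal_norm_proj_sq (E : SubSigmaField P) {A : Set Ω} (hA : MeasurableSet A) :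
    ENNReal.ofReal (‖E.proj (indLp P A)‖ ^ 2) =
      ∫⁻ ω, condExpKernel P E.toMS ω A ^ 2 ∂P := by
  have h1 : E.proj (indLp P A) =ᵐ[P] fun ω => (condExpKernel P E.toMS ω).real A :=
    (E.proj_indLp_ae_eq hA).trans (condExpKernel_ae_eq_condExp E.le hA).symm
  rw [norm_sq_eq_integral, ofReal_integral_eq_lintegral_ofReal (Lp.memLp _).integrable_sq
    (Filter.Eventually.of_forall fun ω => sq_nonneg _)]
  refine lintegral_congr_ae ?_
  filter_upwards [h1] with ω hω
  rw [hω, ENNReal.ofReal_pow measureReal_nonneg, ofReal_measureReal]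

theorem ae_condExpKernel_eq_zero (E : SubSigmaField P) {A : Set Ω} (hA : MeasurableSet A)
    (h : P A = 0) : ∀ᵐ ω ∂P, condExpKernel P E.toMS ω A = 0 := by
  have h1 := E.ofReal_norm_proj_sq hA
  rw [indLp_congr hA MeasurableSet.empty (ae_eq_empty.2 h), indLp_empty, map_zero, norm_zero,
    zero_pow two_ne_zero, ENNReal.ofReal_zero, eq_comm, lintegral_eq_zero_iff
    (((measurable_condExpKernel hA).mono E.le le_rfl).pow_const 2)] at h1
  filter_upwards [h1] with ω hω
  exact pow_eq_zero_iff two_ne_zero |>.1 hω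

/-- A point y lies in some cell, or else in the exceptional conditionally null set; in either case
the square of its conditional mass is at most the conditional energy `e k`. The energies tend to 0
in mean, so by Fatou their lower limit vanishes almost surely, and the exceptional null set does not
depend on y. -/
theorem RelNonatomic.ae_preimage_singleton {E F : SubSigmaField P} (h : RelNonatomic E F)
    {Z : Type*} [MeasurableSpace Z] {Y : Ω → Z} (hY : Measurable Y)
    (hgen : ∀ A, MeasurableSet[F.toMS] A → ∃ B, MeasurableSet B ∧ A =ᵐ[P] Y ⁻¹' B) :
    ∀ᵐ ω ∂P, ∀ y, condExpKernel P E.toMS ω (Y ⁻¹' {y}) = 0 := by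
  have hk : ∀ k : ℕ, ∃ (N : ℕ) (B : (Fin N → Bool) → Set Z), (∀ b, MeasurableSet (B b)) ∧
      P (⋃ b, Y ⁻¹' B b)ᶜ = 0 ∧
      ∫⁻ ω, ∑ b, condExpKernel P E.toMS ω (Y ⁻¹' B b) ^ 2 ∂P ≤
        ENNReal.ofReal (1 / (k + 1)) := by
    intro k
    obtain ⟨N, φ, hφ, h1⟩ := h (1 / (k + 1)) (by positivity)
    have hφb := fun b => hφ (measurableSet_singleton b)
    choose B hB hφB using fun b => hgen _ (hφb b)
    refine ⟨N, B, hB, ?_, ?_⟩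
    · have h2 : ∀ᵐ ω ∂P, ∀ b, ω ∈ φ ⁻¹' {b} → ω ∈ Y ⁻¹' B b :=
        ae_all_iff.2 fun b => (hφB b).le
      refine measure_eq_zero_iff_ae_notMem.2 ?_
      filter_upwards [h2] with ω hω hcon
      exact hcon (mem_iUnion.2 ⟨φ ω, hω _ rfl⟩)
    · rw [lintegral_finsetSum _ fun b _ =>
        ((measurable_condExpKernel (hY (hB b))).mono E.le le_rfl).pow_const 2]
      simp_rw [← fun b => E.ofReal_norm_proj_sq (hY (hB b))]
      rw [← ENNReal.ofReal_sum_of_nonneg fun b _ => sq_nonneg _]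
      refine ENNReal.ofReal_le_ofReal (le_of_eq_of_le ?_ h1.le)
      exact Finset.sum_congr rfl fun b _ => by
        rw [indLp_congr (hY (hB b)) (F.le _ (hφb b)) (hφB b).symm]
  choose N B hB hcov hint using hk
  let e : ℕ → Ω → ℝ≥0∞ := fun k ω => ∑ b, condExpKernel P E.toMS ω (Y ⁻¹' B k b) ^ 2
  have he : ∀ k, Measurable (e k) := fun k => Finset.measurable_fun_sum _ fun b _ =>
    ((measurable_condExpKernel (hY (hB k b))).mono E.le le_rfl).pow_const 2
  have hlim : Filter.Tendsto (fun k => ∫⁻ ω, e k ω ∂P) Filter.atTop (𝓝 0) := by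
    refine tendsto_of_tendsto_of_tendsto_of_le_of_le tendsto_const_nhds ?_
      (fun _ => zero_le) hint
    have := ENNReal.tendsto_ofReal tendsto_one_div_add_atTop_nhds_zero_nat
    rwa [ENNReal.ofReal_zero] at this
  have hinf : ∀ᵐ ω ∂P, Filter.liminf (fun k => e k ω) Filter.atTop = 0 := by
    have h1 := lintegral_liminf_le (μ := P) (u := Filter.atTop) he
    rw [hlim.liminf_eq] at h1
    have h2 : Measurable fun ω => Filter.liminf (fun k => e k ω) Filter.atTop :=
      Measurable.liminf he
    exact (lintegral_eq_zero_iff h2).1 (le_antisymm h1 zero_le)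
  have hcov' : ∀ᵐ ω ∂P, ∀ k, condExpKernel P E.toMS ω (⋃ b, Y ⁻¹' B k b)ᶜ = 0 :=
    ae_all_iff.2 fun k => E.ae_condExpKernel_eq_zero
      (MeasurableSet.iUnion fun b => hY (hB k b)).compl (hcov k)
  filter_upwards [hinf, hcov'] with ω h1 h2 y
  have h3 : ∀ k, condExpKernel P E.toMS ω (Y ⁻¹' {y}) ^ 2 ≤ e k ω := by
    intro k
    by_cases hy : ∃ b, y ∈ B k b
    · obtain ⟨b, hb⟩ := hy
      refine le_trans ?_ (Finset.single_le_sum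
        (f := fun b => condExpKernel P E.toMS ω (Y ⁻¹' B k b) ^ 2) (fun _ _ => zero_le)
        (Finset.mem_univ b))
      gcongr
      exact singleton_subset_iff.2 hb
    · have h4 : condExpKernel P E.toMS ω (Y ⁻¹' {y}) = 0 := by
        refine measure_mono_null ?_ (h2 k)
        intro ω' hω' hcon
        obtain ⟨b, hb⟩ := mem_iUnion.1 hcon
        rw [mem_preimage, mem_singleton_iff] at hω'
        exact hy ⟨b, hω' ▸ hb⟩
      rw [h4]
      simp
  have h5 : condExpKernel P E.toMS ω (Y ⁻¹' {y}) ^ 2 ≤ 0 := by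
    rw [← h1]
    exact Filter.le_liminf_of_le (by isBoundedDefault) (Filter.Eventually.of_forall h3)
  exact pow_eq_zero_iff two_ne_zero |>.1 (le_antisymm h5 zero_le)

/-- The conditional energies of the cylinder partitions of Y are bounded by 1 and tend to 0 almost
surely by `tendsto_sum_cylinder_sq`; dominated convergence concludes. -/
theorem relNonatomic_of_ae_preimage_singleton {E F : SubSigmaField P} {Y : Ω → ℕ → Bool}
    (hY : Measurable[F.toMS] Y)
    (h : ∀ᵐ ω ∂P, ∀ y, condExpKernel P E.toMS ω (Y ⁻¹' {y}) = 0) : RelNonatomic E F := by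
  have hYm : Measurable Y := hY.mono F.le le_rfl
  let e : ℕ → Ω → ℝ≥0∞ := fun N ω =>
    ∑ b, condExpKernel P E.toMS ω ((fun ω (i : Fin N) => Y ω i) ⁻¹' {b}) ^ 2
  have hφ : ∀ N (b : Fin N → Bool), MeasurableSet[F.toMS] ((fun ω (i : Fin N) => Y ω i) ⁻¹' {b}) :=
    fun N b => measurable_take hY N (measurableSet_singleton b)
  have he : ∀ k, Measurable (e k) := fun k => Finset.measurable_fun_sum _ fun b _ =>
    ((measurable_condExpKernel (F.le _ (hφ k b))).mono E.le le_rfl).pow_const 2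
  have hle : ∀ N ω, e N ω ≤ 1 := by
    intro N ω
    have h1 := sum_measure_preimage_singleton (μ := condExpKernel P E.toMS ω)
      (f := fun ω (i : Fin N) => Y ω i) Finset.univ fun b _ => F.le _ (hφ N b)
    rw [Finset.coe_univ, preimage_univ, measure_univ] at h1
    refine le_trans (Finset.sum_le_sum fun b _ => ?_) h1.le
    rw [sq]
    exact mul_le_of_le_one_left zero_le prob_le_one
  have hlim : Filter.Tendsto (fun N => ∫⁻ ω, e N ω ∂P) Filter.atTop (𝓝 (∫⁻ _, 0 ∂P)) := by
    refine tendsto_lintegral_of_dominated_convergence (fun _ => 1) he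
      (fun N => Filter.Eventually.of_forall (hle N)) (by simp) ?_
    filter_upwards [h] with ω hω
    have : IsProbabilityMeasure ((condExpKernel P E.toMS ω).map Y) :=
      Measure.isProbabilityMeasure_map hYm.aemeasurable
    have h1 := tendsto_sum_cylinder_sq ((condExpKernel P E.toMS ω).map Y) fun y => by
      rw [Measure.map_apply hYm (measurableSet_singleton y)]
      exact hω y
    refine h1.congr fun N => Finset.sum_congr rfl fun b _ => ?_
    have hB : MeasurableSet {y : ℕ → Bool | (fun i : Fin N => y i) = b} :=
      measurable_take measurable_id N (measurableSet_singleton b)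
    rw [Measure.map_apply hYm hB]
    rfl
  rw [lintegral_zero] at hlim
  intro ε hε
  obtain ⟨N, hN⟩ := (ENNReal.tendsto_nhds_zero.1 hlim (ENNReal.ofReal (ε / 2))
    (by positivity)).exists
  refine ⟨N, fun ω i => Y ω i, measurable_take hY N, ?_⟩
  rw [lintegral_finsetSum _ fun b _ =>
    ((measurable_condExpKernel (F.le _ (hφ N b))).mono E.le le_rfl).pow_const 2] at hN
  simp_rw [← fun b => E.ofReal_norm_proj_sq (F.le _ (hφ N b))] at hN
  rw [← ENNReal.ofReal_sum_of_nonneg fun b _ => sq_nonneg _,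
    ENNReal.ofReal_le_ofReal_iff (by positivity)] at hN
  linarith

/-- The largest sub-σ-field. -/
instance : Top (SubSigmaField P) :=
  ⟨{ toMS := mΩ
     le := le_rfl
     null_mem := fun _ hs _ => hs }⟩

theorem le_top' (E : SubSigmaField P) : E ≤ ⊤ := E.le

/-- An injective Y into the Cantor space has fibres with at most one point, so the two preceding
criteria, applied with the whole σ-field, speak of point masses of the conditional measures. -/
theorem mem_condNonatomic_iff {E : SubSigmaField P} :
    E ∈ condNonatomic P ↔ RelNonatomic E ⊤ := by
  let Y : Ω → ℕ → Bool := MeasurableSpace.mapNatBool Ω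
  have hY : MeasurableEmbedding Y := (MeasurableSpace.measurable_mapNatBool Ω).measurableEmbedding
    (MeasurableSpace.injective_mapNatBool Ω)
  constructor
  · intro h
    refine relNonatomic_of_ae_preimage_singleton (Y := Y) hY.measurable ?_
    filter_upwards [h] with ω hω y
    have hsub : (Y ⁻¹' {y}).Subsingleton := subsingleton_singleton.preimage hY.injective
    exact hsub.measure_zero _
  · intro h
    have h1 := h.ae_preimage_singleton hY.measurable fun A hA =>
      ⟨Y '' A, hY.measurableSet_image.2 hA, by
        rw [preimage_image_eq _ hY.injective]
        exact Filter.EventuallyEq.rfl⟩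
    change ∀ᵐ ω ∂P, NullSingletonClass (condExpKernel P E.toMS ω)
    filter_upwards [h1] with ω hω
    refine ⟨fun x => ?_⟩
    have h2 := hω (Y x)
    rwa [← image_singleton, preimage_image_eq _ hY.injective] at h2

end SubSigmaField

end SigmaFields

namespace SigmaFields

/-! ### The conditional probability integral transform -/

/-- The set is an interval on which the distribution function is constant. A compact subset with
maximum z lies in (y, z], which is null; inner regularity does the rest. -/
theorem measure_cdf_flat (ν : Measure ℝ) [IsFiniteMeasure ν] (y : ℝ) :
    ν {z | y < z ∧ ν.real (Iic z) ≤ ν.real (Iic y)} = 0 := by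
  have hoc : OrdConnected {z | y < z ∧ ν.real (Iic z) ≤ ν.real (Iic y)} :=
    ⟨fun a ha b hb c hc => ⟨ha.1.trans_le hc.1,
      (measureReal_mono (Iic_subset_Iic.2 hc.2)).trans hb.2⟩⟩
  rw [hoc.measurableSet.measure_eq_iSup_isCompact]
  simp only [ENNReal.iSup_eq_zero]
  intro K hK hKc
  rcases K.eq_empty_or_nonempty with rfl | hne
  · exact measure_empty
  obtain ⟨z, hzK, hz⟩ := hKc.exists_isGreatest hne
  obtain ⟨h1, h2⟩ := hK hzK
  have h3 : K ⊆ Iic z \ Iic y := fun w hw => ⟨hz hw, not_le.2 (hK hw).1⟩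
  refine measure_mono_null h3 ?_
  have h4 := measureReal_sdiff (μ := ν) (Iic_subset_Iic.2 h1.le) (measurableSet_Iic (a := y))
  have h5 : ν.real (Iic z \ Iic y) = 0 :=
    le_antisymm (by linarith) measureReal_nonneg
  exact (measureReal_eq_zero_iff).1 h5

/-- The probability integral transform. For 0 < v < 1, continuity provides y with distribution
function v, and the event is then (-∞, y] plus a null flat piece. -/
theorem measure_cdf_le (ν : Measure ℝ) [IsProbabilityMeasure ν] (hν : ∀ y, ν {y} = 0) {u : ℝ}
    (hu : u ∈ Icc (0 : ℝ) 1) : ν {y | ν.real (Iic y) ≤ u} = ENNReal.ofReal u := by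
  have hcont : Continuous (cdf ν) := by
    rw [continuous_iff_continuousAt]
    intro a
    rw [(monotone_cdf ν).continuousAt_iff_leftLim_eq_rightLim, StieltjesFunction.rightLim_eq]
    have h1 := (cdf ν).measure_singleton a
    rw [measure_cdf, hν, eq_comm, ENNReal.ofReal_eq_zero] at h1
    have h2 := (monotone_cdf ν).leftLim_le (le_refl a)
    linarith
  have key : ∀ v, 0 < v → v < 1 → ν {y | ν.real (Iic y) ≤ v} = ENNReal.ofReal v := by
    intro v h0 h1
    obtain ⟨a, ha⟩ := ((tendsto_cdf_atBot ν).eventually_le_const h0).exists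
    obtain ⟨b, hb⟩ := ((tendsto_cdf_atTop ν).eventually_const_le h1).exists
    obtain ⟨y, hy⟩ := mem_range_of_exists_le_of_exists_ge hcont ⟨a, ha⟩ ⟨b, hb⟩
    rw [cdf_eq_real] at hy
    have h2 : {z | ν.real (Iic z) ≤ v} =
        Iic y ∪ {z | y < z ∧ ν.real (Iic z) ≤ ν.real (Iic y)} := by
      ext z
      simp only [mem_ofPred_eq, mem_union, mem_Iic, hy]
      constructor
      · intro h
        rcases le_or_gt z y with h3 | h3
        · exact Or.inl h3
        · exact Or.inr ⟨h3, h⟩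
      · rintro (h | h)
        · rw [← hy]
          exact measureReal_mono (Iic_subset_Iic.2 h)
        · exact h.2
    rw [h2, measure_congr (union_ae_eq_left_of_ae_eq_empty
      (ae_eq_empty.2 (measure_cdf_flat ν y))), ← hy, ofReal_measureReal]
  -- The values 0 and 1 need not be attained by the distribution function: 0 is handled by letting v
  -- decrease to it, 1 is trivial.
  rcases eq_or_lt_of_le hu.1 with h0 | h0
  · rw [← h0, ENNReal.ofReal_zero]
    refine le_antisymm (le_of_forall_pos_le_add fun ε hε => ?_) zero_le
    rw [zero_add]
    rcases eq_or_ne ε ∞ with rfl | hε'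
    · exact le_top
    have h1 : 0 < min ε.toReal (1 / 2) := lt_min (ENNReal.toReal_pos hε.ne' hε') (by norm_num)
    have h2 := key _ h1 (lt_of_le_of_lt (min_le_right _ _) (by norm_num))
    refine le_trans (measure_mono fun y (hy : _ ≤ (0 : ℝ)) => hy.trans h1.le) (h2.le.trans ?_)
    exact ENNReal.ofReal_le_of_le_toReal (min_le_left _ _)
  rcases eq_or_lt_of_le hu.2 with h1 | h1
  · rw [h1, ENNReal.ofReal_one]
    have : {y | ν.real (Iic y) ≤ 1} = univ := eq_univ_of_forall fun y => measureReal_le_one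
    rw [this, measure_univ]
  · exact key u h0 h1

theorem measurable_kernel_Iic {α : Type*} [MeasurableSpace α] (κ : Kernel α ℝ)
    [IsMarkovKernel κ] : Measurable fun p : α × ℝ => (κ p.1).real (Iic p.2) := by
  have h := Kernel.measurable_kernel_prodMk_left (κ := κ.prodMkRight ℝ)
    (t := {q : (α × ℝ) × ℝ | q.2 ≤ q.1.2})
    (measurableSet_le measurable_snd (measurable_snd.comp measurable_fst))
  exact h.ennreal_toReal

section Transform

variable {Ω α : Type*} [MeasurableSpace Ω] {P : Measure Ω} [IsProbabilityMeasure P]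
  [mα : MeasurableSpace α] {X : Ω → α} {Y : Ω → ℝ} {κ : Kernel α ℝ} [IsMarkovKernel κ]

/-- Given X, the transform is uniform by `measure_cdf_le`; integrating over C yields at once its
uniform law and its independence of X. -/
theorem measure_condTransform_le (hX : Measurable X) (hY : Measurable Y)
    (hlaw : P.map (fun ω => (X ω, Y ω)) = P.map X ⊗ₘ κ)
    (hκ : ∀ᵐ ω ∂P, ∀ y, κ (X ω) {y} = 0) {C : Set α} (hC : MeasurableSet C) {u : ℝ}
    (hu : u ∈ Icc (0 : ℝ) 1) :
    P (X ⁻¹' C ∩ {ω | (κ (X ω)).real (Iic (Y ω)) ≤ u}) = P (X ⁻¹' C) * ENNReal.ofReal u := by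
  let S : Set (α × ℝ) := {p | p.1 ∈ C ∧ (κ p.1).real (Iic p.2) ≤ u}
  have hS : MeasurableSet S :=
    (measurable_fst hC).inter (measurableSet_le (measurable_kernel_Iic κ) measurable_const)
  have h1 : P (X ⁻¹' C ∩ {ω | (κ (X ω)).real (Iic (Y ω)) ≤ u}) =
      P.map (fun ω => (X ω, Y ω)) S := by
    rw [Measure.map_apply (hX.prodMk hY) hS]
    rfl
  have : IsProbabilityMeasure (P.map X) := Measure.isProbabilityMeasure_map hX.aemeasurable
  rw [h1, hlaw, Measure.compProd_apply hS, ← Measure.map_apply hX hC]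
  rw [lintegral_map (Kernel.measurable_kernel_prodMk_left hS) hX, Measure.map_apply hX hC]
  have h2 : ∀ᵐ ω ∂P, κ (X ω) (Prod.mk (X ω) ⁻¹' S) =
      (X ⁻¹' C).indicator (fun _ => ENNReal.ofReal u) ω := by
    filter_upwards [hκ] with ω ha
    by_cases haC : X ω ∈ C
    · rw [indicator_of_mem (by exact haC), ← measure_cdf_le (κ (X ω)) ha hu]
      congr 1
      ext y
      simp [S, haC]
    · rw [indicator_of_notMem (by exact haC)]
      have : Prod.mk (X ω) ⁻¹' S = ∅ := by
        ext y
        simp [S, haC]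
      rw [this, measure_empty]
  rw [lintegral_congr_ae h2, lintegral_indicator (hX hC), setLIntegral_const, mul_comm]

/-- The two events differ only on flat pieces of the conditional distribution functions, which are
null. So Y can be recovered from X and the transform. -/
theorem ae_eq_condTransform (hX : Measurable X) (hY : Measurable Y)
    (hlaw : P.map (fun ω => (X ω, Y ω)) = P.map X ⊗ₘ κ) (y : ℝ) :
    {ω | Y ω ≤ y} =ᵐ[P]
      {ω | (κ (X ω)).real (Iic (Y ω)) ≤ (κ (X ω)).real (Iic y)} := by
  let S : Set (α × ℝ) := {p | y < p.2 ∧ (κ p.1).real (Iic p.2) ≤ (κ p.1).real (Iic y)}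
  have hS : MeasurableSet S :=
    (measurableSet_lt measurable_const measurable_snd).inter
      (measurableSet_le (measurable_kernel_Iic κ)
        ((measurable_kernel_Iic κ).comp (measurable_fst.prodMk measurable_const)))
  have : IsProbabilityMeasure (P.map X) := Measure.isProbabilityMeasure_map hX.aemeasurable
  have h1 : P ((fun ω => (X ω, Y ω)) ⁻¹' S) = 0 := by
    rw [← Measure.map_apply (hX.prodMk hY) hS, hlaw, Measure.compProd_apply hS,
      lintegral_eq_zero_iff (Kernel.measurable_kernel_prodMk_left hS)]
    exact Filter.Eventually.of_forall fun a => measure_cdf_flat (κ a) y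
  filter_upwards [measure_eq_zero_iff_ae_notMem.1 h1] with ω hω
  refine propext ⟨fun h => measureReal_mono (Iic_subset_Iic.2 h), fun h => ?_⟩
  by_contra hcon
  exact hω ⟨not_le.1 hcon, h⟩

end Transform

variable {Ω : Type*} [mΩ : MeasurableSpace Ω] {P : Measure Ω}

/-! ### Completion by null sets, and σ-fields with a nonatomic variable. -/

namespace SubSigmaField

/-- The sub-σ-field of the sets that are almost equal to a set of a given σ-field. -/
def closure {Ω : Type*} (m : MeasurableSpace Ω) {mΩ : MeasurableSpace Ω} (P : Measure Ω) :
    SubSigmaField P where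
  toMS :=
    { MeasurableSet' := fun s => MeasurableSet[mΩ] s ∧ ∃ t, MeasurableSet[m] t ∧ s =ᵐ[P] t
      measurableSet_empty := ⟨@MeasurableSet.empty _ mΩ, ∅, @MeasurableSet.empty _ m,
        Filter.EventuallyEq.rfl⟩
      measurableSet_compl := fun s hs => by
        obtain ⟨h, t, ht, hst⟩ := hs
        exact ⟨h.compl, tᶜ, ht.compl, hst.compl⟩
      measurableSet_iUnion := fun f hf => by
        choose h t ht hft using hf
        exact ⟨MeasurableSet.iUnion h, ⋃ n, t n, MeasurableSet.iUnion ht,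
          Filter.EventuallyEq.countable_iUnion hft⟩ }
  le := fun _ hs => hs.1
  null_mem := fun _ hs h0 => ⟨hs, ∅, @MeasurableSet.empty _ m, ae_eq_empty.2 h0⟩

theorem le_closure {Ω : Type*} {m mΩ : MeasurableSpace Ω} {P : Measure Ω} (hm : m ≤ mΩ) :
    m ≤ (closure m P).toMS :=
  fun s hs => ⟨hm s hs, s, hs, Filter.EventuallyEq.rfl⟩

/-- The sub-σ-field generated by a sub-σ-field and a σ-field. -/
def adjoin {Ω : Type*} {m mΩ : MeasurableSpace Ω} {P : Measure Ω} (E : SubSigmaField P)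
    (hm : m ≤ mΩ) : SubSigmaField P where
  toMS := E.toMS ⊔ m
  le := sup_le E.le hm
  null_mem := fun s hs h0 => le_sup_left (a := E.toMS) (b := m) s (E.null_mem s hs h0)

/-- Under the conditional measure given s, the law of U has no atoms, so cutting at its median
splits s into two halves. -/
theorem isNonatomic_of_measure_preimage_singleton [IsProbabilityMeasure P] {F : SubSigmaField P}
    {U : Ω → ℝ} (hU : Measurable[F.toMS] U) (h : ∀ x, P (U ⁻¹' {x}) = 0) : F.IsNonatomic := by
  intro s hs h0
  have hUm : Measurable U := hU.mono F.le le_rfl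
  have : IsProbabilityMeasure P[|s] := cond_isProbabilityMeasure h0.ne'
  have : IsProbabilityMeasure (P[|s].map U) := Measure.isProbabilityMeasure_map hUm.aemeasurable
  have h1 := measure_cdf_le (P[|s].map U) (fun y => by
    rw [Measure.map_apply hUm (measurableSet_singleton y)]
    exact cond_absolutelyContinuous (h y)) (u := 1 / 2) ⟨by norm_num, by norm_num⟩
  set A : Set ℝ := {y | (P[|s].map U).real (Iic y) ≤ 1 / 2} with hA
  have hAm : MeasurableSet A := by
    have : OrdConnected A := ⟨fun a ha b hb c hc =>
      (measureReal_mono (Iic_subset_Iic.2 hc.2)).trans hb⟩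
    exact this.measurableSet
  rw [Measure.map_apply hUm hAm, cond_apply (F.le s hs)] at h1
  have hst : MeasurableSet[F.toMS] (s ∩ U ⁻¹' A) := hs.inter (hU hAm)
  have h2 : P (s ∩ U ⁻¹' A) = P s * ENNReal.ofReal (1 / 2) := by
    rw [← h1, ← mul_assoc, ENNReal.mul_inv_cancel h0.ne' (MeasureTheory.measure_ne_top _ _), one_mul]
  refine ⟨s ∩ U ⁻¹' A, inter_subset_left, hst, ?_, ?_⟩
  · rw [h2]
    exact ENNReal.mul_pos h0.ne' (by simp)
  · rw [h2]
    calc P s * ENNReal.ofReal (1 / 2) < P s * 1 := by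
          refine ENNReal.mul_lt_mul_right h0.ne' (MeasureTheory.measure_ne_top _ _) ?_
          rw [ENNReal.ofReal_lt_one]
          norm_num
      _ = P s := mul_one _

end SubSigmaField

end SigmaFields

namespace SigmaFields

/-! ### Independent complements -/

/-- The smaller σ-field is put on the first copy of Ω, so that the identity plays the role of the
conditioning variable X in the conditional transform. -/
theorem map_prodMk_eq_compProd_condExpKernel {Ω : Type*} {m mΩ : MeasurableSpace Ω}
    [StandardBorelSpace Ω] {P : Measure Ω} [IsProbabilityMeasure P] (hm : m ≤ mΩ)
    {β : Type*} [MeasurableSpace β] {Y : Ω → β} (hY : Measurable[mΩ] Y) :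
    @Measure.map Ω (Ω × β) mΩ (m.prod inferInstance) (fun ω => (id ω, Y ω)) P =
      @Measure.map Ω Ω mΩ m id P ⊗ₘ (condExpKernel P m).map Y := by
  rw [← trim_eq_map hm, Measure.compProd_map hY, compProd_trim_condExpKernel hm,
    @Measure.map_map Ω (Ω × Ω) (Ω × β) mΩ (m.prod mΩ) (m.prod inferInstance)]
  · rfl
  · exact Measurable.prodMap (@measurable_id _ m) hY
  · exact Measurable.prodMk (measurable_id'' hm) (@measurable_id _ mΩ)

namespace SubSigmaField

variable {Ω : Type*} [mΩ : MeasurableSpace Ω] [StandardBorelSpace Ω]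
  {P : Measure Ω} [IsProbabilityMeasure P]

open unitInterval in
/-- If `F` is nonatomic relative to `E`, then `F` is generated, modulo null sets, by `E` and a
uniformly distributed random variable independent of `E`. -/
theorem RelNonatomic.exists_uniform {E F : SubSigmaField P} (hEF : E ≤ F)
    (h : RelNonatomic E F) :
    ∃ U : Ω → I, Measurable[F.toMS] U ∧ P.map U = volume ∧
      Indep E.toMS (MeasurableSpace.comap U inferInstance) P ∧
      ∀ A, MeasurableSet[F.toMS] A →
        ∃ B, MeasurableSet[E.toMS ⊔ MeasurableSpace.comap U inferInstance] B ∧ A =ᵐ[P] B := by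
  obtain ⟨Z, hZ, hgenZ⟩ := F.exists_generator
  -- A real generator is needed in order to have distribution functions.
  let Y : Ω → ℝ := embeddingReal (ℕ → Bool) ∘ Z
  have hemb := measurableEmbedding_embeddingReal (ℕ → Bool)
  have hY : Measurable[F.toMS] Y := hemb.measurable.comp hZ
  have hYm : Measurable Y := hY.mono F.le le_rfl
  have hgen : ∀ A, MeasurableSet[F.toMS] A → ∃ B, MeasurableSet B ∧ A =ᵐ[P] Y ⁻¹' B := by
    intro A hA
    obtain ⟨B, hB, hAB⟩ := hgenZ A hA
    refine ⟨embeddingReal (ℕ → Bool) '' B, hemb.measurableSet_image.2 hB, ?_⟩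
    rwa [preimage_comp, preimage_image_eq _ hemb.injective]
  have hna := h.ae_preimage_singleton hYm hgen
  let κ : @Kernel Ω ℝ E.toMS _ := (condExpKernel P E.toMS).map Y
  have hκm : IsMarkovKernel κ := Kernel.IsMarkovKernel.map _ hYm
  have hid : @Measurable Ω Ω mΩ E.toMS id := measurable_id'' E.le
  have hlaw := map_prodMk_eq_compProd_condExpKernel (P := P) E.le hYm
  have hκapp : ∀ ω S, MeasurableSet S → κ ω S = condExpKernel P E.toMS ω (Y ⁻¹' S) :=
    fun ω S hS => Kernel.map_apply' _ hYm _ hS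
  have hκ0 : ∀ᵐ ω ∂P, ∀ y, κ (id ω) {y} = 0 := by
    filter_upwards [hna] with ω hω y
    rw [id, hκapp ω _ (measurableSet_singleton y)]
    exact hω y
  have hκmeas : Measurable[@Prod.instMeasurableSpace Ω ℝ E.toMS _]
      fun p : Ω × ℝ => (κ p.1).real (Iic p.2) := @measurable_kernel_Iic Ω E.toMS κ hκm
  -- The conditional distribution function of Y at Y itself; it is F-measurable since E ⊆ F.
  let V : Ω → ℝ := fun ω => (κ ω).real (Iic (Y ω))
  have hV : Measurable[F.toMS] V := by
    have h1 : @Measurable Ω (Ω × ℝ) F.toMS (@Prod.instMeasurableSpace Ω ℝ E.toMS _)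
        fun ω => (ω, Y ω) :=
      Measurable.prodMk (measurable_id'' hEF) hY
    exact hκmeas.comp h1
  have hVI : ∀ ω, V ω ∈ I := fun ω => ⟨measureReal_nonneg, measureReal_le_one⟩
  let U : Ω → I := fun ω => ⟨V ω, hVI ω⟩
  have hU : Measurable[F.toMS] U := @Measurable.subtype_mk _ _ F.toMS _ _ _ hV _
  have hUm : Measurable U := hU.mono F.le le_rfl
  have hkey : ∀ C, MeasurableSet[E.toMS] C → ∀ u : I,
      P (C ∩ U ⁻¹' Iic u) = P C * ENNReal.ofReal u := by
    intro C hC u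
    exact @measure_condTransform_le Ω Ω mΩ P _ E.toMS id Y κ hκm hid hYm hlaw hκ0 C hC u u.2
  have hmapU : P.map U = volume := by
    have : IsProbabilityMeasure (P.map U) := Measure.isProbabilityMeasure_map hUm.aemeasurable
    refine Measure.ext_of_Iic _ _ fun u => ?_
    rw [Measure.map_apply hUm measurableSet_Iic, unitInterval.volume_Iic]
    have h1 := hkey univ (@MeasurableSet.univ _ E.toMS) u
    rwa [univ_inter, measure_univ, one_mul] at h1
  refine ⟨U, hU, hmapU, ?_, ?_⟩
  · refine IndepSets.indep E.le hUm.comap_le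
      (@MeasurableSpace.isPiSystem_measurableSet _ E.toMS)
      (p2 := preimage U '' range Iic) ?_
      (@MeasurableSpace.generateFrom_measurableSet _ E.toMS).symm ?_ ?_
    · rintro _ ⟨_, ⟨a, rfl⟩, rfl⟩ _ ⟨_, ⟨b, rfl⟩, rfl⟩ _
      exact ⟨Iic (a ⊓ b), ⟨_, rfl⟩, by rw [← preimage_inter, Iic_inter_Iic]⟩
    · rw [← MeasurableSpace.comap_generateFrom, ← borel_eq_generateFrom_Iic,
        BorelSpace.measurable_eq (α := I)]
    · rw [IndepSets_iff]
      rintro C _ hC ⟨_, ⟨u, rfl⟩, rfl⟩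
      rw [hkey C hC u, ← Measure.map_apply hUm measurableSet_Iic, hmapU, unitInterval.volume_Iic]
  · have hle : E.toMS ⊔ MeasurableSpace.comap U inferInstance ≤ mΩ := sup_le E.le hUm.comap_le
    -- Modulo null sets, Y ≤ y means that U is at most the E-measurable conditional probability of
    -- {Y ≤ y}.
    have hYc : Measurable[(closure (E.toMS ⊔ MeasurableSpace.comap U inferInstance) P).toMS] Y := by
      refine @measurable_of_Iic _ _ _ _ _ (closure _ P).toMS _ _ _ _ fun y => ?_
      refine ⟨hYm measurableSet_Iic, {ω | (U ω : ℝ) ≤ (κ ω).real (Iic y)}, ?_, ?_⟩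
      · have h1 : Measurable[E.toMS ⊔ MeasurableSpace.comap U inferInstance]
            fun ω => (U ω : ℝ) :=
          measurable_subtype_coe.comp ((comap_measurable U).mono le_sup_right le_rfl)
        have h2 : Measurable[E.toMS ⊔ MeasurableSpace.comap U inferInstance]
            fun ω => (κ ω).real (Iic y) := by
          have h3 : Measurable[E.toMS] fun ω => (κ ω).real (Iic y) :=
            (κ.measurable_coe measurableSet_Iic).ennreal_toReal
          exact h3.mono le_sup_left le_rfl
        exact @measurableSet_le _ _ _ _ _ _ _ _ _ _ _ h1 h2
      · exact @ae_eq_condTransform Ω Ω mΩ P _ E.toMS id Y κ hκm hid hYm hlaw y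
    intro A hA
    obtain ⟨B, hB, hAB⟩ := hgen A hA
    obtain ⟨_, C, hC, hBC⟩ := hYc hB
    exact ⟨C, hC, hAB.trans hBC⟩

/-- `F` is nonatomic over `E` if and only if it contains `E` and is nonatomic relative to `E`. -/
theorem isNonatomicOver_iff {E F : SubSigmaField P} :
    F.IsNonatomicOver E ↔ E ≤ F ∧ RelNonatomic E F := by
  constructor
  · rintro ⟨G, hG, hi, hF⟩
    have hEF : E.toMS ≤ F.toMS := hF ▸ le_sup_left
    have hGF : G.toMS ≤ F.toMS := hF ▸ le_sup_right
    exact ⟨hEF, (hG.relNonatomic hi).mono le_rfl hGF⟩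
  · rintro ⟨hEF, h⟩
    obtain ⟨U, hU, hmap, hi, hgen⟩ := h.exists_uniform hEF
    have hUm : Measurable U := hU.mono F.le le_rfl
    have hcl := le_closure (P := P) hUm.comap_le
    refine ⟨closure (MeasurableSpace.comap U inferInstance) P, ?_, ?_, ?_⟩
    · have h1 : Measurable[(closure (MeasurableSpace.comap U inferInstance) P).toMS]
          fun ω => (U ω : ℝ) :=
        measurable_subtype_coe.comp ((comap_measurable U).mono hcl le_rfl)
      refine isNonatomic_of_measure_preimage_singleton h1 fun x => ?_
      have h2 : (fun ω => (U ω : ℝ)) ⁻¹' {x} = U ⁻¹' (Subtype.val ⁻¹' {x}) := rfl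
      have h3 : MeasurableSet (Subtype.val ⁻¹' {x} : Set unitInterval) :=
        measurable_subtype_coe (measurableSet_singleton x)
      rw [h2, ← Measure.map_apply hUm h3, hmap]
      exact (subsingleton_singleton.preimage Subtype.val_injective).measure_zero _
    · rw [Indep_iff] at hi ⊢
      rintro s _ hs ⟨_, t, ht, htt⟩
      rw [measure_congr htt, ← hi s t hs ht]
      exact measure_congr (Filter.EventuallyEq.rfl.inter htt)
    · refine le_antisymm (sup_le hEF ?_) ?_
      · rintro s ⟨hs, t, ht, hst⟩
        exact F.measurableSet_congr (hU.comap_le t ht) hs hst.symm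
      · intro A hA
        obtain ⟨B, hB, hAB⟩ := hgen A hA
        exact (E.adjoin (closure (MeasurableSpace.comap U inferInstance) P).le).measurableSet_congr
          (sup_le_sup_left hcl E.toMS B hB) (F.le A hA) hAB.symm

end SubSigmaField

end SigmaFields

namespace SigmaFields

variable {Ω : Type*} [mΩ : MeasurableSpace Ω] {P : Measure Ω}

namespace SubSigmaField

/-! ### Joins of sub-σ-fields -/

instance : Max (SubSigmaField P) where
  max E F := E.adjoin F.le

theorem le_sup_left' (E F : SubSigmaField P) : E ≤ E ⊔ F := le_sup_left (a := E.toMS)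

theorem le_sup_right' (E F : SubSigmaField P) : F ≤ E ⊔ F := le_sup_right (a := E.toMS)

theorem sup_le' {E F G : SubSigmaField P} (h1 : E ≤ G) (h2 : F ≤ G) : E ⊔ F ≤ G :=
  sup_le (a := E.toMS) h1 h2

theorem sup_le_sup' {E F E' F' : SubSigmaField P} (h1 : E ≤ E') (h2 : F ≤ F') :
    E ⊔ F ≤ E' ⊔ F' :=
  sup_le_sup (a := E.toMS) h1 h2

theorem closure_le {Ω : Type*} {m mΩ : MeasurableSpace Ω} {P : Measure Ω} {E : SubSigmaField P} (h : m ≤ E.toMS) :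
    closure m P ≤ E := by
  rintro s ⟨hs, t, ht, hst⟩
  exact E.measurableSet_congr (h t ht) hs hst.symm

theorem closure_mono {Ω : Type*} {m m' mΩ : MeasurableSpace Ω} {P : Measure Ω} (h : m ≤ m') :
    closure m P ≤ closure m' P := by
  rintro s ⟨hs, t, ht, hst⟩
  exact ⟨hs, t, h t ht, hst⟩

theorem closure_sup {Ω : Type*} {m m' mΩ : MeasurableSpace Ω} {P : Measure Ω} (h : m ≤ mΩ) (h' : m' ≤ mΩ) :
    closure (m ⊔ m') P = closure m P ⊔ closure m' P :=
  le_antisymm (closure_le (sup_le_sup (le_closure h) (le_closure h')))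
    (sup_le' (closure_mono le_sup_left) (closure_mono le_sup_right))

theorem indep_closure {Ω : Type*} {m m' mΩ : MeasurableSpace Ω} {P : Measure Ω} (h : Indep m m' P) :
    Indep (closure m P).toMS (closure m' P).toMS P := by
  rw [Indep_iff] at h ⊢
  rintro s t ⟨_, s', hs, hss⟩ ⟨_, t', ht, htt⟩
  rw [measure_congr hss, measure_congr htt, ← h s' t' hs ht]
  exact measure_congr (hss.inter htt)

theorem closure_toMS (E : SubSigmaField P) : closure E.toMS P = E :=
  le_antisymm (closure_le le_rfl) (le_closure E.le)

/-! ### Products of independent random variables -/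

variable [IsProbabilityMeasure P]

open Classical in
/-- The product of two random variables, provided that it is square integrable. -/
noncomputable def tensor (f g : Lp ℝ 2 P) : Lp ℝ 2 P :=
  if h : MemLp (fun ω => f ω * g ω) 2 P then h.toLp _ else 0

variable {M N : SubSigmaField P}

theorem indepFun_of_indep (hMN : Indep M.toMS N.toMS P) {f g : Lp ℝ 2 P}
    (hf : AEStronglyMeasurable[M.toMS] f P) (hg : AEStronglyMeasurable[N.toMS] g P) :
    IndepFun f g P := by
  have hf' := measurable_of_aestronglyMeasurable M (Lp.stronglyMeasurable f).measurable hf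
  have hg' := measurable_of_aestronglyMeasurable N (Lp.stronglyMeasurable g).measurable hg
  exact indep_of_indep_of_le_left (indep_of_indep_of_le_right hMN hg'.comap_le) hf'.comap_le

/-- The squares are independent and integrable, so their product is integrable; the default value 0
of `tensor` never occurs here. -/
theorem coeFn_tensor (hMN : Indep M.toMS N.toMS P) {f g : Lp ℝ 2 P}
    (hf : AEStronglyMeasurable[M.toMS] f P) (hg : AEStronglyMeasurable[N.toMS] g P) :
    tensor f g =ᵐ[P] fun ω => f ω * g ω := by
  have h : MemLp (fun ω => f ω * g ω) 2 P := by
    have hi := (indepFun_of_indep hMN hf hg).comp (φ := fun x : ℝ => x ^ 2)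
      (ψ := fun x : ℝ => x ^ 2) (by fun_prop) (by fun_prop)
    refine (memLp_two_iff_integrable_sq
      ((Lp.aestronglyMeasurable f).mul (Lp.aestronglyMeasurable g))).2 ?_
    have := hi.integrable_mul (Lp.memLp f).integrable_sq (Lp.memLp g).integrable_sq
    refine this.congr (Filter.Eventually.of_forall fun ω => ?_)
    simp [mul_pow]
  rw [tensor, dif_pos h]
  exact h.coeFn_toLp

theorem inner_tensor (hMN : Indep M.toMS N.toMS P) {f g f' g' : Lp ℝ 2 P}
    (hf : AEStronglyMeasurable[M.toMS] f P) (hg : AEStronglyMeasurable[N.toMS] g P)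
    (hf' : AEStronglyMeasurable[M.toMS] f' P) (hg' : AEStronglyMeasurable[N.toMS] g' P) :
    inner ℝ (tensor f g) (tensor f' g') = inner ℝ f f' * inner ℝ g g' := by
  have m1 := measurable_of_aestronglyMeasurable M (Lp.stronglyMeasurable f).measurable hf
  have m2 := measurable_of_aestronglyMeasurable N (Lp.stronglyMeasurable g).measurable hg
  have m3 := measurable_of_aestronglyMeasurable M (Lp.stronglyMeasurable f').measurable hf'
  have m4 := measurable_of_aestronglyMeasurable N (Lp.stronglyMeasurable g').measurable hg'
  have hi : IndepFun (f * f' : Ω → ℝ) (g * g' : Ω → ℝ) P :=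
    indep_of_indep_of_le_left (indep_of_indep_of_le_right hMN
      (m2.mul m4).comap_le)
      (m1.mul m3).comap_le
  rw [L2.inner_def, L2.inner_def, L2.inner_def]
  simp only [RCLike.inner_apply, conj_trivial]
  have h1 := hi.integral_fun_mul_eq_mul_integral
    ((Lp.aestronglyMeasurable f).mul (Lp.aestronglyMeasurable f'))
    ((Lp.aestronglyMeasurable g).mul (Lp.aestronglyMeasurable g'))
  calc ∫ ω, tensor f' g' ω * tensor f g ω ∂P
      = ∫ ω, (f ω * f' ω) * (g ω * g' ω) ∂P := by
        refine integral_congr_ae ?_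
        filter_upwards [coeFn_tensor hMN hf hg, coeFn_tensor hMN hf' hg'] with ω h1 h2
        rw [h1, h2]
        ring
    _ = _ := by
        refine h1.trans ?_
        simp only [Pi.mul_apply, mul_comm]

theorem norm_tensor (hMN : Indep M.toMS N.toMS P) {f g : Lp ℝ 2 P}
    (hf : AEStronglyMeasurable[M.toMS] f P) (hg : AEStronglyMeasurable[N.toMS] g P) :
    ‖tensor f g‖ = ‖f‖ * ‖g‖ := by
  have h := inner_tensor hMN hf hg hf hg
  rw [real_inner_self_eq_norm_sq, real_inner_self_eq_norm_sq, real_inner_self_eq_norm_sq,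
    ← mul_pow] at h
  exact (pow_left_inj₀ (norm_nonneg _) (by positivity) two_ne_zero).1 h

theorem tensor_indLp {s t : Set Ω} (hs : MeasurableSet s) (ht : MeasurableSet t) :
    tensor (indLp P s) (indLp P t) = indLp P (s ∩ t) := by
  have h : (fun ω => indLp P s ω * indLp P t ω) =ᵐ[P] indLp P (s ∩ t) := by
    filter_upwards [coeFn_indLp (P := P) hs, coeFn_indLp (P := P) ht,
      coeFn_indLp (P := P) (hs.inter ht)] with ω h1 h2 h3
    rw [h1, h2, h3]
    by_cases h1 : ω ∈ s <;> by_cases h2 : ω ∈ t <;> simp [h1, h2]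
  have h' : MemLp (fun ω => indLp P s ω * indLp P t ω) 2 P := (memLp_congr_ae h).2 (Lp.memLp _)
  rw [tensor, dif_pos h']
  exact Lp.ext (h'.coeFn_toLp.trans h)

theorem tensor_sub_tensor (hMN : Indep M.toMS N.toMS P) {f g f' g' : Lp ℝ 2 P}
    (hf : AEStronglyMeasurable[M.toMS] f P) (hg : AEStronglyMeasurable[N.toMS] g P)
    (hf' : AEStronglyMeasurable[M.toMS] f' P) (hg' : AEStronglyMeasurable[N.toMS] g' P) :
    tensor f g - tensor f' g' = tensor (f - f') g + tensor f' (g - g') := by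
  have hff : AEStronglyMeasurable[M.toMS] (f - f' : Lp ℝ 2 P) P :=
    (hf.sub hf').congr (Lp.coeFn_sub f f').symm
  have hgg : AEStronglyMeasurable[N.toMS] (g - g' : Lp ℝ 2 P) P :=
    (hg.sub hg').congr (Lp.coeFn_sub g g').symm
  refine Lp.ext ?_
  filter_upwards [coeFn_tensor hMN hf hg, coeFn_tensor hMN hf' hg', coeFn_tensor hMN hff hg,
    coeFn_tensor hMN hf' hgg, Lp.coeFn_sub f f', Lp.coeFn_sub g g',
    Lp.coeFn_sub (tensor f g) (tensor f' g'),
    Lp.coeFn_add (tensor (f - f') g) (tensor f' (g - g'))] with ω h1 h2 h3 h4 h5 h6 h7 h8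
  rw [h7, h8, Pi.sub_apply, Pi.add_apply, h1, h2, h3, h4, h5, h6, Pi.sub_apply, Pi.sub_apply]
  ring

theorem norm_tensor_sub_tensor_le (hMN : Indep M.toMS N.toMS P) {f g f' g' : Lp ℝ 2 P}
    (hf : AEStronglyMeasurable[M.toMS] f P) (hg : AEStronglyMeasurable[N.toMS] g P)
    (hf' : AEStronglyMeasurable[M.toMS] f' P) (hg' : AEStronglyMeasurable[N.toMS] g' P) :
    ‖tensor f g - tensor f' g'‖ ≤ ‖f - f'‖ * ‖g‖ + ‖f'‖ * ‖g - g'‖ := by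
  rw [tensor_sub_tensor hMN hf hg hf' hg']
  refine (norm_add_le _ _).trans (le_of_eq ?_)
  rw [norm_tensor hMN _ hg, norm_tensor hMN hf']
  · exact (hg.sub hg').congr (Lp.coeFn_sub g g').symm
  · exact (hf.sub hf').congr (Lp.coeFn_sub f f').symm

/-- The σ-field generated by two σ-fields is generated by intersections. -/
theorem sup_eq_generateFrom_inter {Ω : Type*} (m m' : MeasurableSpace Ω)
    {C C' : Set (Set Ω)} (hC : m = MeasurableSpace.generateFrom C)
    (hC' : m' = MeasurableSpace.generateFrom C') (hu : univ ∈ C) (hu' : univ ∈ C') :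
    m ⊔ m' = MeasurableSpace.generateFrom (image2 (· ∩ ·) C C') := by
  refine le_antisymm (sup_le ?_ ?_) (MeasurableSpace.generateFrom_le ?_)
  · rw [hC]
    exact MeasurableSpace.generateFrom_mono fun s hs => ⟨s, hs, univ, hu', inter_univ s⟩
  · rw [hC']
    exact MeasurableSpace.generateFrom_mono fun s hs => ⟨univ, hu, s, hs, univ_inter s⟩
  · rintro _ ⟨s, hs, t, ht, rfl⟩
    refine MeasurableSet.inter ?_ ?_
    · exact le_sup_left (a := m) s (hC ▸ MeasurableSpace.measurableSet_generateFrom hs)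
    · exact le_sup_right (a := m) t (hC' ▸ MeasurableSpace.measurableSet_generateFrom ht)

theorem isPiSystem_image2_inter {Ω : Type*} {C C' : Set (Set Ω)} (hC : IsPiSystem C)
    (hC' : IsPiSystem C') : IsPiSystem (image2 (· ∩ ·) C C') := by
  rintro _ ⟨s, hs, t, ht, rfl⟩ _ ⟨s', hs', t', ht', rfl⟩ hne
  rw [inter_inter_inter_comm] at hne ⊢
  exact ⟨s ∩ s', hC s hs s' hs' hne.left, t ∩ t', hC' t ht t' ht' hne.right, rfl⟩

/-- Conditional expectations of independent factors multiply: inner products with indicators of s ∩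
t, s in E and t in D, factor by independence, and these sets form a π-system generating the join. -/
theorem proj_sup_tensor (hMN : Indep M.toMS N.toMS P) {E D : SubSigmaField P} (hE : E ≤ M)
    (hD : D ≤ N) {f g : Lp ℝ 2 P} (hf : AEStronglyMeasurable[M.toMS] f P)
    (hg : AEStronglyMeasurable[N.toMS] g P) :
    (E ⊔ D).proj (tensor f g) = tensor (E.proj f) (D.proj g) := by
  have hEf := E.aestronglyMeasurable_proj f
  have hDg := D.aestronglyMeasurable_proj g
  refine proj_eq_of_inner _ ?_ fun w hw => ?_
  · refine AEStronglyMeasurable.congr ?_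
      (coeFn_tensor hMN (hEf.mono hE) (hDg.mono hD)).symm
    exact (hEf.mono (le_sup_left' E D)).mul (hDg.mono (le_sup_right' E D))
  let V : Submodule ℝ (Lp ℝ 2 P) :=
    LinearMap.ker (innerSL ℝ (tensor f g - tensor (E.proj f) (D.proj g))).toLinearMap
  have hV : IsClosed (V : Set (Lp ℝ 2 P)) :=
    (innerSL ℝ (tensor f g - tensor (E.proj f) (D.proj g))).isClosed_ker
  have key : ∀ s t, MeasurableSet[E.toMS] s → MeasurableSet[D.toMS] t →
      indLp P (s ∩ t) ∈ V := by
    intro s t hs ht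
    have h1 := aestronglyMeasurable_indLp E hs
    have h2 := aestronglyMeasurable_indLp D ht
    change inner ℝ (tensor f g - tensor (E.proj f) (D.proj g)) (indLp P (s ∩ t)) = 0
    rw [inner_sub_left, ← tensor_indLp (E.le s hs) (D.le t ht),
      inner_tensor hMN hf hg (h1.mono hE) (h2.mono hD),
      inner_tensor hMN (hEf.mono hE) (hDg.mono hD) (h1.mono hE) (h2.mono hD),
      inner_proj_left, inner_proj_left, (proj_eq_self E).2 h1,
      (proj_eq_self D).2 h2, sub_self]
  refine mem_of_aestronglyMeasurable (V := V) hV (E ⊔ D).le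
    (sup_eq_generateFrom_inter E.toMS D.toMS
      (@MeasurableSpace.generateFrom_measurableSet _ E.toMS).symm
      (@MeasurableSpace.generateFrom_measurableSet _ D.toMS).symm
      (@MeasurableSet.univ _ E.toMS) (@MeasurableSet.univ _ D.toMS))
    (isPiSystem_image2_inter (@MeasurableSpace.isPiSystem_measurableSet _ E.toMS)
      (@MeasurableSpace.isPiSystem_measurableSet _ D.toMS)) ?_ ?_ hw
  · rw [← inter_univ univ]
    exact key _ _ (@MeasurableSet.univ _ E.toMS) (@MeasurableSet.univ _ D.toMS)
  · rintro _ ⟨s, hs, t, ht, rfl⟩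
    exact key s t hs ht

/-- Asymptotic equality of joins of independent sub-σ-fields. -/
theorem tendsto_norm_proj_sup_sub (hMN : Indep M.toMS N.toMS P) {α : Type*} {l : Filter α}
    {E E' D D' : α → SubSigmaField P} (hE : ∀ a, E a ≤ M) (hE' : ∀ a, E' a ≤ M)
    (hD : ∀ a, D a ≤ N) (hD' : ∀ a, D' a ≤ N)
    (h1 : ∀ A, MeasurableSet[M.toMS] A → Filter.Tendsto
      (fun a => ‖(E a).proj (indLp P A) - (E' a).proj (indLp P A)‖) l (𝓝 0))
    {C : Set (Set Ω)} (hC : IsPiSystem C) (hu : univ ∈ C)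
    (hNC : N = closure (MeasurableSpace.generateFrom C) P)
    (hCm : ∀ B ∈ C, MeasurableSet B)
    (h2 : ∀ B ∈ C, Filter.Tendsto
      (fun a => ‖(D a).proj (indLp P B) - (D' a).proj (indLp P B)‖) l (𝓝 0))
    (f : Lp ℝ 2 P) :
    Filter.Tendsto (fun a => ‖(E a ⊔ D a).proj f - (E' a ⊔ D' a).proj f‖) l (𝓝 0) := by
  let Q : α → Lp ℝ 2 P →L[ℝ] Lp ℝ 2 P := fun a => (E a ⊔ D a).proj
  let Q' : α → Lp ℝ 2 P →L[ℝ] Lp ℝ 2 P := fun a => (E' a ⊔ D' a).proj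
  have hcl : IsClosed (asymptoticallyEqual l Q Q' : Set (Lp ℝ 2 P)) :=
    isClosed_asymptoticallyEqual (fun a f => norm_proj_le _ f) (fun a f => norm_proj_le _ f)
  have hCN : ∀ B ∈ C, MeasurableSet[N.toMS] B := fun B hB => by
    rw [hNC]
    exact ⟨hCm B hB, B, MeasurableSpace.measurableSet_generateFrom hB, Filter.EventuallyEq.rfl⟩
  -- On intersections the projections are tensors, so the two one-sided hypotheses add up. Note that
  -- on the side of N only a π-system has to be controlled.
  have key : ∀ A B, MeasurableSet[M.toMS] A → B ∈ C →
      indLp P (A ∩ B) ∈ asymptoticallyEqual l Q Q' := by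
    intro A B hA hB
    have ha := aestronglyMeasurable_indLp M hA
    have hb := aestronglyMeasurable_indLp N (hCN B hB)
    have hz := ((h1 A hA).mul_const ‖indLp P B‖).add ((h2 B hB).const_mul ‖indLp P A‖)
    rw [zero_mul, mul_zero, add_zero] at hz
    refine squeeze_zero (fun _ => norm_nonneg _) (fun a => ?_) hz
    change ‖(E a ⊔ D a).proj _ - (E' a ⊔ D' a).proj _‖ ≤ _
    rw [← tensor_indLp (M.le A hA) (hCm B hB), proj_sup_tensor hMN (hE a) (hD a) ha hb,
      proj_sup_tensor hMN (hE' a) (hD' a) ha hb]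
    refine (norm_tensor_sub_tensor_le hMN ((aestronglyMeasurable_proj _ _).mono (hE a))
      ((aestronglyMeasurable_proj _ _).mono (hD a)) ((aestronglyMeasurable_proj _ _).mono (hE' a))
      ((aestronglyMeasurable_proj _ _).mono (hD' a))).trans ?_
    gcongr
    · exact norm_proj_le _ _
    · exact norm_proj_le _ _
  let G : SubSigmaField P := M ⊔ N
  have hgC : MeasurableSpace.generateFrom C ≤ mΩ := MeasurableSpace.generateFrom_le hCm
  have hG : G = closure (M.toMS ⊔ MeasurableSpace.generateFrom C) P := by
    rw [closure_sup M.le hgC, closure_toMS, ← hNC]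
  have hall : ∀ f : Lp ℝ 2 P, AEStronglyMeasurable[G.toMS] f P →
      f ∈ asymptoticallyEqual l Q Q' := by
    intro f hf
    have hGV : ∀ A, MeasurableSet[G.toMS] A → indLp P A ∈ asymptoticallyEqual l Q Q' := by
      intro A hA
      rw [hG] at hA
      obtain ⟨hAm, B, hB, hAB⟩ := hA
      have hm : M.toMS ⊔ MeasurableSpace.generateFrom C ≤ mΩ := sup_le M.le hgC
      rw [indLp_congr hAm (hm B hB) hAB]
      refine mem_of_aestronglyMeasurable hcl hm
        (sup_eq_generateFrom_inter M.toMS _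
          (@MeasurableSpace.generateFrom_measurableSet _ M.toMS).symm rfl
          (@MeasurableSet.univ _ M.toMS) hu)
        (isPiSystem_image2_inter (@MeasurableSpace.isPiSystem_measurableSet _ M.toMS) hC)
        ?_ ?_ (f := indLp P B) ?_
      · rw [← inter_univ univ]
        exact key _ _ (@MeasurableSet.univ _ M.toMS) hu
      · rintro _ ⟨s, hs, t, ht, rfl⟩
        exact key s t hs ht
      · refine AEStronglyMeasurable.congr ?_ (coeFn_indLp (hm B hB)).symm
        exact ((@stronglyMeasurable_const _ _ (M.toMS ⊔ MeasurableSpace.generateFrom C) _ (1 : ℝ)).indicator hB).aestronglyMeasurable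
    exact mem_of_aestronglyMeasurable hcl G.le
      (@MeasurableSpace.generateFrom_measurableSet _ G.toMS).symm
      (@MeasurableSpace.isPiSystem_measurableSet _ G.toMS)
      (hGV _ (@MeasurableSet.univ _ G.toMS)) hGV hf
  -- All the joins lie below M ⊔ N, so f may be replaced by its projection there.
  have h3 : Filter.Tendsto (fun a => ‖Q a (G.proj f) - Q' a (G.proj f)‖) l (𝓝 0) :=
    hall _ (aestronglyMeasurable_proj G f)
  refine h3.congr fun a => ?_
  change ‖(E a ⊔ D a).proj (G.proj f) - (E' a ⊔ D' a).proj (G.proj f)‖ = _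
  rw [proj_proj_of_le (sup_le_sup' (hE a) (hD a)), proj_proj_of_le (sup_le_sup' (hE' a) (hD' a))]

end SubSigmaField

end SigmaFields

namespace SigmaFields

namespace SubSigmaField

theorem aestronglyMeasurable_of_closure {Ω : Type*} {m mΩ : MeasurableSpace Ω} {P : Measure Ω}
    [IsProbabilityMeasure P] (hm : m ≤ mΩ) {f : Lp ℝ 2 P}
    (hf : AEStronglyMeasurable[(closure m P).toMS] f P) : AEStronglyMeasurable[m] f P := by
  have : Fact (m ≤ mΩ) := ⟨hm⟩
  have hV : IsClosed (lpMeas ℝ ℝ m 2 P : Set (Lp ℝ 2 P)) :=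
    isClosed_aestronglyMeasurable hm
  have key : ∀ s, MeasurableSet[(closure m P).toMS] s → indLp P s ∈ lpMeas ℝ ℝ m 2 P := by
    rintro s ⟨hs, t, ht, hst⟩
    rw [mem_lpMeas_iff_aestronglyMeasurable, indLp_congr hs (hm t ht) hst]
    refine AEStronglyMeasurable.congr ?_ (coeFn_indLp (hm t ht)).symm
    exact ((@stronglyMeasurable_const _ _ m _ (1 : ℝ)).indicator ht).aestronglyMeasurable
  exact mem_lpMeas_iff_aestronglyMeasurable.1
    (mem_of_aestronglyMeasurable hV (closure m P).le
      (@MeasurableSpace.generateFrom_measurableSet _ (closure m P).toMS).symm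
      (@MeasurableSpace.isPiSystem_measurableSet _ (closure m P).toMS)
      (key _ (@MeasurableSet.univ _ (closure m P).toMS)) key hf)

variable {Ω : Type*} [mΩ : MeasurableSpace Ω] {P : Measure Ω} [IsProbabilityMeasure P]

theorem norm_sub_proj_le (E : SubSigmaField P) (f : Lp ℝ 2 P) {g : Lp ℝ 2 P}
    (hg : AEStronglyMeasurable[E.toMS] g P) : ‖f - E.proj f‖ ≤ ‖f - g‖ := by
  rw [← infDist_eq, ← dist_eq_norm]
  exact Metric.infDist_le_dist_of_mem (mem_lpMeas_iff_aestronglyMeasurable.2 hg)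

theorem ae_proj_indLp_mem_Icc (E : SubSigmaField P) {A : Set Ω} (hA : MeasurableSet A) :
    ∀ᵐ ω ∂P, E.proj (indLp P A) ω ∈ Icc (0 : ℝ) 1 := by
  have h0 : 0 ≤ᵐ[P] P⟦A | E.toMS⟧ :=
    condExp_nonneg (Filter.Eventually.of_forall (indicator_nonneg fun _ _ => zero_le_one))
  have h1 : P⟦A | E.toMS⟧ ≤ᵐ[P] P[fun _ => (1 : ℝ) | E.toMS] := by
    refine condExp_mono ((integrable_const 1).indicator hA) (integrable_const 1)
      (Filter.Eventually.of_forall fun ω => ?_)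
    exact indicator_le_self' (fun _ _ => zero_le_one) ω
  rw [condExp_const E.le] at h1
  filter_upwards [proj_indLp_ae_eq E hA, h0, h1] with ω h2 h3 h4
  rw [h2]
  exact ⟨h3, h4⟩

/-! ### Truncated noise -/

open unitInterval

/-- The sub-σ-field generated by the random variables `U k ⊓ a`, `k ∈ S`. -/
def noise (P : Measure Ω) (U : ℕ → Ω → I) (S : Set ℕ) (a : I) : SubSigmaField P :=
  closure (⨆ k ∈ S, MeasurableSpace.comap (fun ω => min (U k ω) a) inferInstance) P

variable {U : ℕ → Ω → I}

theorem comap_min_le_comap (k : ℕ) {a b : I} (hab : a ≤ b) :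
    MeasurableSpace.comap (fun ω => min (U k ω) a) inferInstance ≤
      MeasurableSpace.comap (fun ω => min (U k ω) b) inferInstance := by
  have h : (fun ω => min (U k ω) a) = (fun x => min x a) ∘ fun ω => min (U k ω) b := by
    ext ω
    simp [min_assoc, min_eq_right hab]
  rw [h, ← MeasurableSpace.comap_comp]
  exact MeasurableSpace.comap_mono (measurable_id.min measurable_const).comap_le

theorem noise_mono {S S' : Set ℕ} (hS : S ⊆ S') {a b : I} (hab : a ≤ b) :
    noise P U S a ≤ noise P U S' b :=
  closure_mono (iSup₂_le fun k hk => (comap_min_le_comap k hab).trans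
    (le_iSup₂ (f := fun k (_ : k ∈ S') =>
      MeasurableSpace.comap (fun ω => min (U k ω) b) inferInstance) k (hS hk)))

theorem noise_le {S : Set ℕ} {a : I} (hU : ∀ k, Measurable (U k)) :
    (⨆ k ∈ S, MeasurableSpace.comap (fun ω => min (U k ω) a) inferInstance) ≤ mΩ :=
  iSup₂_le fun k _ => ((hU k).min measurable_const).comap_le

theorem noise_union (hU : ∀ k, Measurable (U k)) (S S' : Set ℕ) (a : I) :
    noise P U (S ∪ S') a = noise P U S a ⊔ noise P U S' a := by
  rw [noise, iSup_union, closure_sup (noise_le hU) (noise_le hU)]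
  rfl

theorem noise_zero_le (S : Set ℕ) (E : SubSigmaField P) : noise P U S 0 ≤ E := by
  refine closure_le (iSup₂_le fun k _ => ?_)
  have h : (fun ω => min (U k ω) 0) = fun _ => 0 := by
    ext ω
    simp
  rw [h, MeasurableSpace.comap_const]
  exact bot_le

theorem noise_empty_le (a : I) (E : SubSigmaField P) : noise P U ∅ a ≤ E := by
  refine closure_le ?_
  simp

theorem indep_noise (hU : ∀ k, Measurable (U k)) (hi : iIndepFun U P) {S S' : Set ℕ}
    (hS : Disjoint S S') (a b : I) :
    Indep (noise P U S a).toMS (noise P U S' b).toMS P := by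
  refine indep_closure ?_
  have h := indep_iSup_of_disjoint (fun k => (hU k).comap_le) hi hS
  have hle : ∀ (c : I) k, MeasurableSpace.comap (fun ω => min (U k ω) c) inferInstance ≤
      MeasurableSpace.comap (U k) inferInstance := fun c k =>
    ((comap_measurable (U k)).min (@measurable_const _ _ _ (_) c)).comap_le
  exact indep_of_indep_of_le_left (indep_of_indep_of_le_right h
    (iSup₂_mono fun k _ => hle b k)) (iSup₂_mono fun k _ => hle a k)

/-- The left projection is a [0, 1]-valued function of min (U k) d. Off the event U k ∈ [c, d) the
variable min (U k) d can be read from min (U k) c, so some function of the latter differs from this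
projection only there, by at most 1; the true projection is at least as close. -/
theorem norm_proj_noise_singleton_sub_sq_le (hU : ∀ k, Measurable (U k)) (k : ℕ) {c d : I}
    (hcd : c ≤ d) {A : Set Ω} (hA : MeasurableSet A) :
    ‖(noise P U {k} d).proj (indLp P A) - (noise P U {k} c).proj (indLp P A)‖ ^ 2 ≤
      P.real (U k ⁻¹' Ico c d) := by
  set g := (noise P U {k} d).proj (indLp P A) with hg
  have hgm : AEStronglyMeasurable[MeasurableSpace.comap (fun ω => min (U k ω) d) inferInstance]
      g P := by
    refine aestronglyMeasurable_of_closure ((hU k).min measurable_const).comap_le ?_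
    have h := aestronglyMeasurable_proj (noise P U {k} d) (indLp P A)
    have hn : noise P U {k} d =
        closure (MeasurableSpace.comap (fun ω => min (U k ω) d) inferInstance) P := by
      rw [noise, iSup_singleton]
    rw [← hg] at h
    rwa [hn] at h
  obtain ⟨g₀, hg₀, hgg₀⟩ := hgm
  obtain ⟨φ, hφ, rfl⟩ := hg₀.exists_eq_measurable_comp
  -- The value c of min (U k) c means U k ≥ c, and it is sent to d, which is correct unless U k < d.
  let ψ : I → I := fun x => if x < c then x else d
  have hψ : Measurable ψ := Measurable.ite measurableSet_Iio measurable_id measurable_const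
  -- φ takes values in [0, 1] only almost surely, hence the clamping.
  let φ' : I → ℝ := fun x => max 0 (min 1 (φ x))
  have hφ' : Measurable φ' := measurable_const.max (measurable_const.min hφ.measurable)
  have hφ'0 : ∀ x, 0 ≤ φ' x := fun x => le_max_left _ _
  have hφ'1 : ∀ x, φ' x ≤ 1 := fun x => max_le zero_le_one (min_le_left _ _)
  let w : Ω → ℝ := fun ω => φ' (ψ (min (U k ω) c))
  have hwm : Measurable w := hφ'.comp (hψ.comp ((hU k).min measurable_const))
  have hw : MemLp w 2 P := MemLp.of_bound hwm.aestronglyMeasurable 1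
    (Filter.Eventually.of_forall fun ω => by
      rw [Real.norm_eq_abs, abs_of_nonneg (hφ'0 _)]
      exact hφ'1 _)
  have hwE : AEStronglyMeasurable[(noise P U {k} c).toMS] (hw.toLp w) P := by
    refine AEStronglyMeasurable.congr ?_ hw.coeFn_toLp.symm
    have h1 : Measurable[MeasurableSpace.comap (fun ω => min (U k ω) c) inferInstance] w :=
      (hφ'.comp hψ).comp (comap_measurable _)
    refine (h1.stronglyMeasurable.aestronglyMeasurable).mono ?_
    rw [noise]
    refine le_trans ?_ (le_closure (noise_le hU))
    simp
  have h1 := norm_sub_proj_le (noise P U {k} c) g hwE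
  rw [hg, proj_proj_of_le (noise_mono subset_rfl hcd), ← hg] at h1
  refine (pow_le_pow_left₀ (norm_nonneg _) h1 2).trans ?_
  have hm : MeasurableSet (U k ⁻¹' Ico c d) := hU k measurableSet_Ico
  rw [norm_sq_eq_integral, ← integral_indicator_one hm]
  refine integral_mono_ae (Lp.memLp _).integrable_sq ((integrable_const 1).indicator hm) ?_
  filter_upwards [Lp.coeFn_sub g (hw.toLp w), hw.coeFn_toLp, hgg₀,
    ae_proj_indLp_mem_Icc (noise P U {k} d) hA] with ω h2 h3 h4 h5
  rw [← hg, h4] at h5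
  have h6 : g ω = φ' (min (U k ω) d) := by
    have h5 : φ (min (U k ω) d) ∈ Icc (0 : ℝ) 1 := h5
    rw [h4]
    change φ (min (U k ω) d) = max 0 (min 1 (φ (min (U k ω) d)))
    rw [min_eq_right h5.2, max_eq_right h5.1]
  simp only [h2, Pi.sub_apply, h3, h6]
  by_cases hω : ω ∈ U k ⁻¹' Ico c d
  · rw [indicator_of_mem hω, Pi.one_apply, sq_le_one_iff_abs_le_one, abs_le]
    have := hφ'0 (min (U k ω) d)
    have := hφ'1 (min (U k ω) d)
    have := hφ'0 (ψ (min (U k ω) c))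
    have := hφ'1 (ψ (min (U k ω) c))
    constructor <;> simp only [w] <;> linarith
  · rw [indicator_of_notMem hω]
    have h7 : min (U k ω) d = ψ (min (U k ω) c) := by
      simp only [ψ]
      rcases lt_or_ge (U k ω) c with h | h
      · rw [min_eq_left h.le, if_pos h, min_eq_left (h.le.trans hcd)]
      · rw [min_eq_right h, if_neg (lt_irrefl _), min_eq_right]
        by_contra hlt
        exact hω ⟨h, not_le.1 hlt⟩
    simp [w, h7]

theorem tendsto_norm_proj_noise_singleton (hU : ∀ k, Measurable (U k))
    (hlaw : ∀ k, P.map (U k) = volume) (k : ℕ) (a : I) {A : Set Ω} (hA : MeasurableSet A) :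
    Filter.Tendsto (fun b => ‖(noise P U {k} b).proj (indLp P A) -
      (noise P U {k} a).proj (indLp P A)‖) (𝓝 a) (𝓝 0) := by
  have hIco : ∀ c d : I, P.real (U k ⁻¹' Ico c d) ≤ |(d : ℝ) - c| := by
    intro c d
    rw [Measure.real, ← Measure.map_apply (hU k) measurableSet_Ico, hlaw k,
      unitInterval.volume_Ico, ENNReal.toReal_ofReal']
    exact max_le (le_abs_self _) (abs_nonneg _)
  have hz : Filter.Tendsto (fun b : I => √|(b : ℝ) - a|) (𝓝 a) (𝓝 0) := by
    have : Continuous fun b : I => √|(b : ℝ) - a| := by fun_prop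
    simpa using this.tendsto a
  refine squeeze_zero (fun _ => norm_nonneg _) (fun b => Real.le_sqrt_of_sq_le ?_) hz
  rcases le_total a b with h | h
  · exact (norm_proj_noise_singleton_sub_sq_le hU k h hA).trans (hIco a b)
  · rw [norm_sub_rev, abs_sub_comm]
    exact (norm_proj_noise_singleton_sub_sq_le hU k h hA).trans (hIco b a)

theorem tendsto_norm_proj_noise_finset (hU : ∀ k, Measurable (U k)) (hi : iIndepFun U P)
    (hlaw : ∀ k, P.map (U k) = volume) (J : Finset ℕ) (a : I) (f : Lp ℝ 2 P) :
    Filter.Tendsto (fun b => ‖(noise P U J b).proj f - (noise P U J a).proj f‖) (𝓝 a) (𝓝 0) := by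
  induction J using Finset.induction_on generalizing f with
  | empty =>
    have h : ∀ b, noise P U ((∅ : Finset ℕ) : Set ℕ) b = noise P U ((∅ : Finset ℕ) : Set ℕ) a := by
      intro b
      rw [Finset.coe_empty]
      exact le_antisymm (noise_empty_le _ _) (noise_empty_le _ _)
    refine tendsto_const_nhds.congr fun b => ?_
    rw [h b, sub_self, norm_zero]
  | insert k J hk ih =>
    have hd : Disjoint ({k} : Set ℕ) J := by simpa using hk
    have h := tendsto_norm_proj_sup_sub (indep_noise hU hi hd 1 1) (l := 𝓝 a)
      (E := fun b => noise P U {k} b) (E' := fun _ => noise P U {k} a)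
      (D := fun b => noise P U J b) (D' := fun _ => noise P U J a)
      (fun b => noise_mono subset_rfl unitInterval.le_one')
      (fun b => noise_mono subset_rfl unitInterval.le_one')
      (fun b => noise_mono subset_rfl unitInterval.le_one')
      (fun b => noise_mono subset_rfl unitInterval.le_one')
      (fun A hA => tendsto_norm_proj_noise_singleton hU hlaw k a ((noise P U {k} 1).le A hA))
      (@MeasurableSpace.isPiSystem_measurableSet _ (noise P U J 1).toMS)
      (@MeasurableSet.univ _ (noise P U J 1).toMS)
      (by rw [@MeasurableSpace.generateFrom_measurableSet _ (noise P U J 1).toMS, closure_toMS])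
      (fun B hB => (noise P U J 1).le B hB) (fun B _ => ih _) f
    rw [Finset.coe_insert, Set.insert_eq]
    simpa only [noise_union hU] using h

/-- Independent information is irrelevant: the case g = 1 of `proj_sup_tensor`. -/
theorem proj_sup_of_indep {M N E D : SubSigmaField P} (hMN : Indep M.toMS N.toMS P) (hE : E ≤ M)
    (hD : D ≤ N) {A : Set Ω} (hA : MeasurableSet[M.toMS] A) :
    (E ⊔ D).proj (indLp P A) = E.proj (indLp P A) := by
  have hu : AEStronglyMeasurable[D.toMS] (indLp P univ) P :=
    aestronglyMeasurable_indLp D (@MeasurableSet.univ _ D.toMS)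
  have h1 := proj_sup_tensor hMN hE hD (aestronglyMeasurable_indLp M hA) (hu.mono hD)
  rw [tensor_indLp (M.le A hA) MeasurableSet.univ, inter_univ, (proj_eq_self D).2 hu] at h1
  rw [h1]
  refine Lp.ext ?_
  filter_upwards [coeFn_tensor hMN ((aestronglyMeasurable_proj E (indLp P A)).mono hE)
    (hu.mono hD), coeFn_indLp (P := P) MeasurableSet.univ] with ω h2 h3
  rw [h2, h3]
  simp

/-- Coordinates outside J are independent of A. So for events depending on finitely many variables
an arbitrary S reduces to a finite set. -/
theorem proj_noise_inter (hU : ∀ k, Measurable (U k)) (hi : iIndepFun U P) (S J : Set ℕ) (a : I)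
    {A : Set Ω} (hA : MeasurableSet[(noise P U J 1).toMS] A) :
    (noise P U S a).proj (indLp P A) = (noise P U (S ∩ J) a).proj (indLp P A) := by
  conv_lhs => rw [← Set.inter_union_sdiff S J, noise_union hU]
  exact proj_sup_of_indep (indep_noise hU hi (disjoint_sdiff_right (s := J) (t := S)) 1 1)
    (noise_mono inter_subset_right unitInterval.le_one')
    (noise_mono subset_rfl unitInterval.le_one') hA

/-- The events depending on finitely many of the random variables `U k`. -/
def noiseCylinders (P : Measure Ω) (U : ℕ → Ω → I) : Set (Set Ω) :=
  {A | ∃ m : ℕ, MeasurableSet[(noise P U (Iio m) 1).toMS] A}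

theorem measurableSet_of_mem_noiseCylinders {A : Set Ω} (hA : A ∈ noiseCylinders P U) :
    MeasurableSet A := by
  obtain ⟨m, h⟩ := hA
  exact SubSigmaField.le _ A h

theorem univ_mem_noiseCylinders : univ ∈ noiseCylinders P U :=
  ⟨0, @MeasurableSet.univ _ (noise P U (Iio 0) 1).toMS⟩

theorem isPiSystem_noiseCylinders : IsPiSystem (noiseCylinders P U) := by
  rintro A ⟨m, hA⟩ B ⟨n, hB⟩ _
  refine ⟨max m n, MeasurableSet.inter ?_ ?_⟩
  · exact noise_mono (Iio_subset_Iio (le_max_left m n)) le_rfl A hA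
  · exact noise_mono (Iio_subset_Iio (le_max_right m n)) le_rfl B hB

theorem noise_univ_eq (hU : ∀ k, Measurable (U k)) :
    noise P U univ 1 = closure (MeasurableSpace.generateFrom (noiseCylinders P U)) P := by
  refine le_antisymm (closure_mono (iSup₂_le fun k _ => ?_)) (closure_le ?_)
  · intro A hA
    have h : MeasurableSpace.comap (fun ω => min (U k ω) 1) inferInstance ≤
        ⨆ j ∈ Iio (k + 1), MeasurableSpace.comap (fun ω => min (U j ω) 1) inferInstance :=
      le_iSup₂_of_le k (mem_Iio.2 k.lt_succ_self) le_rfl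
    exact MeasurableSpace.measurableSet_generateFrom
      ⟨k + 1, le_closure (noise_le hU) A (h A hA)⟩
  · refine MeasurableSpace.generateFrom_le ?_
    rintro A ⟨m, hA⟩
    exact noise_mono (subset_univ _) le_rfl A hA

end SubSigmaField

end SigmaFields

namespace SigmaFields

namespace SubSigmaField

variable {Ω : Type*} [mΩ : MeasurableSpace Ω] {P : Measure Ω} [IsProbabilityMeasure P]

open unitInterval

variable {U : ℕ → Ω → I} {M : SubSigmaField P}

/-! ### Continuity of the noise in its truncation level, and negligibility of its tails. -/

theorem tendsto_norm_proj_noise (hU : ∀ k, Measurable (U k)) (hi : iIndepFun U P)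
    (hlaw : ∀ k, P.map (U k) = volume) (S : Set ℕ) (a : I) {A : Set Ω}
    (hA : A ∈ noiseCylinders P U) :
    Filter.Tendsto (fun b => ‖(noise P U S b).proj (indLp P A) -
      (noise P U S a).proj (indLp P A)‖) (𝓝 a) (𝓝 0) := by
  obtain ⟨m, hA⟩ := hA
  have hf : (S ∩ Iio m).Finite := (finite_Iio m).inter_of_right S
  have h := tendsto_norm_proj_noise_finset hU hi hlaw hf.toFinset a (indLp P A)
  rw [hf.coe_toFinset] at h
  refine h.congr fun b => ?_
  rw [proj_noise_inter hU hi S (Iio m) b hA, proj_noise_inter hU hi S (Iio m) a hA]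

/-- With l a neighbourhood filter in T and c the time change, this is the continuity of the
perturbed filtration. -/
theorem tendsto_sup_noise (hU : ∀ k, Measurable (U k)) (hi : iIndepFun U P)
    (hlaw : ∀ k, P.map (U k) = volume) (hM : Indep M.toMS (noise P U univ 1).toMS P)
    {α : Type*} {l : Filter α} {E : α → SubSigmaField P} {E₀ : SubSigmaField P}
    (hE : ∀ x, E x ≤ M) (hE₀ : E₀ ≤ M) (h : Filter.Tendsto E l (𝓝 E₀)) (S : Set ℕ)
    {c : α → I} {c₀ : I} (hc : Filter.Tendsto c l (𝓝 c₀)) :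
    Filter.Tendsto (fun x => E x ⊔ noise P U S (c x)) l (𝓝 (E₀ ⊔ noise P U S c₀)) := by
  rw [tendsto_iff_proj]
  intro f
  rw [tendsto_iff_norm_sub_tendsto_zero]
  refine tendsto_norm_proj_sup_sub hM (E := E) (E' := fun _ => E₀)
    (D := fun x => noise P U S (c x)) (D' := fun _ => noise P U S c₀) hE (fun _ => hE₀)
    (fun x => noise_mono (subset_univ S) unitInterval.le_one')
    (fun x => noise_mono (subset_univ S) unitInterval.le_one') (fun A _ => ?_)
    isPiSystem_noiseCylinders univ_mem_noiseCylinders (noise_univ_eq hU)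
    (fun B hB => measurableSet_of_mem_noiseCylinders hB) (fun B hB => ?_) f
  · exact tendsto_iff_norm_sub_tendsto_zero.1 (tendsto_iff_proj.1 h _)
  · exact (tendsto_norm_proj_noise hU hi hlaw S c₀ hB).comp hc

/-- Adjoining a distant tail of the noise has asymptotically no effect, uniformly. -/
theorem tendsto_norm_proj_sup_noise_Ici (hU : ∀ k, Measurable (U k)) (hi : iIndepFun U P)
    (hM : Indep M.toMS (noise P U univ 1).toMS P)
    {α : Type*} {l : Filter α} {E : α → SubSigmaField P} (hE : ∀ x, E x ≤ M)
    {n : α → ℕ} (hn : Filter.Tendsto n l Filter.atTop) (c : α → I) (f : Lp ℝ 2 P) :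
    Filter.Tendsto (fun x => ‖(E x ⊔ noise P U (Ici (n x)) (c x)).proj f - (E x).proj f‖)
      l (𝓝 0) := by
  have hE' : ∀ x, E x ⊔ noise P U ∅ 0 = E x := fun x =>
    le_antisymm (sup_le' le_rfl (noise_empty_le _ _)) (le_sup_left' _ _)
  have h := tendsto_norm_proj_sup_sub hM (l := l) (E := E) (E' := E)
    (D := fun x => noise P U (Ici (n x)) (c x)) (D' := fun _ => noise P U ∅ 0) hE hE
    (fun x => noise_mono (subset_univ _) unitInterval.le_one')
    (fun x => noise_mono (subset_univ _) unitInterval.le_one')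
    (fun A _ => by simp only [sub_self, norm_zero]; exact tendsto_const_nhds)
    isPiSystem_noiseCylinders univ_mem_noiseCylinders (noise_univ_eq hU)
    (fun B hB => measurableSet_of_mem_noiseCylinders hB) (fun B hB => ?_) f
  · simpa only [hE'] using h
  · obtain ⟨m, hB⟩ := hB
    -- Once n x ≥ m, the tail shares no variable with B and both projections agree exactly.
    refine tendsto_const_nhds.congr' ?_
    filter_upwards [hn.eventually_ge_atTop m] with x hx
    have h0 : Ici (n x) ∩ Iio m = ∅ := by
      ext k
      simp only [mem_inter_iff, mem_Ici, mem_Iio, mem_empty_iff_false, iff_false]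
      omega
    rw [proj_noise_inter hU hi _ _ _ hB, h0,
      le_antisymm (noise_empty_le (c x) (noise P U ∅ 0)) (noise_empty_le 0 (noise P U ∅ (c x))),
      sub_self, norm_zero]

/-! ### The energy of patterns -/

theorem measureReal_preimage_Ico (hU : ∀ k, Measurable (U k))
    (hlaw : ∀ k, P.map (U k) = volume) (k : ℕ) {a b : I} (hab : a ≤ b) :
    P.real (U k ⁻¹' Ico a b) = b - a := by
  rw [Measure.real, ← Measure.map_apply (hU k) measurableSet_Ico, hlaw k,
    unitInterval.volume_Ico, ENNReal.toReal_ofReal (sub_nonneg.2 hab)]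

theorem measureReal_preimage_Ici (hU : ∀ k, Measurable (U k))
    (hlaw : ∀ k, P.map (U k) = volume) (k : ℕ) (a : I) :
    P.real (U k ⁻¹' Ici a) = 1 - a := by
  rw [Measure.real, ← Measure.map_apply (hU k) measurableSet_Ici, hlaw k,
    unitInterval.volume_Ici, ENNReal.toReal_ofReal (sub_nonneg.2 a.2.2)]

/-- The event {U k ≥ a} is an atom of the σ-field of min (U k) a and contains {a ≤ U k < b}, whose
conditional probability on it is (b - a) / (1 - a). -/
theorem proj_noise_indLp_Ico (hU : ∀ k, Measurable (U k))
    (hlaw : ∀ k, P.map (U k) = volume) (k : ℕ) {a b : I} (hab : a ≤ b) (ha : a < 1) :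
    (noise P U {k} a).proj (indLp P (U k ⁻¹' Ico a b)) =
      (((b : ℝ) - a) / (1 - a)) • indLp P (U k ⁻¹' Ici a) := by
  have ha' : (0 : ℝ) < 1 - a := sub_pos.2 ha
  have hm : MeasurableSpace.comap (fun ω => min (U k ω) a) inferInstance ≤ mΩ :=
    ((hU k).min measurable_const).comap_le
  have hn : noise P U {k} a =
      closure (MeasurableSpace.comap (fun ω => min (U k ω) a) inferInstance) P := by
    rw [noise, iSup_singleton]
  have hG : MeasurableSet (U k ⁻¹' Ici a) := hU k measurableSet_Ici
  have hD : MeasurableSet (U k ⁻¹' Ico a b) := hU k measurableSet_Ico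
  have hGm : MeasurableSet[(noise P U {k} a).toMS] (U k ⁻¹' Ici a) := by
    rw [hn]
    refine le_closure hm _ ⟨Ici a, measurableSet_Ici, ?_⟩
    ext ω
    simp
  refine proj_eq_of_inner _ ?_ fun w hw => ?_
  · exact (((aestronglyMeasurable_indLp _ hGm).const_smul _)).congr (Lp.coeFn_smul _ _).symm
  rw [hn] at hw
  have hw' := aestronglyMeasurable_of_closure hm hw
  set d : Lp ℝ 2 P := indLp P (U k ⁻¹' Ico a b) -
    (((b : ℝ) - a) / (1 - a)) • indLp P (U k ⁻¹' Ici a) with hd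
  let V : Submodule ℝ (Lp ℝ 2 P) := LinearMap.ker (innerSL ℝ d).toLinearMap
  have hV : IsClosed (V : Set (Lp ℝ 2 P)) := (innerSL ℝ d).isClosed_ker
  have key : ∀ s, MeasurableSet[MeasurableSpace.comap (fun ω => min (U k ω) a) inferInstance] s →
      indLp P s ∈ V := by
    rintro _ ⟨B, hB, rfl⟩
    have hs : MeasurableSet ((fun ω => min (U k ω) a) ⁻¹' B) := hm _ ⟨B, hB, rfl⟩
    change inner ℝ d _ = 0
    rw [hd, inner_sub_left, real_inner_smul_left, inner_indLp hD hs, inner_indLp hG hs]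
    -- A set of this σ-field contains all of {U k ≥ a} or misses it, according to whether a ∈ B.
    by_cases haB : a ∈ B
    · have h1 : U k ⁻¹' Ico a b ∩ (fun ω => min (U k ω) a) ⁻¹' B = U k ⁻¹' Ico a b := by
        refine inter_eq_left.2 fun ω hω => ?_
        have : a ≤ U k ω := hω.1
        simpa [this] using haB
      have h2 : U k ⁻¹' Ici a ∩ (fun ω => min (U k ω) a) ⁻¹' B = U k ⁻¹' Ici a := by
        refine inter_eq_left.2 fun ω hω => ?_
        have : a ≤ U k ω := hω
        simpa [this] using haB
      rw [h1, h2, measureReal_preimage_Ico hU hlaw k hab, measureReal_preimage_Ici hU hlaw]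
      field_simp
      ring
    · have h2 : U k ⁻¹' Ici a ∩ (fun ω => min (U k ω) a) ⁻¹' B = ∅ := by
        refine eq_empty_of_forall_notMem fun ω hω => haB ?_
        have : a ≤ U k ω := hω.1
        simpa [this] using hω.2
      have h1 : U k ⁻¹' Ico a b ∩ (fun ω => min (U k ω) a) ⁻¹' B = ∅ :=
        subset_empty_iff.1 (h2 ▸ inter_subset_inter_left _
          (preimage_mono fun x hx => hx.1))
      rw [h1, h2]
      simp
  exact mem_of_aestronglyMeasurable hV hm
    (@MeasurableSpace.generateFrom_measurableSet _ (_)).symm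
    (@MeasurableSpace.isPiSystem_measurableSet _ (_)) (key _ MeasurableSet.univ) key hw'

/-- The event that `U k` does (`x = true`) or does not (`x = false`) belong to `[a, b)`. -/
def noiseEvent (U : ℕ → Ω → I) (a b : I) (k : ℕ) (x : Bool) : Set Ω :=
  {ω | (U k ω ∈ Ico a b) ↔ x = true}

theorem noiseEvent_true (a b : I) (k : ℕ) : noiseEvent U a b k true = U k ⁻¹' Ico a b := by
  ext ω
  simp [noiseEvent]

theorem noiseEvent_false (a b : I) (k : ℕ) :
    noiseEvent U a b k false = (U k ⁻¹' Ico a b)ᶜ := by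
  ext ω
  simp only [noiseEvent, mem_ofPred_eq, mem_compl_iff, mem_preimage, Bool.false_eq_true, iff_false]

theorem measurableSet_noiseEvent (hU : ∀ k, Measurable (U k)) {S : Set ℕ} {k : ℕ} (hk : k ∈ S)
    {a b c : I} (hbc : b ≤ c) (x : Bool) :
    MeasurableSet[(noise P U S c).toMS] (noiseEvent U a b k x) := by
  have h : MeasurableSet[(noise P U S c).toMS] (U k ⁻¹' Ico a b) := by
    refine le_closure (noise_le hU) _ ?_
    have h1 : MeasurableSpace.comap (fun ω => min (U k ω) b) inferInstance ≤
        ⨆ j ∈ S, MeasurableSpace.comap (fun ω => min (U j ω) c) inferInstance :=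
      (comap_min_le_comap k hbc).trans (le_iSup₂_of_le k hk le_rfl)
    by_cases hab : a ≤ b
    · refine h1 _ ⟨Ico a b, measurableSet_Ico, ?_⟩
      ext ω
      simp [hab]
    · rw [Ico_eq_empty_of_le (not_le.1 hab).le, preimage_empty]
      exact @MeasurableSet.empty _ (_)
  cases x
  · rw [noiseEvent_false]
    exact h.compl
  · rwa [noiseEvent_true]

/-- With r = (b - a) / (1 - a) the energy of the two-cell partition is 1 - 2 (1 - a) r (1 - r), and
0 < r < 1 because a < b < 1. It is the same for all k since the variables have the same law. -/
theorem norm_proj_noiseEvent_sq (hU : ∀ k, Measurable (U k))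
    (hlaw : ∀ k, P.map (U k) = volume) {a b : I} (hab : a < b) (hb : b < 1) :
    ∃ e : Bool → ℝ, e true + e false < 1 ∧
      ∀ k x, ‖(noise P U {k} a).proj (indLp P (noiseEvent U a b k x))‖ ^ 2 = e x := by
  have ha' : (0 : ℝ) < 1 - a := sub_pos.2 (hab.trans hb)
  have hab' : (0 : ℝ) < b - a := sub_pos.2 hab
  have hb' : (0 : ℝ) < 1 - b := sub_pos.2 hb
  set r : ℝ := ((b : ℝ) - a) / (1 - a) with hr
  have hra : r * (1 - a) = b - a := by
    rw [hr]
    field_simp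
  have h1 : ∀ k, ‖(noise P U {k} a).proj (indLp P (noiseEvent U a b k true))‖ ^ 2 =
      r ^ 2 * (1 - a) := by
    intro k
    rw [noiseEvent_true, proj_noise_indLp_Ico hU hlaw k hab.le (hab.trans hb), norm_smul, mul_pow,
      norm_indLp_sq (hU k measurableSet_Ici), measureReal_preimage_Ici hU hlaw, Real.norm_eq_abs,
      sq_abs]
  have h2 : ∀ k, ‖(noise P U {k} a).proj (indLp P (noiseEvent U a b k false))‖ ^ 2 =
      1 - 2 * (r * (1 - a)) + r ^ 2 * (1 - a) := by
    intro k
    have hu : AEStronglyMeasurable[(noise P U {k} a).toMS] (indLp P univ) P :=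
      aestronglyMeasurable_indLp _ (@MeasurableSet.univ _ (noise P U {k} a).toMS)
    rw [noiseEvent_false, indLp_compl (hU k measurableSet_Ico), map_sub,
      (proj_eq_self _).2 hu, norm_sub_sq_real, norm_indLp_sq MeasurableSet.univ,
      ← noiseEvent_true (U := U), h1 k, noiseEvent_true,
      proj_noise_indLp_Ico hU hlaw k hab.le (hab.trans hb), real_inner_smul_right,
      inner_indLp MeasurableSet.univ (hU k measurableSet_Ici), univ_inter,
      measureReal_preimage_Ici hU hlaw]
    simp [hr]
  refine ⟨fun x => if x then r ^ 2 * (1 - a) else 1 - 2 * (r * (1 - a)) + r ^ 2 * (1 - a),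
    ?_, fun k x => ?_⟩
  · have hr0 : 0 < r := div_pos hab' ha'
    have hr1 : r < 1 := by
      rw [hr, div_lt_one ha']
      linarith
    have : r ^ 2 * (1 - a) < r * (1 - a) := by
      refine mul_lt_mul_of_pos_right ?_ ha'
      nlinarith
    simp only [if_true, Bool.false_eq_true, if_false]
    linarith
  · cases x
    · simpa using h2 k
    · simpa using h1 k

/-- Energies multiply over independent coordinates, as norms of tensors do. -/
theorem norm_proj_noise_pattern_sq (hU : ∀ k, Measurable (U k)) (hi : iIndepFun U P) {a b : I}
    {e : Bool → ℝ}
    (he : ∀ k x, ‖(noise P U {k} a).proj (indLp P (noiseEvent U a b k x))‖ ^ 2 = e x) (n N : ℕ)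
    (β : Fin N → Bool) :
    MeasurableSet[(noise P U (Ico n (n + N)) 1).toMS]
        {ω | ∀ i : Fin N, ω ∈ noiseEvent U a b (n + i) (β i)} ∧
      ‖(noise P U (Ico n (n + N)) a).proj
        (indLp P {ω | ∀ i : Fin N, ω ∈ noiseEvent U a b (n + i) (β i)})‖ ^ 2 =
      ∏ i, e (β i) := by
  induction N with
  | zero =>
    have h : {ω | ∀ i : Fin 0, ω ∈ noiseEvent U a b (n + i) (β i)} = univ :=
      eq_univ_of_forall fun ω i => i.elim0
    rw [h]
    refine ⟨@MeasurableSet.univ _ (_), ?_⟩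
    rw [(proj_eq_self _).2 (aestronglyMeasurable_indLp _ (@MeasurableSet.univ _ (_))),
      norm_indLp_sq MeasurableSet.univ]
    simp
  | succ N ih =>
    have h : {ω | ∀ i : Fin (N + 1), ω ∈ noiseEvent U a b (n + i) (β i)} =
        {ω | ∀ i : Fin N, ω ∈ noiseEvent U a b (n + i) (β i.castSucc)} ∩
          noiseEvent U a b (n + N) (β (Fin.last N)) := by
      ext ω
      simp [Fin.forall_fin_succ']
    have hI : Ico n (n + (N + 1)) = Ico n (n + N) ∪ {n + N} := by
      ext k
      simp only [mem_Ico, mem_union, mem_singleton_iff]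
      omega
    have hd : Disjoint (Ico n (n + N)) {n + N} := by simp
    obtain ⟨ih1, ih2⟩ := ih fun i => β i.castSucc
    have h1 : MeasurableSet[(noise P U {n + N} 1).toMS]
        (noiseEvent U a b (n + N) (β (Fin.last N))) :=
      measurableSet_noiseEvent hU (mem_singleton _) unitInterval.le_one' _
    rw [h, hI]
    have hl : noise P U (Ico n (n + N)) 1 ≤ noise P U (Ico n (n + N) ∪ {n + N}) 1 :=
      noise_mono subset_union_left le_rfl
    have hr : noise P U {n + N} 1 ≤ noise P U (Ico n (n + N) ∪ {n + N}) 1 :=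
      noise_mono subset_union_right le_rfl
    refine ⟨(hl _ ih1).inter (hr _ h1), ?_⟩
    have hMN := indep_noise (P := P) hU hi hd 1 1
    rw [noise_union hU, ← tensor_indLp ((SubSigmaField.le _) _ ih1) ((SubSigmaField.le _) _ h1),
      proj_sup_tensor hMN (noise_mono subset_rfl unitInterval.le_one')
        (noise_mono subset_rfl unitInterval.le_one') (aestronglyMeasurable_indLp _ ih1)
        (aestronglyMeasurable_indLp _ h1),
      norm_tensor hMN ((aestronglyMeasurable_proj _ _).mono
          (noise_mono subset_rfl unitInterval.le_one'))
        ((aestronglyMeasurable_proj _ _).mono (noise_mono subset_rfl unitInterval.le_one')),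
      mul_pow, ih2, he, Fin.prod_univ_castSucc]

/-- Truncation at b reveals whether U k ∈ [a, b), truncation at a does not. The partition by N such
events has energy (e true + e false)^N, which tends to 0; M and the other coordinates are
independent of these events and change nothing. -/
theorem relNonatomic_noise (hU : ∀ k, Measurable (U k)) (hi : iIndepFun U P)
    (hlaw : ∀ k, P.map (U k) = volume) (hM : Indep M.toMS (noise P U univ 1).toMS P)
    {a b : I} (hab : a < b) (hb : b < 1) (n : ℕ) :
    RelNonatomic (M ⊔ noise P U univ a) (noise P U (Ici n) b) := by
  intro ε hε
  obtain ⟨e, he1, he⟩ := norm_proj_noiseEvent_sq (P := P) hU hlaw hab hb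
  obtain ⟨N, hN⟩ := exists_pow_lt_of_lt_one hε he1
  classical
  let φ : Ω → Fin N → Bool := fun ω i => decide (U (n + i) ω ∈ Ico a b)
  have hφ : ∀ β : Fin N → Bool,
      φ ⁻¹' {β} = {ω | ∀ i : Fin N, ω ∈ noiseEvent U a b (n + i) (β i)} := by
    intro β
    ext ω
    simp only [φ, mem_preimage, mem_singleton_iff, funext_iff, noiseEvent, mem_ofPred_eq]
    refine forall_congr' fun i => ?_
    cases β i <;> simp
  refine ⟨N, φ, ?_, lt_of_eq_of_lt ?_ hN⟩
  · refine @measurable_pi_lambda _ _ _ (_) _ _ fun i => @measurable_to_bool _ (_) _ ?_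
    have : (fun ω => φ ω i) ⁻¹' {true} = noiseEvent U a b (n + i) true := by
      ext ω
      simp [φ, noiseEvent]
    rw [this]
    exact measurableSet_noiseEvent hU (by simp) le_rfl true
  · have hc : e true + e false = ∑ x, e x := by simp
    rw [hc, Fintype.sum_pow]
    refine Finset.sum_congr rfl fun β _ => ?_
    obtain ⟨h1, h2⟩ := norm_proj_noise_pattern_sq hU hi he n N β
    have hcomm : M ⊔ noise P U univ a = noise P U univ a ⊔ M :=
      ext' (sup_comm M.toMS (noise P U univ a).toMS)
    rw [hφ, hcomm, proj_sup_of_indep hM.symm (noise_mono subset_rfl unitInterval.le_one') le_rfl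
      (noise_mono (subset_univ _) le_rfl _ h1), proj_noise_inter hU hi univ _ a h1, univ_inter, h2]

/-- A sub-σ-field `M` such that the whole space is nonatomic relative to `M` admits an independent
sequence of independent uniformly distributed random variables. -/
theorem RelNonatomic.exists_noise [StandardBorelSpace Ω] (h : RelNonatomic M ⊤) :
    ∃ U : ℕ → Ω → I, (∀ k, Measurable (U k)) ∧ iIndepFun U P ∧ (∀ k, P.map (U k) = volume) ∧
      Indep M.toMS (noise P U univ 1).toMS P := by
  obtain ⟨V, hV, hlaw, hi, -⟩ := h.exists_uniform (le_top' M)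
  have hV : Measurable V := hV
  -- A single uniform variable carries a whole independent sequence of them: f pushes Lebesgue
  -- measure to the infinite product.
  obtain ⟨f, hf, hmap⟩ := Measure.exists_measurable_map_eq
    (Measure.infinitePi fun _ : ℕ => (volume : Measure I))
  have hfk : ∀ k, Measurable fun x => f x k := fun k => (measurable_pi_apply k).comp hf
  have hUm : ∀ k, Measurable fun ω => f (V ω) k := fun k => (hfk k).comp hV
  have hjoint : P.map (fun ω => f (V ω)) = Measure.infinitePi fun _ : ℕ => (volume : Measure I) := by
    rw [← hmap, ← hlaw, Measure.map_map hf hV]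
    rfl
  have hk : ∀ k, P.map (fun ω => f (V ω) k) = volume := by
    intro k
    rw [← Measure.infinitePi_map_eval (fun _ : ℕ => (volume : Measure I)) k, ← hjoint,
      Measure.map_map (g := fun x : ℕ → I => x k) (f := fun ω => f (V ω))
        (measurable_pi_apply k) (hf.comp hV)]
    rfl
  refine ⟨fun k ω => f (V ω) k, hUm, ?_, hk, ?_⟩
  · rw [iIndepFun_iff_map_fun_eq_infinitePi_map hUm]
    simp_rw [hk]
    exact hjoint
  · have h1 := indep_closure hi
    rw [closure_toMS] at h1
    refine indep_of_indep_of_le_right h1 (closure_mono (iSup₂_le fun k _ => ?_))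
    have h2 : Measurable[MeasurableSpace.comap V inferInstance] fun ω => min (f (V ω) k) 1 :=
      ((hfk k).min measurable_const).comp (comap_measurable V)
    exact h2.comap_le

end SubSigmaField

end SigmaFields

namespace SigmaFields

/-! ### Density of conditionally nonatomic filtrations -/

/-- Continuous convergence implies convergence in the compact-open topology. -/
theorem tendsto_continuousMap_of_tendsto_prod {α X Y : Type*} [TopologicalSpace X]
    [TopologicalSpace Y] {l : Filter α} {f : α → C(X, Y)} {g : C(X, Y)}
    (h : ∀ x, Filter.Tendsto (fun p : α × X => f p.1 p.2) (l ×ˢ 𝓝 x) (𝓝 (g x))) :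
    Filter.Tendsto f l (𝓝 g) := by
  rw [ContinuousMap.tendsto_nhds_compactOpen]
  intro K hK V hV hgV
  have h1 : {p : α × X | f p.1 p.2 ∈ V} ∈ l ×ˢ 𝓝ˢ K :=
    hK.mem_prod_nhdsSet_of_forall fun x hx => h x (hV.mem_nhds (hgV hx))
  obtain ⟨s, hs, t, ht, hst⟩ := Filter.mem_prod_iff.1 h1
  filter_upwards [hs] with a ha x hx
  exact @hst (a, x) ⟨ha, subset_of_mem_nhdsSet ht hx⟩

/-- A strictly increasing continuous time change, starting at zero and bounded by one half. -/
theorem exists_timeChange {T : Set ℝ≥0∞} {t₀ : T} (h₀ : ∀ t : T, t₀ ≤ t) :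
    ∃ h : T → unitInterval, Continuous h ∧ StrictMono h ∧ h t₀ = 0 ∧
      ∀ t, (h t : ℝ) ≤ 1 / 2 := by
  let e := ENNReal.orderIsoUnitIntervalBirational
  have he : Continuous e := e.continuous
  have hm : ∀ t : T, (e t₀ : ℝ) ≤ e t := fun t => e.monotone (h₀ t)
  refine ⟨fun t => ⟨((e t : ℝ) - e t₀) / 2, ?_, ?_⟩, ?_, ?_, ?_, ?_⟩
  · have := hm t
    linarith
  · have := (e t).2.2
    have := (e t₀).2.1
    linarith
  · refine Continuous.subtype_mk ?_ _
    have : Continuous fun t : T => ((e t : unitInterval) : ℝ) :=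
      continuous_subtype_val.comp (he.comp continuous_subtype_val)
    fun_prop
  · intro s t hst
    have h1 : (e s : ℝ) < e t := e.strictMono hst
    refine Subtype.mk_lt_mk.2 ?_
    linarith
  · refine Subtype.ext ?_
    simp
  · intro t
    have := (e t).2.2
    have := (e t₀).2.1
    change ((e t : ℝ) - e t₀) / 2 ≤ 1 / 2
    linarith

open SubSigmaField

variable {Ω : Type*} [mΩ : MeasurableSpace Ω] [StandardBorelSpace Ω] {P : Measure Ω}
  [IsProbabilityMeasure P] {T : Set ℝ≥0∞}

theorem mem_cnaFiltrations_iff {F : filtrationSpace P T} :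
    F ∈ cnaFiltrations P T ↔
      ∀ s t : T, s < t → RelNonatomic (F.1 s : SubSigmaField P) (F.1 t) := by
  refine forall_congr' fun s => forall_congr' fun t => forall_congr' fun hst => ?_
  rw [isNonatomicOver_iff]
  exact and_iff_right (F.2.1 s t hst.le)

theorem dense_cnaFiltrations (hT : IsCompact T) : Dense (cnaFiltrations P T) := by
  rcases T.eq_empty_or_nonempty with hem | hne
  · have h : cnaFiltrations P T = univ := by
      refine eq_univ_of_forall fun F s => ?_
      exact (eq_empty_iff_forall_notMem.1 hem s s.2).elim
    rw [h]
    exact dense_univ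
  obtain ⟨t₀, ht₀⟩ := hT.exists_isLeast hne
  obtain ⟨t₁, ht₁⟩ := hT.exists_isGreatest hne
  intro F
  -- One noise, independent of the last field, serves all times at once.
  let M : SubSigmaField P := F.1 ⟨t₁, ht₁.1⟩
  have hFM : ∀ t : T, (F.1 t : SubSigmaField P) ≤ M := fun t => F.2.1 t ⟨t₁, ht₁.1⟩ (ht₁.2 t.2)
  have hMna : RelNonatomic M ⊤ := mem_condNonatomic_iff.1 (F.1 ⟨t₁, ht₁.1⟩).2
  obtain ⟨U, hU, hi, hlaw, hM⟩ := hMna.exists_noise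
  obtain ⟨h, hc, hmono, h0, hhalf⟩ := exists_timeChange (t₀ := ⟨t₀, ht₀.1⟩) fun t => ht₀.2 t.2
  have hone : ∀ t, h t < 1 := fun t => by
    rw [← Subtype.coe_lt_coe]
    exact (hhalf t).trans_lt (by norm_num)
  have hrel : ∀ (n : ℕ) (t : T) (b : unitInterval), h t < b → b < 1 →
      RelNonatomic ((F.1 t : SubSigmaField P) ⊔ noise P U (Ici n) (h t)) (noise P U (Ici n) b) :=
    fun n t b hb hb1 => (relNonatomic_noise hU hi hlaw hM hb hb1 n).mono
      (sup_le_sup' (hFM t) (noise_mono (subset_univ _) le_rfl)) le_rfl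
  have hX : ∀ (n : ℕ) (t : T),
      (F.1 t : SubSigmaField P) ⊔ noise P U (Ici n) (h t) ∈ condNonatomic P := by
    intro n t
    rw [mem_condNonatomic_iff]
    -- Any level strictly between 1/2 and 1 would do: the noise between h t and this level is left
    -- over and witnesses conditional nonatomicity of the perturbed field.
    have hb : h t < ⟨3 / 4, by norm_num, by norm_num⟩ := by
      rw [← Subtype.coe_lt_coe]
      exact (hhalf t).trans_lt (by norm_num)
    have hb1 : (⟨3 / 4, by norm_num, by norm_num⟩ : unitInterval) < 1 := by
      rw [← Subtype.coe_lt_coe]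
      norm_num
    exact (hrel n t _ hb hb1).mono le_rfl (le_top' _)
  let H : ℕ → C(T, condNonatomic P) := fun n =>
    { toFun := fun t => ⟨_, hX n t⟩
      continuous_toFun := by
        refine Continuous.subtype_mk (continuous_iff_continuousAt.2 fun t => ?_) _
        exact tendsto_sup_noise hU hi hlaw hM hFM (hFM t)
          ((continuous_subtype_val.comp F.1.continuous).tendsto t) (Ici n) (hc.tendsto t) }
  have hHapp : ∀ n t, (H n t : SubSigmaField P) =
      (F.1 t : SubSigmaField P) ⊔ noise P U (Ici n) (h t) := fun n t => rfl
  have hHmem : ∀ n, H n ∈ filtrationSpace P T := by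
    refine fun n => ⟨fun s t hst => ?_, fun t ht => ?_⟩
    · rw [hHapp, hHapp]
      exact sup_le_sup' (F.2.1 s t hst) (noise_mono subset_rfl (hmono.monotone hst))
    · have htt : t = ⟨t₀, ht₀.1⟩ := Subtype.ext (ht.unique ht₀)
      -- At the least time h = 0, so the truncated variables are constant and the initial field
      -- stays trivial.
      have hle : (H n t : SubSigmaField P) ≤ F.1 t := by
        rw [hHapp, htt, h0]
        exact sup_le' le_rfl (noise_zero_le _ _)
      exact fun s hs => F.2.2 t ht s (hle s hs)
  have hHcna : ∀ n, (⟨H n, hHmem n⟩ : filtrationSpace P T) ∈ cnaFiltrations P T := by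
    intro n
    rw [mem_cnaFiltrations_iff]
    intro s t hst
    exact (hrel n s (h t) (hmono hst) (hone t)).mono le_rfl (le_sup_right' _ _)
  have hlim : Filter.Tendsto (fun n => (⟨H n, hHmem n⟩ : filtrationSpace P T)) Filter.atTop
      (𝓝 F) := by
    rw [tendsto_subtype_rng]
    refine tendsto_continuousMap_of_tendsto_prod fun t => ?_
    rw [tendsto_subtype_rng, tendsto_iff_proj]
    intro f
    -- The time varies together with n, which yields convergence in the compact-open topology and
    -- not just at each time.
    have h1 := tendsto_norm_proj_sup_noise_Ici hU hi hM (l := Filter.atTop ×ˢ 𝓝 t)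
      (E := fun p : ℕ × T => (F.1 p.2 : SubSigmaField P)) (fun p => hFM p.2)
      (n := fun p => p.1) Filter.tendsto_fst (fun p => h p.2) f
    have h2 : Filter.Tendsto (fun p : ℕ × T => (F.1 p.2 : SubSigmaField P).proj f)
        (Filter.atTop ×ˢ 𝓝 t) (𝓝 ((F.1 t : SubSigmaField P).proj f)) :=
      (((continuous_proj f).comp (continuous_subtype_val.comp F.1.continuous)).tendsto t).comp
        Filter.tendsto_snd
    have h3 := (tendsto_zero_iff_norm_tendsto_zero.2 h1).add h2
    simp only [sub_add_cancel, zero_add] at h3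
    exact h3
  exact mem_closure_of_tendsto hlim (Filter.Eventually.of_forall hHcna)

end SigmaFields

namespace SigmaFields

open SubSigmaField

variable {Ω : Type*} [mΩ : MeasurableSpace Ω] [StandardBorelSpace Ω] {P : Measure Ω}
  [IsProbabilityMeasure P] {T : Set ℝ≥0∞}

/-! ### Spaces of filtrations are Polish -/

namespace SubSigmaField

theorem isGδ_condNonatomic : IsGδ (condNonatomic P) := by
  have h : condNonatomic P =
      ⋂ n : ℕ, (fun E => (E, (⊤ : SubSigmaField P))) ⁻¹' nearlyRelNonatomic P (1 / (n + 1)) := by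
    ext E
    rw [mem_condNonatomic_iff, relNonatomic_iff, mem_iInter]
    rfl
  rw [h]
  refine IsGδ.iInter fun n => IsOpen.isGδ ?_
  exact (isOpen_nearlyRelNonatomic _).preimage (by fun_prop)

instance : PolishSpace (condNonatomic P) := polishSpace_of_isGδ isGδ_condNonatomic

/-- For the converse, projecting 1_A without loss of norm must fix it, by Pythagoras. The order is
thereby expressed by closed conditions. -/
theorem le_iff_norm_proj_le {E F : SubSigmaField P} :
    E ≤ F ↔ ∀ f, ‖E.proj f‖ ≤ ‖F.proj f‖ := by
  constructor
  · intro h f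
    rw [← proj_proj_of_le h]
    exact norm_proj_le _ _
  · intro h A hA
    rw [measurableSet_iff_proj F (E.le A hA)]
    have h1 := h (indLp P A)
    rw [(measurableSet_iff_proj E (E.le A hA)).1 hA] at h1
    have h2 := norm_proj_sq F (indLp P A)
    rw [infDist_eq] at h2
    have h3 : ‖indLp P A‖ ^ 2 ≤ ‖F.proj (indLp P A)‖ ^ 2 := by gcongr
    have h4 : ‖indLp P A - F.proj (indLp P A)‖ ^ 2 ≤ 0 := by linarith
    have h5 : ‖indLp P A - F.proj (indLp P A)‖ = 0 :=
      pow_eq_zero_iff two_ne_zero |>.1 (le_antisymm h4 (sq_nonneg _))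
    exact (sub_eq_zero.1 (norm_eq_zero.1 h5)).symm

instance : OrderClosedTopology (SubSigmaField P) where
  isClosed_le' := by
    simp only [le_iff_norm_proj_le, ofPred_forall]
    exact isClosed_iInter fun f => isClosed_le
      ((continuous_proj f).comp continuous_fst).norm ((continuous_proj f).comp continuous_snd).norm

/-- Triviality becomes an order condition, hence closed. -/
theorem isTrivial_iff {E : SubSigmaField P} : E.IsTrivial ↔ E ≤ closure ⊥ P := by
  constructor
  · intro h s hs
    refine ⟨E.le s hs, ?_⟩
    rcases h s hs with h0 | h1
    · exact ⟨∅, @MeasurableSet.empty _ ⊥, ae_eq_empty.2 h0⟩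
    · refine ⟨univ, @MeasurableSet.univ _ ⊥, Filter.eventuallyEq_univ.2 ?_⟩
      exact (prob_compl_eq_zero_iff (E.le s hs)).2 h1
  · intro h s hs
    obtain ⟨_, t, ht, hst⟩ := h s hs
    rw [measure_congr hst]
    rcases MeasurableSpace.measurableSet_bot_iff.1 ht with rfl | rfl
    · exact Or.inl measure_empty
    · exact Or.inr measure_univ

theorem RelNonatomic.smul {E F : SubSigmaField P} (h : RelNonatomic E F) (g : Aut P) :
    RelNonatomic (g • E) (g • F) := by
  intro ε hε
  obtain ⟨N, φ, hφ, h1⟩ := h ε hε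
  refine ⟨N, φ ∘ g.pointMap, hφ.comp (measurable_pointMap_smul g F), lt_of_eq_of_lt ?_ h1⟩
  refine Finset.sum_congr rfl fun b _ => ?_
  have hb : MeasurableSet (φ ⁻¹' {b}) := F.le _ (hφ (measurableSet_singleton b))
  rw [preimage_comp, ← Aut.koopman_indLp g (Aut.mapsSet_pointMap g hb), proj_smul_koopman,
    LinearIsometry.norm_map]

theorem smul_mem_condNonatomic (g : Aut P) {E : SubSigmaField P} (hE : E ∈ condNonatomic P) :
    g • E ∈ condNonatomic P :=
  mem_condNonatomic_iff.2 (((mem_condNonatomic_iff.1 hE).smul g).mono le_rfl (le_top' _))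

end SubSigmaField

theorem continuous_eval_coe (t : T) :
    Continuous fun F : C(T, condNonatomic P) => (F t : SubSigmaField P) :=
  continuous_subtype_val.comp (continuous_eval_const t)

theorem isClosed_filtrationSpace : IsClosed (filtrationSpace P T) := by
  refine IsClosed.inter ?_ ?_
  · change IsClosed {F : C(T, condNonatomic P) |
      ∀ s t : T, s ≤ t → (F s : SubSigmaField P) ≤ F t}
    simp only [ofPred_forall]
    exact isClosed_iInter fun s => isClosed_iInter fun t => isClosed_iInter fun _ =>
      isClosed_le (continuous_eval_coe s) (continuous_eval_coe t)
  · change IsClosed {F : C(T, condNonatomic P) |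
      ∀ t : T, IsLeast T (t : ℝ≥0∞) → (F t : SubSigmaField P).IsTrivial}
    simp only [ofPred_forall, isTrivial_iff]
    exact isClosed_iInter fun t => isClosed_iInter fun _ =>
      isClosed_le (continuous_eval_coe t) continuous_const

theorem polishSpace_filtrationSpace (hT : IsCompact T) : PolishSpace (filtrationSpace P T) := by
  have : CompactSpace T := isCompact_iff_compactSpace.1 hT
  have : PolishSpace C(T, condNonatomic P) := polishSpace_continuousMap
  exact isClosed_filtrationSpace.polishSpace

/-- The tube lemma. -/
theorem isOpen_forall_mem_compact {X Y : Type*} [TopologicalSpace X] [TopologicalSpace Y]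
    {K : Set Y} (hK : IsCompact K) {V : Set (X × Y)} (hV : IsOpen V) :
    IsOpen {x | ∀ y ∈ K, (x, y) ∈ V} := by
  rw [isOpen_iff_eventually]
  intro x hx
  exact hK.eventually_forall_of_forall_eventually fun y hy => hV.mem_nhds (hx y hy)

/-- The pairs s < t do not form a compact set, but they are covered by countably many compact sets s
≤ q < q' ≤ t with q, q' in a countable dense set. On each of these an open condition holding at all
pairs is open in the filtration, evaluation being jointly continuous. -/
theorem isGδ_cnaFiltrations (hT : IsCompact T) : IsGδ (cnaFiltrations P T) := by
  have : CompactSpace T := isCompact_iff_compactSpace.1 hT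
  obtain ⟨D, hDc, hD⟩ := TopologicalSpace.exists_countable_dense ℝ≥0∞
  let V : ℕ → Set (filtrationSpace P T × (T × T)) := fun n =>
    {p | ((p.1.1 p.2.1 : SubSigmaField P), (p.1.1 p.2.2 : SubSigmaField P)) ∈
      nearlyRelNonatomic P (1 / (n + 1))}
  have hV : ∀ n, IsOpen (V n) := by
    intro n
    refine (isOpen_nearlyRelNonatomic _).preimage ?_
    refine Continuous.prodMk ?_ ?_
    · exact continuous_subtype_val.comp ((continuous_subtype_val.comp continuous_fst).eval
        (continuous_fst.comp continuous_snd))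
    · exact continuous_subtype_val.comp ((continuous_subtype_val.comp continuous_fst).eval
        (continuous_snd.comp continuous_snd))
  let K : ℝ≥0∞ → ℝ≥0∞ → Set (T × T) := fun q q' =>
    {p | (p.1 : ℝ≥0∞) ≤ q ∧ q' ≤ (p.2 : ℝ≥0∞)}
  have hK : ∀ q q', IsCompact (K q q') := by
    intro q q'
    refine IsClosed.isCompact (IsClosed.inter ?_ ?_)
    · exact isClosed_le (continuous_subtype_val.comp continuous_fst) continuous_const
    · exact isClosed_le continuous_const (continuous_subtype_val.comp continuous_snd)
  have h : cnaFiltrations P T =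
      ⋂ q ∈ D, ⋂ q' ∈ D, ⋂ (_ : q < q'), ⋂ n : ℕ, {F | ∀ p ∈ K q q', (F, p) ∈ V n} := by
    ext F
    rw [mem_cnaFiltrations_iff]
    simp only [mem_iInter]
    constructor
    · intro h q _ q' _ hqq n p hp
      exact relNonatomic_iff.1 (h p.1 p.2 (hp.1.trans_lt (hqq.trans_le hp.2))) n
    · intro h s t hst
      obtain ⟨q, hq, h1, h2⟩ := hD.exists_between hst
      obtain ⟨q', hq', h3, h4⟩ := hD.exists_between h2
      exact relNonatomic_iff.2 fun n => h q hq q' hq' h3 n (s, t) ⟨h1.le, h4.le⟩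
  rw [h]
  refine IsGδ.biInter hDc fun q _ => IsGδ.biInter hDc fun q' _ => IsGδ.iInter fun _ =>
    IsGδ.iInter fun n => IsOpen.isGδ ?_
  exact isOpen_forall_mem_compact (hK q q') (hV n)

/-! ### The action on filtrations -/

theorem cnaFiltrations_ext {x y : cnaFiltrations P T}
    (h : ∀ t, (x.1.1 t : SubSigmaField P) = y.1.1 t) : x = y :=
  Subtype.ext (Subtype.ext (ContinuousMap.ext fun t => Subtype.ext (h t)))

/-- The image of a conditionally nonatomic filtration under an automorphism. -/
noncomputable def cnaSMul (g : Aut P) (x : cnaFiltrations P T) : cnaFiltrations P T :=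
  ⟨⟨⟨fun t => ⟨g • (x.1.1 t : SubSigmaField P), smul_mem_condNonatomic g (x.1.1 t).2⟩,
      ((continuous_const_smul g).comp
        (continuous_subtype_val.comp x.1.1.continuous)).subtype_mk _⟩,
    fun s t hst => smul_mono g (x.1.2.1 s t hst), fun t ht => (x.1.2.2 t ht).smul g⟩,
    mem_cnaFiltrations_iff.2 fun s t hst => (mem_cnaFiltrations_iff.1 x.2 s t hst).smul g⟩

theorem cnaSMul_apply (g : Aut P) (x : cnaFiltrations P T) (t : T) :
    ((cnaSMul g x).1.1 t : SubSigmaField P) = g • (x.1.1 t : SubSigmaField P) := rfl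

/-- The action of `Aut P` on conditionally nonatomic filtrations. -/
noncomputable abbrev cnaMulAction (P : Measure Ω) [IsProbabilityMeasure P] (T : Set ℝ≥0∞) :
    MulAction (Aut P) (cnaFiltrations P T) where
  smul := cnaSMul
  one_smul x := cnaFiltrations_ext fun t => (cnaSMul_apply 1 x t).trans (one_smul _ _)
  mul_smul g h x := cnaFiltrations_ext fun t => (cnaSMul_apply (g * h) x t).trans (mul_smul _ _ _)

theorem continuous_cnaSMul (hT : IsCompact T) :
    Continuous fun p : Aut P × cnaFiltrations P T => cnaSMul p.1 p.2 := by
  have : CompactSpace T := isCompact_iff_compactSpace.1 hT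
  rw [IsInducing.subtypeVal.continuous_iff, IsInducing.subtypeVal.continuous_iff]
  -- Joint continuity in the automorphism, the filtration and the time suffices for the compact-open
  -- topology.
  refine ContinuousMap.continuous_of_continuous_uncurry _ ?_
  rw [IsInducing.subtypeVal.continuous_iff]
  have h1 : Continuous fun q : (Aut P × cnaFiltrations P T) × T =>
      (q.1.2.1.1 q.2 : SubSigmaField P) :=
    continuous_subtype_val.comp ((continuous_subtype_val.comp (continuous_subtype_val.comp
      (continuous_snd.comp continuous_fst))).eval continuous_snd)
  have h2 : Continuous fun q : (Aut P × cnaFiltrations P T) × T =>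
      q.1.1 • (q.1.2.1.1 q.2 : SubSigmaField P) :=
    (continuous_fst.comp continuous_fst).smul h1
  exact h2

theorem isPolishGSpace_cnaFiltrations (hT : IsCompact T) :
    letI := cnaMulAction P T
    IsPolishGSpace (Aut P) (cnaFiltrations P T) :=
  letI := cnaMulAction P T
  { isTopologicalGroup := inferInstance
    polishSpace_group := inferInstance
    polishSpace :=
      have := polishSpace_filtrationSpace (P := P) hT
      polishSpace_of_isGδ (isGδ_cnaFiltrations hT)
    continuous_smul := continuous_cnaSMul hT }

end SigmaFields

theorem theorem4 {Ω : Type*} [MeasurableSpace Ω] [StandardBorelSpace Ω]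
    (P : Measure Ω) [IsProbabilityMeasure P] [NullSingletonClass P]
    (T : Set ℝ≥0∞) (hT : IsCompact T) :
    IsGδ (SigmaFields.cnaFiltrations P T) ∧
    Dense (SigmaFields.cnaFiltrations P T) ∧
    SigmaFields.cnaFiltrations P T ∈ residual (SigmaFields.filtrationSpace P T) ∧
    ∃ _ : MulAction (SigmaFields.Aut P) (SigmaFields.cnaFiltrations P T),
      (∀ (g : SigmaFields.Aut P) (x : SigmaFields.cnaFiltrations P T) (t : T),
        ((g • x).1.1 t : SigmaFields.SubSigmaField P) =
          g • (x.1.1 t : SigmaFields.SubSigmaField P)) ∧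
      SigmaFields.IsPolishGSpace (SigmaFields.Aut P) (SigmaFields.cnaFiltrations P T) :=
  ⟨SigmaFields.isGδ_cnaFiltrations hT, SigmaFields.dense_cnaFiltrations hT,
    residual_of_dense_Gδ (SigmaFields.isGδ_cnaFiltrations hT)
      (SigmaFields.dense_cnaFiltrations hT),
    SigmaFields.cnaMulAction P T, SigmaFields.cnaSMul_apply,
    SigmaFields.isPolishGSpace_cnaFiltrations hT⟩
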